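/- **Setting.** Let $N\in\mathbb N$ and let $t_0=0<t_1<\dots<t_N$ be fixed. For every $n\in\mathbb N$ and $m=0,\dots,N$ let $w_{n,t_m}:\mathbb Z\to[0,\infty)$ be a weight and $\nu_{n,t_m}:\mathbb Z\to\mathbb R$ a function that is injective (for instance strictly monotone) on the support of $w_{n,t_m}$, with $\sum_{y}|\nu_{n,t_m}(y)|^k w_{n,t_m}(y)<\infty$ for all $k\in\mathbb N$. Write $\mu_n(t_m,x)=\nu_{n,t_m}(nx)$ for $x\in\frac1n\mathbb Z$. Let $S_{n,m}\in\mathbb N\cup\{\infty\}$ be the number of points of the support of $w_{n,t_m}$. For $k<S_{n,m}$ let $p_{k,t_m}$ be the polynomial of degree $k$ with positive leading coefficient such that the functions $r_{k,t_m}=p_{k,t_m}\circ\nu_{n,t_m}$ satisfy $\sum_{y\in\mathbb Z}r_{j,t_m}(y)r_{k,t_m}(y)w_{n,t_m}(y)=\delta_{jk}$; put $r_{k,t_m}=0$ for $k\ge S_{n,m}$. (The $r_{k,t_m}$ depend on $n$.) The recurrence coefficients, for $m=1,\dots,N$, are defined by $$\nu_{n,t_m}r_{j,t_m}=a^{(t_m)}_{j,n}r_{j+1,t_m}+b^{(t_m)}_{j,n}r_{j,t_m}+a^{(t_m)}_{j-1,n}r_{j-1,t_m},\qquad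 a^{(t_m)}_{-1,n}=0,$$ on the support of $w_{n,t_m}$, with $a^{(t_m)}_{j,n}>0$ if $j+1<S_{n,m}$ and $a^{(t_m)}_{j,n}=0$ otherwise. Let $c_{k,t_m}=c_{k,t_m}(n)$ be numbers that are positive for $k<S_{n,m}$, and put $$U_{t_m}(y,y')=\sum_{k\ge0}\frac{c_{k,t_{m+1}}}{c_{k,t_m}}\,r_{k,t_m}(y)\,r_{k,t_{m+1}}(y'),\qquad m=0,\dots,N-1,$$ where the series is assumed to converge in $L^2(w_{n,t_{m+1}})$ as a function of $y'$ for each fixed $y$ with $w_{n,t_m}(y)\neq0$, and in $L^2(w_{n,t_m})$ as a function of $y$ for each fixed $y'$ with $w_{n,t_{m+1}}(y')\ne0$ (this is automatic for weights of finite support). Suppose that for each $n$ the points $y_j(t_m)\in\mathbb Z$, $j=1,\dots,n$, $m=0,\dots,N$, are random with a joint probability mass function proportional to $$\det\big(c_{k-1,t_0}r_{k-1,t_0}(y_j(t_0))\big)_{j,k=1}^{n}\prod_{m=0}^{N-1}\det\big(U_{t_m}(y_i(t_m),y_j(t_{m+1}))\big)_{i,j=1}^n\det\Big(\frac{r_{k-1,t_N}(y_j(t_N))}{c_{k-1,t_N}}\Big)_{j,k=1}^{n}\prod_{m=0}^N\prod_{j=1}^n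 w_{n,t_m}(y_j(t_m)).$$ Put $x_j(t_m)=y_j(t_m)/n$ and $X_n(f)=\sum_{m=1}^N\sum_{j=1}^n f(t_m,x_j(t_m))$. For a function $g$ and $E\subset\mathbb R$ let $L_E(g)=\sup_{x\ne y\in E}\left|\frac{g(x)-g(y)}{x-y}\right|$. **Assumptions.** For $m=1,\dots,N$ let $\mu(t_m,\cdot):\mathbb R\to\mathbb R$ and $K^{(t_m)}\subset\mathbb R$ be such that $\mu(t_m,K^{(t_m)})$ is compact, $\mu(t_m,\cdot)$ is injective on $K^{(t_m)}$ with inverse $\mu^{-1,(t_m)}:\mu(t_m,K^{(t_m)})\to K^{(t_m)}$, $L_{K^{(t_m)}}(\mu(t_m,\cdot))<\infty$, and $\mu_n(t_m,\cdot)$ is injective on $K^{(t_m)}\cap\frac1n\mathbb Z$, with inverse $\mu_n^{-1}(t_m,\cdot)$. Assume that, as $n\to\infty$: 1. for every integer $k\ge0$, $\ \mathbb E\Big[\sum_{m=1}^N\sum_{j:\,x_j(t_m)\notin K^{(t_m)}}|\mu_n(t_m,x_j(t_m))|^k\Big]=o(n^{-1})$ and $\ \mathbb E\Big[\sum_{m=1}^N\sum_{j:\,x_j(t_m)\notin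 K^{(t_m)}}|\mu(t_m,x_j(t_m))|^k\Big]=o(n^{-1})$; 2. for every $m=1,\dots,N$, $\ \sup_{x\in\frac1n\mathbb Z\cap K^{(t_m)}}|\mu_n(t_m,x)-\mu(t_m,x)|\to0$ and $L_{E_{n,m}}\big(\mu(t_m,\mu_n^{-1}(t_m,\cdot))-\mathrm{id}\big)\to0$, where $E_{n,m}=\mu_n(t_m,\tfrac1n\mathbb Z\cap K^{(t_m)})$; 3. for every $m=1,\dots,N$ and every fixed $j\in\mathbb Z$, $\ a^{(t_m)}_{n+j,n}\to a(1;t_m)$ and $b^{(t_m)}_{n+j,n}\to b(1;t_m)$, where $a(1;t_m)>0$ and $b(1;t_m)\in\mathbb R$; 4. for every $m=1,\dots,N$ and all fixed $k,l\in\mathbb Z$, $\ c_{n+k,t_m}/c_{n+l,t_m}\to e^{\tau_m(l-k)}$, where $\tau_1<\dots<\tau_N$ are real. Let $f:\{t_1,\dots,t_N\}\times\mathbb R\to\mathbb R$ be such that, for each $m$, the function $f(t_m,\mu^{-1,(t_m)}(\cdot))$ is continuously differentiable on $\mu(t_m,K^{(t_m)})$ (that is, it is the restriction of a $C^1$ function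 on $\mathbb R$), and such that for some $C,d$ one has $|f(t_m,x)|\le C(1+|\mu(t_m,x)|^d)$ for all $m$ and all $x\in\mathbb R$. **Conclusion.** For every $r$, $[b(1;t_r)-2a(1;t_r),\,b(1;t_r)+2a(1;t_r)]\subset\mu(t_r,K^{(t_r)})$, so that $$\hat f^{(r)}_k=\frac1\pi\int_0^\pi f\big(t_r,\mu^{-1,(t_r)}(b(1;t_r)+2a(1;t_r)\cos\theta)\big)\cos(k\theta)\,d\theta,\qquad k\ge 1,$$ is well defined; $X_n(f)$ is integrable for all large $n$; the series $$\sigma^2=\sum_{r_1,r_2=1}^N\sum_{k=1}^\infty k\,e^{-|\tau_{r_1}-\tau_{r_2}|k}\,\hat f^{(r_1)}_k\hat f^{(r_2)}_k$$ converges and is non-negative; and $X_n(f)-\mathbb E[X_n(f)]$ converges in distribution to $\mathcal N(0,\sigma^2)$ as $n\to\infty$. -/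

import Mathlib

open MeasureTheory ProbabilityTheory Filter Topology

namespace QOPE

/-- `(p k)` is the system of orthonormal polynomials, in the variable `ν`, for the weight `w` on
`ℤ`.  If `w` is supported on `S < ∞` points, only `p 0, …, p (S - 1)` exist; the remaining `p k`
are set to zero, so that they do not contribute to any sum. -/
structure IsOrthonormalSystem (ν w : ℤ → ℝ) (p : ℕ → Polynomial ℝ) : Prop where
  natDegree_eq : ∀ k : ℕ, (k : ℕ∞) < (Function.support w).encard → (p k).natDegree = k
  leadingCoeff_pos : ∀ k : ℕ, (k : ℕ∞) < (Function.support w).encard → 0 < (p k).leadingCoeff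
  orthonormal : ∀ j k : ℕ, (j : ℕ∞) < (Function.support w).encard →
    (k : ℕ∞) < (Function.support w).encard →
    HasSum (fun y : ℤ => (p j).eval (ν y) * (p k).eval (ν y) * w y) (if j = k then 1 else 0)
  eq_zero : ∀ k : ℕ, (Function.support w).encard ≤ (k : ℕ∞) → p k = 0

/-- `a`, `b` are the coefficients of the three term recurrence
`ν r_j = a_j r_{j+1} + b_j r_j + a_{j-1} r_{j-1}`, with `r_j = p_j ∘ ν` and `a_{-1} = 0`, on the
support of the weight.  If the support has `S < ∞` points then `a_j = 0` for `j ≥ S - 1`. -/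
structure IsRecurrence (ν w : ℤ → ℝ) (p : ℕ → Polynomial ℝ) (a b : ℕ → ℝ) : Prop where
  pos : ∀ j : ℕ, ((j + 1 : ℕ) : ℕ∞) < (Function.support w).encard → 0 < a j
  eq_zero : ∀ j : ℕ, (Function.support w).encard ≤ ((j + 1 : ℕ) : ℕ∞) → a j = 0
  recurrence : ∀ j : ℕ, (j : ℕ∞) < (Function.support w).encard → ∀ y : ℤ, w y ≠ 0 →
    ν y * (p j).eval (ν y) = a j * (p (j + 1)).eval (ν y) + b j * (p j).eval (ν y)
      + (if j = 0 then 0 else a (j - 1) * (p (j - 1)).eval (ν y))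

/-- Labelled configurations of `n` lattice points at each of the times `t_0, …, t_N`. -/
abbrev Config (N n : ℕ) : Type := Fin (N + 1) → Fin n → ℤ

/-- The `k`-th term of the transition function from time `t_m` to time `t_{m+1}`. -/
noncomputable def transitionTerm {N : ℕ} (ν : Fin (N + 1) → ℤ → ℝ)
    (p : Fin (N + 1) → ℕ → Polynomial ℝ) (c : Fin (N + 1) → ℕ → ℝ)
    (m : Fin N) (x y : ℤ) (k : ℕ) : ℝ :=
  c m.succ k / c m.castSucc k *
    (p m.castSucc k).eval (ν m.castSucc x) * (p m.succ k).eval (ν m.succ y)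

/-- The transition function `U_{t_m}(x, y) = ∑ₖ c_{k,m+1} / c_{k,m} r_{k,m}(x) r_{k,m+1}(y)`. -/
noncomputable def transition {N : ℕ} (ν : Fin (N + 1) → ℤ → ℝ)
    (p : Fin (N + 1) → ℕ → Polynomial ℝ) (c : Fin (N + 1) → ℕ → ℝ)
    (m : Fin N) (x y : ℤ) : ℝ :=
  ∑' k : ℕ, transitionTerm ν p c m x y k

/-- The unnormalized density of the extended ensemble. -/
noncomputable def density {N n : ℕ} (ν w : Fin (N + 1) → ℤ → ℝ)
    (p : Fin (N + 1) → ℕ → Polynomial ℝ) (c : Fin (N + 1) → ℕ → ℝ) (y : Config N n) : ℝ :=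
  (Matrix.of fun j k : Fin n => c 0 k * (p 0 k).eval (ν 0 (y 0 j))).det
    * (∏ m : Fin N,
        (Matrix.of fun i j : Fin n => transition ν p c m (y m.castSucc i) (y m.succ j)).det)
    * (Matrix.of fun j k : Fin n =>
        (p (Fin.last N) k).eval (ν (Fin.last N) (y (Fin.last N) j)) / c (Fin.last N) k).det
    * ∏ m : Fin (N + 1), ∏ j : Fin n, w m (y m j)

/-- An extended ensemble of `n` points at the times `t_0, …, t_N`.  The lattice point `y : ℤ`
stands for the rescaled point `y / n`; so `ν m y` is `μ_n(t_m, y / n)` and `w m y` is the weight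
`w_{n,t_m}` at `y`. -/
structure ExtendedEnsemble (N n : ℕ) where
  /-- the functions `ν_{n,t_m}` on the lattice -/
  ν : Fin (N + 1) → ℤ → ℝ
  /-- the weights -/
  w : Fin (N + 1) → ℤ → ℝ
  /-- the orthonormal polynomials -/
  p : Fin (N + 1) → ℕ → Polynomial ℝ
  /-- the coefficients `c_{k,t_m}` -/
  c : Fin (N + 1) → ℕ → ℝ
  /-- the joint law of the points -/
  law : Measure (Config N n)
  injOn : ∀ m, Set.InjOn (ν m) (Function.support (w m))
  w_nonneg : ∀ m y, 0 ≤ w m y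
  moments : ∀ m (k : ℕ), Summable fun y : ℤ => |ν m y| ^ k * w m y
  orthonormal : ∀ m, IsOrthonormalSystem (ν m) (w m) (p m)
  c_pos : ∀ m (k : ℕ), (k : ℕ∞) < (Function.support (w m)).encard → 0 < c m k
  /-- as a function of its second variable, the series defining `U_{t_m}` converges in `L²` -/
  transition_right : ∀ (m : Fin N) (x : ℤ), w m.castSucc x ≠ 0 →
    Summable fun k : ℕ => ∑' y : ℤ, transitionTerm ν p c m x y k ^ 2 * w m.succ y
  /-- as a function of its first variable, the series defining `U_{t_m}` converges in `L²` -/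
  transition_left : ∀ (m : Fin N) (y : ℤ), w m.succ y ≠ 0 →
    Summable fun k : ℕ => ∑' x : ℤ, transitionTerm ν p c m x y k ^ 2 * w m.castSucc x
  isProbabilityMeasure : IsProbabilityMeasure law
  /-- the law has a probability mass function proportional to `density` -/
  law_eq : ∃ Z : ℝ, ∀ y : Config N n, law.real {y} = Z * density ν w p c y

instance {N n : ℕ} (E : ExtendedEnsemble N n) : IsProbabilityMeasure E.law :=
  E.isProbabilityMeasure

/-- The linear statistic `X_n(f) = ∑_{m=1}^N ∑_j f(t_m, x_j(t_m))`, where `x_j = y_j / n`. -/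
noncomputable def linStat {N n : ℕ} (f : Fin N → ℝ → ℝ) (y : Config N n) : ℝ :=
  ∑ m : Fin N, ∑ j : Fin n, f m ((y m.succ j : ℝ) / n)

/-- The statistic `X_n(|μ_n|^k χ_{K^c})`. -/
noncomputable def outerMoment {N n : ℕ} (E : ExtendedEnsemble N n) (K : Fin N → Set ℝ) (k : ℕ)
    (y : Config N n) : ℝ :=
  ∑ m : Fin N, ∑ j : Fin n,
    Set.indicator {z : ℤ | (z : ℝ) / n ∉ K m} (fun z => |E.ν m.succ z| ^ k) (y m.succ j)

/-- The points `y` of `ℤ` for which `y / n` lies in `K`. -/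
def lattice (n : ℕ) (K : Set ℝ) : Set ℤ := {y : ℤ | (y : ℝ) / n ∈ K}

/-- The Lipschitz constant `L_E(g) = sup_{x ≠ y ∈ E} |(g x - g y) / (x - y)|`, in `[0, ∞]`. -/
noncomputable def lipConst (g : ℝ → ℝ) (E : Set ℝ) : ENNReal :=
  ⨆ x ∈ E, ⨆ y ∈ E, ⨆ _ : x ≠ y, ENNReal.ofReal |(g x - g y) / (x - y)|

/-- `μ ∘ μ_n⁻¹ : μ_n(K ∩ (1/n)ℤ) → ℝ`, where `ν y = μ_n(y / n)`. -/
noncomputable def compInv (n : ℕ) (μ : ℝ → ℝ) (ν : ℤ → ℝ) (K : Set ℝ) (u : ℝ) : ℝ :=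
  μ (((Function.invFunOn ν (lattice n K) u : ℤ) : ℝ) / n)

/-- The `k`-th Fourier coefficient
`(1/π) ∫_0^π f(μ⁻¹(b + 2 a cos θ)) cos(k θ) dθ`, with `μ⁻¹ : μ(K) → K`. -/
noncomputable def fourierCos (f μ : ℝ → ℝ) (K : Set ℝ) (a b : ℝ) (k : ℕ) : ℝ :=
  1 / Real.pi * ∫ θ in (0 : ℝ)..Real.pi,
    f (Function.invFunOn μ K (b + 2 * a * Real.cos θ)) * Real.cos (k * θ)

/-- The summand `k e^{-|τ_r - τ_s| k} \hat f_k^{(r)} \hat f_k^{(s)}` of the limiting variance. -/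
noncomputable def varTerm {N : ℕ} (f μ : Fin N → ℝ → ℝ) (K : Fin N → Set ℝ) (α β τ : Fin N → ℝ)
    (r s : Fin N) (k : ℕ) : ℝ :=
  k * Real.exp (-|τ r - τ s| * k)
    * fourierCos (f r) (μ r) (K r) (α r) (β r) k * fourierCos (f s) (μ s) (K s) (α s) (β s) k

/-- The limiting variance; the term `k = 0` vanishes. -/
noncomputable def limVar {N : ℕ} (f μ : Fin N → ℝ → ℝ) (K : Fin N → Set ℝ) (α β τ : Fin N → ℝ) :
    ℝ :=
  ∑ r : Fin N, ∑ s : Fin N, ∑' k : ℕ, varTerm f μ K α β τ r s k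

end QOPE

/-!
Central limit theorem for linear statistics of orthogonal polynomial ensembles at several times.

The density of the ensemble is a chain of determinants, hence, by the Andréief identity
(`hasSum_andreief`), the vacuum expectation of a system of `n` free fermions. Fermionic states are
encoded dually, as alternating `n`-forms on finitely supported sequences: an operator `A` acts on
forms by the Leibniz rule (`altDer`), and the dual vacuum `vac n` is the volume form in the first `n`
coordinates. The recurrence relation turns the multiplication by a polynomial `q ∘ ν` into the banded
operator `q(J)`, where `J` is the Jacobi operator conjugated by the numbers `c_k` (`jacobi`). Thus the
mixed moments of centred polynomial statistics are time-ordered vacuum moments of such operators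
(`hasSum_density_moment`, `integral_prod_centredStat`); this also gives their integrability.

Near the index `n` the operators converge to Laurent operators (`HasSymbol`, `hasSymbol_jacobi`).
These commute, so the commutator of two of the operators is asymptotically the scalar
`tr (Pₙ [A, B])`, whose limit is a bilinear expression in the symbols
(`HasSymbol.tendsto_ptr_commutator`). The dual vacuum is annihilated by strictly lower triangular
operators from one side and, after centring, by upper triangular ones from the other. Splitting one
operator into these two parts and moving each of them to its side yields Gaussian integration by
parts in the limit (`stein_identity`), that is, the recursion of Gaussian moments
(`tendsto_integral_pow_recursion`). The coefficients of the symbol of `q(J)` are `e^{-τ k}` times the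
Fourier coefficients of `q(β + 2 α cos θ)` (`coeff_aeval_jacobiSymbol`), and this identifies the
limiting variance for polynomials (`symCov_eq_tsum`).

The passage to `C¹` functions rests on two bounds by the derivative. On the side of the limit,
Bessel's inequality bounds the covariance series (`covTerm_bound`). On the side of the ensemble, each
one-time marginal is the determinantal ensemble of a projection (`map_real_singleton`), in which the
variance of a linear statistic is a double sum of squared increments against the squared kernel
(`hasSum_increments`); by the Christoffel–Darboux formula that sum equals `a_{n-1}²` for the
function `ν` itself (`hasSum_increments_nu`), so a function which is `ε`-Lipschitz with respect to `ν`
has variance at most about `ε² a_{n-1}²` (`projVar_le`). Approximating the derivative of `f ∘ μ⁻¹`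
uniformly by the derivative of a polynomial therefore makes the difference of the centred statistics
small in `L¹` (`eventually_integral_abs_sub_le`), the points outside `K` being negligible by
hypothesis. Finally, the method of moments (`tendsto_charFun_of_moments`), the stability of the limit
under `L¹` approximation (`tendsto_charFun_of_approx`) and Lévy's continuity theorem give the
convergence in distribution.
-/


namespace QOPE

/-! ### Derivations of alternating forms -/

section Derivation

variable {n : ℕ} {V W : Type*} [AddCommGroup V] [Module ℝ V] [AddCommGroup W] [Module ℝ W]

lemma compLinearMap_single (A : Module.End ℝ V) (Θ : V [⋀^Fin n]→ₗ[ℝ] ℝ) (v : Fin n → V)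
    (j : Fin n) : (Θ.toMultilinearMap.compLinearMap
      (fun i => if i = j then A else LinearMap.id)) v = Θ (Function.update v j (A (v j))) := by
  rw [MultilinearMap.compLinearMap_apply, AlternatingMap.coe_multilinearMap]
  refine congrArg Θ (funext fun i => ?_)
  by_cases h : i = j
  · subst h; simp
  · simp [h]

/-- The action of an endomorphism `A` on alternating forms by the Leibniz rule,
`(Θ A)(v₁, …, vₙ) = ∑ⱼ Θ(v₁, …, A vⱼ, …, vₙ)`; it is the transpose of the second quantization of
`A`. -/
noncomputable def altDer (A : Module.End ℝ V) :
    (V [⋀^Fin n]→ₗ[ℝ] ℝ) →ₗ[ℝ] (V [⋀^Fin n]→ₗ[ℝ] ℝ) where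
  toFun Θ :=
    { (∑ j, Θ.toMultilinearMap.compLinearMap
        (fun i => if i = j then A else LinearMap.id) : MultilinearMap ℝ (fun _ : Fin n => V) ℝ) with
      map_eq_zero_of_eq' := by
        intro v a b hab hne
        simp only [MultilinearMap.toFun_eq_coe, _root_.sum_apply, compLinearMap_single]
        rw [← Finset.add_sum_erase _ _ (Finset.mem_univ a),
          ← Finset.add_sum_erase _ _ (Finset.mem_erase.2 ⟨hne.symm, Finset.mem_univ b⟩),
          Finset.sum_eq_zero, add_zero]
        · have : Function.update v b (A (v b))
              = Function.update v a (A (v a)) ∘ Equiv.swap a b := by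
            funext i
            by_cases hia : i = a
            · subst hia
              rw [Function.comp_apply, Equiv.swap_apply_left, Function.update_of_ne hne,
                Function.update_of_ne hne.symm, hab]
            · by_cases hib : i = b
              · subst hib
                simp [hab]
              · simp [Equiv.swap_apply_of_ne_of_ne hia hib, hia, hib]
          rw [this, AlternatingMap.map_swap _ _ hne, add_neg_cancel]
        · intro j hj
          simp only [Finset.mem_erase, Finset.mem_univ, and_true] at hj
          apply Θ.map_eq_zero_of_eq _ _ hne
          rw [Function.update_of_ne (Ne.symm hj.2), Function.update_of_ne (Ne.symm hj.1), hab] }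
  map_add' Θ Θ' := by
    ext v
    simp [Finset.sum_add_distrib]
  map_smul' c Θ := by
    ext v
    simp [Finset.mul_sum]

lemma altDer_apply (A : Module.End ℝ V) (Θ : V [⋀^Fin n]→ₗ[ℝ] ℝ) (v : Fin n → V) :
    altDer A Θ v = ∑ j, Θ (Function.update v j (A (v j))) := by
  change (∑ j, Θ.toMultilinearMap.compLinearMap
        (fun i => if i = j then A else LinearMap.id) : MultilinearMap ℝ (fun _ : Fin n => V) ℝ) v = _
  simp only [_root_.sum_apply, compLinearMap_single]

lemma altDer_add (A B : Module.End ℝ V) (Θ : V [⋀^Fin n]→ₗ[ℝ] ℝ) :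
    altDer (A + B) Θ = altDer A Θ + altDer B Θ := by
  ext v
  simp [altDer_apply, Finset.sum_add_distrib]

lemma altDer_comm (A B : Module.End ℝ V) (Θ : V [⋀^Fin n]→ₗ[ℝ] ℝ) :
    altDer B (altDer A Θ) = altDer A (altDer B Θ) + altDer (A * B - B * A) Θ := by
  have key : ∀ (A B : Module.End ℝ V) (v : Fin n → V), altDer B (altDer A Θ) v
      = altDer (A * B) Θ v + ∑ j, ∑ i ∈ Finset.univ.erase j,
        Θ (Function.update (Function.update v j (B (v j))) i (A (v i))) := by
    intro A B v
    simp only [altDer_apply, ← Finset.sum_add_distrib]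
    refine Finset.sum_congr rfl fun j _ => ?_
    rw [← Finset.add_sum_erase _ _ (Finset.mem_univ j)]
    congr 1
    · simp
    · refine Finset.sum_congr rfl fun i hi => ?_
      rw [Function.update_of_ne (Finset.ne_of_mem_erase hi)]
  ext v
  rw [AlternatingMap.add_apply, key A B, key B A]
  have h1 : altDer (A * B) Θ v = altDer (B * A) Θ v + altDer (A * B - B * A) Θ v := by
    rw [← AlternatingMap.add_apply, ← altDer_add, add_sub_cancel]
  have h2 : ∑ j, ∑ i ∈ Finset.univ.erase j,
        Θ (Function.update (Function.update v j (B (v j))) i (A (v i)))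
      = ∑ j, ∑ i ∈ Finset.univ.erase j,
        Θ (Function.update (Function.update v j (A (v j))) i (B (v i))) := by
    rw [Finset.sum_comm' (t' := Finset.univ) (s' := fun i => Finset.univ.erase i)
      (by simp [eq_comm])]
    refine Finset.sum_congr rfl fun j _ => Finset.sum_congr rfl fun i hi => ?_
    rw [Function.update_comm (Finset.ne_of_mem_erase hi)]
  rw [h1, h2]; ring

/-- The derivation action commutes with pulling back along an intertwining map. -/
lemma altDer_compLinearMap (A : Module.End ℝ V) (B : Module.End ℝ W) (L : V →ₗ[ℝ] W)
    (h : ∀ v, L (A v) = B (L v)) (Θ : W [⋀^Fin n]→ₗ[ℝ] ℝ) :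
    altDer A (Θ.compLinearMap L) = (altDer B Θ).compLinearMap L := by
  ext v
  simp only [altDer_apply, AlternatingMap.compLinearMap_apply]
  refine Finset.sum_congr rfl fun j _ => ?_
  refine congrArg Θ (funext fun i => ?_)
  by_cases hij : i = j
  · subst hij; simp [h]
  · simp [hij]

lemma det_update_one (j : Fin n) (w : Fin n → ℝ) :
    Matrix.detRowAlternating (Function.update (fun i => Pi.single i (1 : ℝ)) j w) = w j := by
  have : Matrix.detRowAlternating (Function.update (fun i => Pi.single i (1 : ℝ)) j w)
      = ((1 : Matrix (Fin n) (Fin n) ℝ).updateRow j w).det := by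
    change Matrix.det _ = _
    congr 1
    ext a b
    by_cases h : a = j
    · subst h; simp
    · simp [h, Matrix.one_apply, Pi.single_apply, eq_comm]
  rw [this, ← Matrix.det_transpose, ← Matrix.updateCol_transpose, ← Matrix.cramer_apply]
  simp

/-- On a space of dimension `n` an endomorphism acts on the volume form by its trace. -/
lemma altDer_det (f : Module.End ℝ (Fin n → ℝ)) :
    altDer f (Matrix.detRowAlternating : (Fin n → ℝ) [⋀^Fin n]→ₗ[ℝ] ℝ)
      = (∑ j, f (Pi.single j 1) j) • Matrix.detRowAlternating := by
  have h := AlternatingMap.eq_smul_basis_det (Pi.basisFun ℝ (Fin n))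
    (altDer f (Matrix.detRowAlternating : (Fin n → ℝ) [⋀^Fin n]→ₗ[ℝ] ℝ))
  rw [h]
  have h1 : (altDer f (Matrix.detRowAlternating : (Fin n → ℝ) [⋀^Fin n]→ₗ[ℝ] ℝ))
      (Pi.basisFun ℝ (Fin n)) = ∑ j, f (Pi.single j 1) j := by
    rw [altDer_apply]
    refine Finset.sum_congr rfl fun j _ => ?_
    have := det_update_one j (f (Pi.single j 1))
    convert this using 3
    · ext; simp
    · simp
  rw [h1]
  congr 1
  exact Pi.basisFun_det

end Derivation

/-! ### Centred moments of operators in the vacuum state -/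

/-- Finitely supported sequences; `Finsupp.single k 1` stands for the `k`-th orthonormal
polynomial. -/
abbrev Vec : Type := ℕ →₀ ℝ

/-- Matrix entries of an operator on finitely supported sequences. -/
noncomputable def ent (A : Module.End ℝ Vec) (i j : ℕ) : ℝ := A (Finsupp.single j 1) i

@[simp] lemma ent_add (A B : Module.End ℝ Vec) (i j : ℕ) :
    ent (A + B) i j = ent A i j + ent B i j := by simp [ent]

@[simp] lemma ent_sub (A B : Module.End ℝ Vec) (i j : ℕ) :
    ent (A - B) i j = ent A i j - ent B i j := by simp [ent]

@[simp] lemma ent_smul (c : ℝ) (A : Module.End ℝ Vec) (i j : ℕ) :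
    ent (c • A) i j = c * ent A i j := by simp [ent]

lemma ent_one (i j : ℕ) : ent 1 i j = if i = j then 1 else 0 := by
  simp [ent, Finsupp.single_apply, eq_comm]

lemma apply_eq_sum_ent (A : Module.End ℝ Vec) (v : Vec) (i : ℕ) :
    A v i = v.sum fun j x => ent A i j * x := by
  conv_lhs => rw [← Finsupp.sum_single v]
  rw [Finsupp.sum, map_sum, Finsupp.finsetSum_apply, Finsupp.sum]
  refine Finset.sum_congr rfl fun j _ => ?_
  rw [← mul_one (v j), ← smul_eq_mul, ← Finsupp.smul_single, map_smul]
  simp [ent, mul_comm]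

lemma ent_mul (A B : Module.End ℝ Vec) (i j : ℕ) {s : Finset ℕ}
    (hs : ∀ k, ent B k j ≠ 0 → k ∈ s) :
    ent (A * B) i j = ∑ k ∈ s, ent A i k * ent B k j := by
  have : ent (A * B) i j = A (B (Finsupp.single j 1)) i := rfl
  rw [this, apply_eq_sum_ent]
  refine Finsupp.sum_of_support_subset _ ?_ _ (by simp)
  intro k hk
  exact hs k (by simpa [ent] using hk)

/-- The partial trace `tr (Pₙ A)`. -/
noncomputable def ptr (n : ℕ) (A : Module.End ℝ Vec) : ℝ := ∑ i : Fin n, ent A i i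

lemma ptr_add (n : ℕ) (A B : Module.End ℝ Vec) : ptr n (A + B) = ptr n A + ptr n B := by
  simp [ptr, Finset.sum_add_distrib]

/-- The first `n` coordinates. -/
noncomputable def firstCoords (n : ℕ) : Vec →ₗ[ℝ] (Fin n → ℝ) :=
  LinearMap.pi fun j => Finsupp.lapply (j : ℕ)

@[simp] lemma firstCoords_apply (n : ℕ) (v : Vec) (j : Fin n) : firstCoords n v j = v j := rfl

/-- The volume form in the first `n` coordinates: the dual of the vacuum vector
`e₀ ∧ ⋯ ∧ eₙ₋₁`. -/
noncomputable def vac (n : ℕ) : Vec [⋀^Fin n]→ₗ[ℝ] ℝ :=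
  (Matrix.detRowAlternating : (Fin n → ℝ) [⋀^Fin n]→ₗ[ℝ] ℝ).compLinearMap (firstCoords n)

/-- The vectors `e₀, …, eₙ₋₁`. -/
noncomputable def firstVecs (n : ℕ) : Fin n → Vec := fun i => Finsupp.single (i : ℕ) 1

lemma vac_firstVecs (n : ℕ) : vac n (firstVecs n) = 1 := by
  have : vac n (firstVecs n) = (1 : Matrix (Fin n) (Fin n) ℝ).det := by
    rw [vac, AlternatingMap.compLinearMap_apply]
    change Matrix.det _ = _
    congr 1
    ext i j
    simp [firstVecs, Matrix.one_apply, Finsupp.single_apply, Fin.ext_iff]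
  simp [this]

/-- The derivation action, centred at its vacuum expectation. -/
noncomputable def cder (n : ℕ) (A : Module.End ℝ Vec) :
    (Vec [⋀^Fin n]→ₗ[ℝ] ℝ) →ₗ[ℝ] (Vec [⋀^Fin n]→ₗ[ℝ] ℝ) :=
  altDer A - ptr n A • LinearMap.id

/-- Successive action of a list of operators on an alternating form. The head of the list acts
first; for the ensemble it belongs to the earliest time. -/
noncomputable def cact (n : ℕ) : List (Module.End ℝ Vec) →
    ((Vec [⋀^Fin n]→ₗ[ℝ] ℝ) →ₗ[ℝ] (Vec [⋀^Fin n]→ₗ[ℝ] ℝ))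
  | [] => LinearMap.id
  | A :: l => cact n l ∘ₗ cder n A

lemma cact_append (n : ℕ) (u v : List (Module.End ℝ Vec)) :
    cact n (u ++ v) = cact n v ∘ₗ cact n u := by
  induction u with
  | nil => rfl
  | cons A u ih => rw [List.cons_append, cact, ih, cact, LinearMap.comp_assoc]

/-- The centred moment of a list of operators in the vacuum state of `n` particles. -/
noncomputable def cmom (n : ℕ) (l : List (Module.End ℝ Vec)) : ℝ :=
  cact n l (vac n) (firstVecs n)

@[simp] lemma cmom_nil (n : ℕ) : cmom n [] = 1 := vac_firstVecs n

lemma cmom_add (n : ℕ) (u v : List (Module.End ℝ Vec)) (A B : Module.End ℝ Vec) :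
    cmom n (u ++ (A + B) :: v) = cmom n (u ++ A :: v) + cmom n (u ++ B :: v) := by
  have : cder n (A + B) = cder n A + cder n B := by
    ext Θ v
    simp only [cder, LinearMap.sub_apply, LinearMap.add_apply, LinearMap.smul_apply,
      altDer_add, ptr_add, AlternatingMap.sub_apply, AlternatingMap.add_apply,
      AlternatingMap.smul_apply, LinearMap.id_apply, smul_eq_mul]
    ring
  simp only [cmom, cact_append, cact, this, LinearMap.comp_apply, LinearMap.add_apply, map_add,
    AlternatingMap.add_apply]

/-- Exchanging two neighbouring operators produces their commutator. Its partial trace, which need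
not vanish for operators on an infinite-dimensional space, appears because the action is centred. -/
lemma cmom_comm (n : ℕ) (u v : List (Module.End ℝ Vec)) (A B : Module.End ℝ Vec) :
    cmom n (u ++ A :: B :: v) = cmom n (u ++ B :: A :: v) + cmom n (u ++ (A * B - B * A) :: v)
      + ptr n (A * B - B * A) * cmom n (u ++ v) := by
  have : ∀ Θ, cder n B (cder n A Θ) = cder n A (cder n B Θ) + cder n (A * B - B * A) Θ
      + ptr n (A * B - B * A) • Θ := by
    intro Θ
    simp only [cder, LinearMap.sub_apply, LinearMap.smul_apply, LinearMap.id_apply, map_sub,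
      map_smul, altDer_comm A B Θ]
    module
  simp only [cmom, cact_append, cact, LinearMap.comp_apply, this, map_add, map_smul,
    AlternatingMap.add_apply, AlternatingMap.smul_apply, smul_eq_mul]

/-- A strictly lower triangular operator annihilates the dual vacuum. -/
lemma cmom_lower (n : ℕ) (v : List (Module.End ℝ Vec)) (A : Module.End ℝ Vec)
    (hA : ∀ i j, i ≤ j → ent A i j = 0) : cmom n (A :: v) = 0 := by
  have key : cder n A (vac n) = 0 := by
    let f : Module.End ℝ (Fin n → ℝ) :=
      Matrix.toLin' (Matrix.of fun i j : Fin n => ent A i j)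
    have h1 : ∀ x, firstCoords n (A x) = f (firstCoords n x) := by
      intro x
      ext i
      have h2 : f (firstCoords n x) i = ∑ k : Fin n, ent A i k * x k := by
        simp [f, Matrix.toLin'_apply, Matrix.mulVec, dotProduct]
      rw [firstCoords_apply, h2, apply_eq_sum_ent, Fin.sum_univ_eq_sum_range
        (fun k => ent A i k * x k) n, Finsupp.sum_of_support_subset
        (s := x.support ∪ Finset.range n) _ Finset.subset_union_left _ (by simp)]
      symm
      refine Finset.sum_subset Finset.subset_union_right ?_
      intro k _ hk
      rw [hA _ _ (by have := i.2; simp at hk; omega), zero_mul]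
    have h3 : altDer A (vac n) = ptr n A • vac n := by
      rw [vac, altDer_compLinearMap A f _ h1, altDer_det]
      have : ∑ j, f (Pi.single j 1) j = ptr n A := by
        simp [f, ptr]
      rw [this]
      rfl
    simp [cder, h3]
  simp [cmom, cact, key]

/-- An upper triangular operator acts on the vacuum by a scalar. -/
lemma cmom_upper (n : ℕ) (u : List (Module.End ℝ Vec)) (A : Module.End ℝ Vec)
    (hA : ∀ i j, j < i → ent A i j = 0) : cmom n (u ++ [A]) = 0 := by
  have key : ∀ Θ : Vec [⋀^Fin n]→ₗ[ℝ] ℝ, altDer A Θ (firstVecs n)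
      = ptr n A * Θ (firstVecs n) := by
    intro Θ
    rw [altDer_apply, ptr, Finset.sum_mul]
    refine Finset.sum_congr rfl fun j _ => ?_
    have h1 : A (firstVecs n j) = ∑ i ∈ Finset.range (j + 1),
        ent A i j • Finsupp.single i (1 : ℝ) := by
      ext k
      simp only [Finsupp.finsetSum_apply, Finsupp.smul_apply, Finsupp.single_apply, smul_eq_mul,
        mul_ite, mul_one, mul_zero, Finset.sum_ite_eq', Finset.mem_range]
      split_ifs with h
      · rfl
      · exact hA k j (by omega)
    rw [h1, AlternatingMap.map_update_sum]
    rw [Finset.sum_eq_single (j : ℕ)]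
    · rw [AlternatingMap.map_update_smul]
      have : Function.update (firstVecs n) j (Finsupp.single (j : ℕ) 1) = firstVecs n :=
        Function.update_eq_self j _
      rw [this, smul_eq_mul]
    · intro i hi hij
      have hi' : i < j := by simp at hi; omega
      rw [AlternatingMap.map_update_smul]
      have hne : j ≠ ⟨i, hi'.trans j.2⟩ := by
        intro h; apply hij; rw [h]
      rw [Θ.map_eq_zero_of_eq _ _ hne, smul_zero]
      rw [Function.update_self, Function.update_of_ne hne.symm]
      rfl
    · simp
  simp only [cmom, cact_append, cact, LinearMap.comp_apply, LinearMap.id_apply, cder,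
    LinearMap.sub_apply, LinearMap.smul_apply, AlternatingMap.sub_apply, key,
    AlternatingMap.smul_apply, smul_eq_mul, sub_self]

/-- The strictly lower triangular part of an operator. -/
noncomputable def low (A : Module.End ℝ Vec) : Module.End ℝ Vec :=
  Finsupp.basisSingleOne.constr ℝ fun j => (A (Finsupp.single j 1)).filter fun i => j < i

lemma ent_low (A : Module.End ℝ Vec) (i j : ℕ) :
    ent (low A) i j = if j < i then ent A i j else 0 := by
  have : low A (Finsupp.single j 1) = (A (Finsupp.single j 1)).filter fun i => j < i := by
    have := (Finsupp.basisSingleOne (R := ℝ) (ι := ℕ)).constr_basis ℝ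
      (fun j => (A (Finsupp.single j 1)).filter fun i => j < i) j
    simpa [low] using this
  rw [ent, this, Finsupp.filter_apply]
  rfl

/-! ### Operators that are asymptotically Laurent near the Fermi level -/

/-- A sequence of banded operators whose entries near the diagonal position `(n, n)` converge to
those of the Laurent operator with symbol `s`; the truncation in `toNat` is harmless, as `i` and `j`
are fixed while `n → ∞`. -/
def HasSymbol (A : ℕ → Module.End ℝ Vec) (s : AddMonoidAlgebra ℝ ℤ) : Prop :=
  (∃ d : ℕ, ∀ n i j, (j + d < i ∨ i + d < j) → ent (A n) i j = 0) ∧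
  ∀ i j : ℤ, Tendsto (fun n : ℕ => ent (A n) ((n : ℤ) + i).toNat ((n : ℤ) + j).toNat) atTop
    (𝓝 (s.coeff (i - j)))

lemma HasSymbol.coeff_eq_zero {A : ℕ → Module.End ℝ Vec} {s : AddMonoidAlgebra ℝ ℤ} {d : ℕ}
    (h : HasSymbol A s) (hd : ∀ n i j, (j + d < i ∨ i + d < j) → ent (A n) i j = 0) {k : ℤ}
    (hk : (d : ℤ) < |k|) : s.coeff k = 0 := by
  have h1 := h.2 k 0
  rw [sub_zero] at h1
  refine tendsto_nhds_unique h1 (tendsto_const_nhds.congr' ?_)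
  filter_upwards [eventually_ge_atTop k.natAbs] with n hn
  rw [hd]
  rcases lt_abs.1 hk with h | h
  · left; omega
  · right; omega

lemma HasSymbol.add {A B : ℕ → Module.End ℝ Vec} {s t : AddMonoidAlgebra ℝ ℤ}
    (hA : HasSymbol A s) (hB : HasSymbol B t) : HasSymbol (fun n => A n + B n) (s + t) := by
  obtain ⟨⟨d, hd⟩, hA⟩ := hA
  obtain ⟨⟨e, he⟩, hB⟩ := hB
  refine ⟨⟨max d e, fun n i j h => ?_⟩, fun i j => ?_⟩
  · rw [ent_add, hd n i j (by omega), he n i j (by omega), add_zero]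
  · simpa using (hA i j).add (hB i j)

lemma HasSymbol.const_smul {A : ℕ → Module.End ℝ Vec} {s : AddMonoidAlgebra ℝ ℤ}
    (hA : HasSymbol A s) (c : ℝ) : HasSymbol (fun n => c • A n) (c • s) := by
  obtain ⟨⟨d, hd⟩, hA⟩ := hA
  refine ⟨⟨d, fun n i j h => ?_⟩, fun i j => ?_⟩
  · rw [ent_smul, hd n i j h, mul_zero]
  · simpa using (hA i j).const_mul c

lemma HasSymbol.sub {A B : ℕ → Module.End ℝ Vec} {s t : AddMonoidAlgebra ℝ ℤ}
    (hA : HasSymbol A s) (hB : HasSymbol B t) : HasSymbol (fun n => A n - B n) (s - t) := by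
  have h := hA.add (hB.const_smul (-1))
  rw [neg_one_smul, ← sub_eq_add_neg] at h
  refine (funext fun n => ?_ : (fun n => A n - B n) = fun n => A n + (-1 : ℝ) • B n) ▸ h
  refine LinearMap.ext fun v => ?_
  simp [sub_eq_add_neg]

lemma hasSymbol_one : HasSymbol (fun _ => 1) 1 := by
  refine ⟨⟨0, fun n i j h => ?_⟩, fun i j => ?_⟩
  · rw [ent_one, if_neg (by omega)]
  · refine tendsto_const_nhds.congr' ?_
    filter_upwards [eventually_ge_atTop (i.natAbs + j.natAbs)] with n hn
    rw [ent_one, AddMonoidAlgebra.one_def, AddMonoidAlgebra.coeff_single, Finsupp.single_apply]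
    congr 1
    apply propext
    omega

lemma coeff_mul_eq_sum (s t : AddMonoidAlgebra ℝ ℤ) (i j : ℤ) (d : ℕ)
    (ht : ∀ k : ℤ, (d : ℤ) < |k| → t.coeff k = 0) :
    (s * t).coeff (i - j) = ∑ k ∈ Finset.Icc (j - d) (j + d), s.coeff (i - k) * t.coeff (k - j) := by
  rw [AddMonoidAlgebra.coeff_mul_apply_right, Finsupp.sum_of_support_subset
    (s := Finset.Icc (-(d : ℤ)) d)]
  · refine Finset.sum_bij (fun k _ => k + j) ?_ ?_ ?_ ?_
    · intro k hk; simp only [Finset.mem_Icc] at hk ⊢; omega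
    · intro a _ b _ h; simpa using h
    · intro k hk
      refine ⟨k - j, ?_, by ring⟩
      simp only [Finset.mem_Icc] at hk ⊢; omega
    · intro k _
      rw [add_sub_cancel_right]
      congr 2
      ring
  · intro k hk
    rw [Finset.mem_Icc, ← abs_le]
    by_contra h
    exact (Finsupp.mem_support_iff.1 hk) (ht k (not_le.1 h))
  · simp

lemma HasSymbol.mul {A B : ℕ → Module.End ℝ Vec} {s t : AddMonoidAlgebra ℝ ℤ}
    (hA : HasSymbol A s) (hB : HasSymbol B t) : HasSymbol (fun n => A n * B n) (s * t) := by
  have ht := fun {e : ℕ} he {k : ℤ} hk => hB.coeff_eq_zero (d := e) (k := k) he hk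
  obtain ⟨⟨d, hd⟩, hA⟩ := hA
  obtain ⟨⟨e, he⟩, hB⟩ := hB
  refine ⟨⟨d + e, fun n i j h => ?_⟩, fun i j => ?_⟩
  · rw [ent_mul (A n) (B n) i j (s := Finset.range (j + e + 1))]
    · refine Finset.sum_eq_zero fun k _ => ?_
      by_cases hk : j + e < k ∨ k + e < j
      · rw [he n k j hk, mul_zero]
      · rw [hd n i k (by omega), zero_mul]
    · intro k hk
      by_contra h'
      exact hk (he n k j (by simp at h'; omega))
  · rw [coeff_mul_eq_sum s t i j e (fun k hk => ht he hk)]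
    have : Tendsto (fun n : ℕ => ∑ k ∈ Finset.Icc (j - e) (j + e),
        ent (A n) ((n : ℤ) + i).toNat ((n : ℤ) + k).toNat
          * ent (B n) ((n : ℤ) + k).toNat ((n : ℤ) + j).toNat) atTop
        (𝓝 (∑ k ∈ Finset.Icc (j - e) (j + e), s.coeff (i - k) * t.coeff (k - j))) :=
      tendsto_finsetSum _ fun k _ => (hA i k).mul (hB k j)
    refine this.congr' ?_
    filter_upwards [eventually_ge_atTop (j.natAbs + e)] with n hn
    rw [ent_mul (A n) (B n) _ _
      (s := (Finset.Icc (j - e) (j + e)).image fun k => ((n : ℤ) + k).toNat), Finset.sum_image]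
    · intro a ha b hb h
      simp only [Finset.coe_Icc, Set.mem_Icc] at ha hb
      simp only at h
      omega
    · intro k hk
      by_contra h'
      refine hk (he n _ _ ?_)
      by_contra h''
      apply h'
      rw [Finset.mem_image]
      refine ⟨(k : ℤ) - n, ?_, by omega⟩
      rw [Finset.mem_Icc]
      omega

/-- Laurent operators commute, so a commutator has the symbol `0`. -/
lemma HasSymbol.commutator {A B : ℕ → Module.End ℝ Vec} {s t : AddMonoidAlgebra ℝ ℤ}
    (hA : HasSymbol A s) (hB : HasSymbol B t) :
    HasSymbol (fun n => A n * B n - B n * A n) 0 := by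
  have := (hA.mul hB).sub (hB.mul hA)
  rwa [mul_comm t s, sub_self] at this

lemma HasSymbol.aeval {A : ℕ → Module.End ℝ Vec} {s : AddMonoidAlgebra ℝ ℤ}
    (hA : HasSymbol A s) (q : Polynomial ℝ) :
    HasSymbol (fun n => Polynomial.aeval (A n) q) (Polynomial.aeval s q) := by
  induction q using Polynomial.induction_on' with
  | add p q hp hq => simpa using hp.add hq
  | monomial k c =>
    have : HasSymbol (fun n => A n ^ k) (s ^ k) := by
      induction k with
      | zero => simpa using hasSymbol_one
      | succ k ih => simpa [pow_succ] using ih.mul hA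
    have := this.const_smul c
    simpa [Polynomial.aeval_monomial, Algebra.algebraMap_eq_smul_one] using this

/-- The part of a symbol that corresponds to the strictly lower triangular part. -/
noncomputable def lowSymbol (s : AddMonoidAlgebra ℝ ℤ) : AddMonoidAlgebra ℝ ℤ :=
  AddMonoidAlgebra.ofCoeff (s.coeff.filter fun k => 0 < k)

lemma coeff_lowSymbol (s : AddMonoidAlgebra ℝ ℤ) (k : ℤ) :
    (lowSymbol s).coeff k = if 0 < k then s.coeff k else 0 := by
  simp [lowSymbol, Finsupp.filter_apply]

lemma HasSymbol.low {A : ℕ → Module.End ℝ Vec} {s : AddMonoidAlgebra ℝ ℤ}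
    (hA : HasSymbol A s) : HasSymbol (fun n => low (A n)) (lowSymbol s) := by
  obtain ⟨⟨d, hd⟩, hA⟩ := hA
  refine ⟨⟨d, fun n i j h => ?_⟩, fun i j => ?_⟩
  · rw [ent_low, hd n i j h, ite_self]
  · rw [coeff_lowSymbol]
    have key : ∀ᶠ n : ℕ in atTop, ((n : ℤ) + j).toNat < ((n : ℤ) + i).toNat ↔ 0 < i - j := by
      filter_upwards [eventually_ge_atTop (i.natAbs + j.natAbs)] with n hn
      omega
    by_cases h : 0 < i - j
    · rw [if_pos h]
      refine (hA i j).congr' ?_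
      filter_upwards [key] with n hn
      rw [ent_low, if_pos (hn.2 h)]
    · rw [if_neg h]
      refine tendsto_const_nhds.congr' ?_
      filter_upwards [key] with n hn
      rw [ent_low, if_neg (fun h' => h (hn.1 h'))]

/-- The pairing `∑_{k ≥ 1} k s₋ₖ tₖ` of symbols; `Int.toNat` removes the terms with `k ≤ 0`. -/
noncomputable def halfPairing (s t : AddMonoidAlgebra ℝ ℤ) : ℝ :=
  t.coeff.sum fun k x => (k.toNat : ℝ) * s.coeff (-k) * x

lemma halfPairing_eq_sum (s t : AddMonoidAlgebra ℝ ℤ) (d : ℕ)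
    (ht : ∀ k : ℤ, (d : ℤ) < k → t.coeff k = 0) :
    halfPairing s t = ∑ k ∈ Finset.range (d + 1), (k : ℝ) * (s.coeff (-k) * t.coeff k) := by
  have h1 : ∑ k ∈ Finset.range (d + 1), (k : ℝ) * (s.coeff (-k) * t.coeff k)
      = ∑ k ∈ (Finset.range (d + 1)).image (Nat.cast : ℕ → ℤ),
        (k.toNat : ℝ) * s.coeff (-k) * t.coeff k := by
    rw [Finset.sum_image (by simp)]
    refine Finset.sum_congr rfl fun k _ => ?_
    simp [mul_assoc]
  rw [h1, halfPairing, Finsupp.sum_of_support_subset (s := t.coeff.support ∪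
    (Finset.range (d + 1)).image (Nat.cast : ℕ → ℤ)) _ Finset.subset_union_left _ (by simp)]
  symm
  refine Finset.sum_subset Finset.subset_union_right fun k _ hk => ?_
  by_cases h : 0 < k
  · rw [ht k, mul_zero]
    by_contra h'
    apply hk
    rw [Finset.mem_image]
    exact ⟨k.toNat, by rw [Finset.mem_range]; omega, by omega⟩
  · rw [Int.toNat_of_nonpos (by omega)]
    simp

lemma sum_sum_add_one (F : ℕ → ℝ) (D : ℕ) (hF : ∀ k, D < k → F k = 0) :
    ∑ p ∈ Finset.range D, ∑ q ∈ Finset.range D, F (p + q + 1)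
      = ∑ k ∈ Finset.range (D + 1), k * F k := by
  have h1 : ∀ p ∈ Finset.range D, ∑ q ∈ Finset.range D, F (p + q + 1)
      = ∑ k ∈ Finset.range (D + 1), if p < k then F k else 0 := by
    intro p hp
    rw [← Finset.sum_filter]
    have h2 : ∑ k ∈ Finset.range (D + 1) with p < k, F k
        = ∑ k ∈ (Finset.range D).image (fun q => p + q + 1), F k := by
      refine Finset.sum_subset ?_ ?_
      · intro k hk
        simp only [Finset.mem_filter, Finset.mem_range, Finset.mem_image] at hk ⊢
        exact ⟨k - p - 1, by omega, by omega⟩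
      · intro k hk hk'
        simp only [Finset.mem_filter, Finset.mem_range, Finset.mem_image] at hk hk'
        obtain ⟨q, hq, rfl⟩ := hk
        exact hF _ (by omega)
    rw [h2, Finset.sum_image]
    intro a _ b _ h
    simp only at h
    omega
  rw [Finset.sum_congr rfl h1, Finset.sum_comm]
  refine Finset.sum_congr rfl fun k hk => ?_
  rw [← Finset.sum_filter, Finset.sum_const, nsmul_eq_mul]
  congr 2
  have : (Finset.range D).filter (fun p => p < k) = Finset.range k := by
    ext p; simp only [Finset.mem_filter, Finset.mem_range] at hk ⊢; omega
  rw [this, Finset.card_range]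

/-- The partial trace of a commutator only involves entries across the Fermi level. -/
lemma ptr_commutator (A B : Module.End ℝ Vec) (d n : ℕ) (hn : d ≤ n)
    (hA : ∀ i j, (j + d < i ∨ i + d < j) → ent A i j = 0)
    (hB : ∀ i j, (j + d < i ∨ i + d < j) → ent B i j = 0) :
    ptr n (A * B - B * A) = ∑ p ∈ Finset.range d, ∑ q ∈ Finset.range d,
      (ent A (n - 1 - p) (n + q) * ent B (n + q) (n - 1 - p)
        - ent B (n - 1 - p) (n + q) * ent A (n + q) (n - 1 - p)) := by
  set G : ℕ → ℕ → ℝ := fun i l => ent A i l * ent B l i - ent B i l * ent A l i with hG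
  have h1 : ptr n (A * B - B * A) = ∑ i ∈ Finset.range n, ∑ l ∈ Finset.range (n + d), G i l := by
    rw [ptr, Fin.sum_univ_eq_sum_range (fun i => ent (A * B - B * A) i i) n]
    refine Finset.sum_congr rfl fun i hi => ?_
    rw [Finset.mem_range] at hi
    rw [ent_sub, ent_mul A B i i (s := Finset.range (n + d)),
      ent_mul B A i i (s := Finset.range (n + d)), ← Finset.sum_sub_distrib]
    · intro k hk
      rw [Finset.mem_range]
      by_contra h
      exact hk (hA k i (by omega))
    · intro k hk
      rw [Finset.mem_range]
      by_contra h
      exact hk (hB k i (by omega))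
  have h2 : ∑ i ∈ Finset.range n, ∑ l ∈ Finset.range n, G i l = 0 := by
    have h3 : ∑ i ∈ Finset.range n, ∑ l ∈ Finset.range n, G i l
        = -∑ i ∈ Finset.range n, ∑ l ∈ Finset.range n, G i l := by
      conv_lhs => rw [Finset.sum_comm]
      simp only [← Finset.sum_neg_distrib]
      refine Finset.sum_congr rfl fun i _ => Finset.sum_congr rfl fun l _ => ?_
      simp only [hG]; ring
    linarith
  have h4 : ∀ i, ∑ l ∈ Finset.range (n + d), G i l
      = ∑ l ∈ Finset.range n, G i l + ∑ q ∈ Finset.range d, G i (n + q) :=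
    fun i => Finset.sum_range_add _ _ _
  rw [h1]
  simp only [h4, Finset.sum_add_distrib]
  rw [h2, zero_add, ← Finset.sum_range_reflect]
  symm
  refine Finset.sum_subset (by simpa using hn) fun p hp' hp => Finset.sum_eq_zero fun q _ => ?_
  simp only [Finset.mem_range] at hp hp'
  change _ - _ = (0 : ℝ)
  rw [hA (n - 1 - p) (n + q) (by omega), hB (n - 1 - p) (n + q) (by omega)]
  ring

/-- The limit is the central cocycle of the loop algebra: although the symbol of a commutator is
zero, its partial trace has a non-trivial limit. -/
lemma HasSymbol.tendsto_ptr_commutator {A B : ℕ → Module.End ℝ Vec} {s t : AddMonoidAlgebra ℝ ℤ}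
    (hA : HasSymbol A s) (hB : HasSymbol B t) :
    Tendsto (fun n => ptr n (A n * B n - B n * A n)) atTop
      (𝓝 (halfPairing s t - halfPairing t s)) := by
  obtain ⟨d₁, hd₁⟩ := hA.1
  obtain ⟨d₂, hd₂⟩ := hB.1
  set d := max d₁ d₂
  have hd₁' : ∀ n i j, (j + d < i ∨ i + d < j) → ent (A n) i j = 0 :=
    fun n i j h => hd₁ n i j (by omega)
  have hd₂' : ∀ n i j, (j + d < i ∨ i + d < j) → ent (B n) i j = 0 :=
    fun n i j h => hd₂ n i j (by omega)
  have hs : ∀ k : ℤ, (d : ℤ) < k → s.coeff k = 0 := fun k hk =>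
    hA.coeff_eq_zero hd₁' (hk.trans_le (le_abs_self k))
  have ht : ∀ k : ℤ, (d : ℤ) < k → t.coeff k = 0 := fun k hk =>
    hB.coeff_eq_zero hd₂' (hk.trans_le (le_abs_self k))
  rw [halfPairing_eq_sum s t d ht, halfPairing_eq_sum t s d hs, ← Finset.sum_sub_distrib]
  have h1 : ∑ k ∈ Finset.range (d + 1), ((k : ℝ) * (s.coeff (-k) * t.coeff k)
      - k * (t.coeff (-k) * s.coeff k))
      = ∑ p ∈ Finset.range d, ∑ q ∈ Finset.range d, (fun k : ℕ =>
        s.coeff (-k) * t.coeff k - t.coeff (-k) * s.coeff k) (p + q + 1) := by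
    rw [sum_sum_add_one (fun k : ℕ => s.coeff (-k) * t.coeff k - t.coeff (-k) * s.coeff k)]
    · refine Finset.sum_congr rfl fun k _ => ?_
      ring
    · intro k hk
      simp only [hs k (by exact_mod_cast hk), ht k (by exact_mod_cast hk)]
      ring
  rw [h1]
  have h2 : Tendsto (fun n : ℕ => ∑ p ∈ Finset.range d, ∑ q ∈ Finset.range d,
      (ent (A n) ((n : ℤ) + (-1 - p)).toNat ((n : ℤ) + q).toNat
          * ent (B n) ((n : ℤ) + q).toNat ((n : ℤ) + (-1 - p)).toNat
        - ent (B n) ((n : ℤ) + (-1 - p)).toNat ((n : ℤ) + q).toNat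
          * ent (A n) ((n : ℤ) + q).toNat ((n : ℤ) + (-1 - p)).toNat)) atTop
      (𝓝 (∑ p ∈ Finset.range d, ∑ q ∈ Finset.range d,
        (s.coeff ((-1 - p) - q) * t.coeff (q - (-1 - p))
          - t.coeff ((-1 - p) - q) * s.coeff (q - (-1 - p))))) :=
    tendsto_finsetSum _ fun p _ => tendsto_finsetSum _ fun q _ =>
      ((hA.2 _ _).mul (hB.2 _ _)).sub ((hB.2 _ _).mul (hA.2 _ _))
  have h3 : (∑ p ∈ Finset.range d, ∑ q ∈ Finset.range d,
        (s.coeff ((-1 - p : ℤ) - q) * t.coeff (q - (-1 - p : ℤ))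
          - t.coeff ((-1 - p : ℤ) - q) * s.coeff (q - (-1 - p : ℤ))))
      = ∑ p ∈ Finset.range d, ∑ q ∈ Finset.range d, (fun k : ℕ =>
        s.coeff (-k) * t.coeff k - t.coeff (-k) * s.coeff k) (p + q + 1) := by
    refine Finset.sum_congr rfl fun p _ => Finset.sum_congr rfl fun q _ => ?_
    have e1 : (-1 - p : ℤ) - q = -((p + q + 1 : ℕ) : ℤ) := by push_cast; ring
    have e2 : (q : ℤ) - (-1 - p) = ((p + q + 1 : ℕ) : ℤ) := by push_cast; ring
    rw [e1, e2]
  rw [h3] at h2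
  refine h2.congr' ?_
  filter_upwards [eventually_ge_atTop (d + 1)] with n hn
  rw [ptr_commutator (A n) (B n) d n (by omega) (hd₁' n) (hd₂' n)]
  refine Finset.sum_congr rfl fun p hp => Finset.sum_congr rfl fun q _ => ?_
  rw [Finset.mem_range] at hp
  have e1 : ((n : ℤ) + (-1 - p)).toNat = n - 1 - p := by omega
  have e2 : ((n : ℤ) + q).toNat = n + q := by omega
  rw [e1, e2]

lemma halfPairing_zero_left (t : AddMonoidAlgebra ℝ ℤ) : halfPairing 0 t = 0 := by
  simp [halfPairing]

lemma halfPairing_zero_right (s : AddMonoidAlgebra ℝ ℤ) : halfPairing s 0 = 0 := by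
  simp [halfPairing]

lemma exists_coeff_eq_zero (s : AddMonoidAlgebra ℝ ℤ) :
    ∃ d : ℕ, ∀ k : ℤ, (d : ℤ) < |k| → s.coeff k = 0 := by
  refine ⟨s.coeff.support.sup Int.natAbs, fun k hk => ?_⟩
  by_contra h
  have := Finset.le_sup (f := Int.natAbs) (Finsupp.mem_support_iff.2 h)
  rw [Int.abs_eq_natAbs] at hk
  omega

lemma halfPairing_lowSymbol_right (s t : AddMonoidAlgebra ℝ ℤ) :
    halfPairing s (lowSymbol t) = halfPairing s t := by
  obtain ⟨d, hd⟩ := exists_coeff_eq_zero t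
  have hd' : ∀ k : ℤ, (d : ℤ) < k → t.coeff k = 0 := fun k hk =>
    hd k (hk.trans_le (le_abs_self k))
  rw [halfPairing_eq_sum s t d hd', halfPairing_eq_sum s (lowSymbol t) d]
  · refine Finset.sum_congr rfl fun k _ => ?_
    rw [coeff_lowSymbol]
    rcases Nat.eq_zero_or_pos k with rfl | h
    · simp
    · rw [if_pos (by exact_mod_cast h)]
  · intro k hk
    rw [coeff_lowSymbol, hd' k hk, ite_self]

lemma halfPairing_lowSymbol_left (s t : AddMonoidAlgebra ℝ ℤ) :
    halfPairing (lowSymbol s) t = 0 := by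
  refine Finset.sum_eq_zero fun k _ => ?_
  simp only
  rw [coeff_lowSymbol]
  by_cases h : 0 < k
  · rw [if_neg (by omega)]; simp
  · rw [Int.toNat_of_nonpos (by omega)]; simp

/-! ### The asymptotic Wick rule -/

/-- The centred moments of a list of sequences of operators. -/
noncomputable def seqMom (l : List (ℕ → Module.End ℝ Vec)) (n : ℕ) : ℝ :=
  cmom n (l.map fun A => A n)

/-- Boundedness of the centred moments, and smallness if one of the symbols vanishes. -/
def MomBound (l : List (ℕ → Module.End ℝ Vec)) : Prop :=
  seqMom l =O[atTop] (fun _ => (1 : ℝ)) ∧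
    ((∃ A ∈ l, HasSymbol A 0) → seqMom l =o[atTop] (fun _ => (1 : ℝ)))

lemma seqMom_comm (u v : List (ℕ → Module.End ℝ Vec)) (A B : ℕ → Module.End ℝ Vec) (n : ℕ) :
    seqMom (u ++ A :: B :: v) n = seqMom (u ++ B :: A :: v) n
      + seqMom (u ++ (fun n => A n * B n - B n * A n) :: v) n
      + ptr n (A n * B n - B n * A n) * seqMom (u ++ v) n := by
  simp only [seqMom, List.map_append, List.map_cons]
  exact cmom_comm _ _ _ _ _

/-- A strictly lower triangular factor is moved to the left, where it annihilates the vacuum; each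
commutator is scalar up to an operator whose symbol is zero. -/
lemma momBound_of_lower {k : ℕ}
    (ih : ∀ l : List (ℕ → Module.End ℝ Vec), l.length ≤ k → (∀ A ∈ l, ∃ s, HasSymbol A s) →
      MomBound l)
    (X : ℕ → Module.End ℝ Vec) (hX : ∃ s, HasSymbol X s)
    (hlow : ∀ n i j, i ≤ j → ent (X n) i j = 0) (u : List (ℕ → Module.End ℝ Vec)) :
    ∀ v : List (ℕ → Module.End ℝ Vec), u.length + v.length = k →
      (∀ A ∈ u, ∃ s, HasSymbol A s) → (∀ A ∈ v, ∃ s, HasSymbol A s) → MomBound (u ++ X :: v) := by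
  induction u using List.reverseRecOn with
  | nil =>
    intro v _ _ _
    have : seqMom ([] ++ X :: v) = fun _ => 0 := by
      funext n
      exact cmom_lower n _ _ (hlow n)
    rw [MomBound, this]
    exact ⟨Asymptotics.isBigO_zero _ _, fun _ => Asymptotics.isLittleO_zero _ _⟩
  | append_singleton u Y ihu =>
    intro v hk hu hv
    have hY : ∃ s, HasSymbol Y s := hu Y (by simp)
    have hu' : ∀ A ∈ u, ∃ s, HasSymbol A s := fun A hA => hu A (by simp [hA])
    obtain ⟨s, hs⟩ := hY
    obtain ⟨t, ht⟩ := hX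
    have hcomm := hs.commutator ht
    have htr := hs.tendsto_ptr_commutator ht
    rw [List.length_append, List.length_singleton] at hk
    have h1 := ihu (Y :: v) (by rw [List.length_cons]; omega) hu'
      (by intro A hA; rcases List.mem_cons.1 hA with rfl | h; exacts [⟨s, hs⟩, hv A h])
    have h2 := ih (u ++ (fun n => Y n * X n - X n * Y n) :: v) (by simp; omega) (by
      intro A hA
      rcases List.mem_append.1 hA with h | h
      · exact hu' A h
      · rcases List.mem_cons.1 h with rfl | h
        exacts [⟨0, hcomm⟩, hv A h])
    have h3 := ih (u ++ v) (by simp; omega) (by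
      intro A hA
      rcases List.mem_append.1 hA with h | h
      exacts [hu' A h, hv A h])
    have h2' := h2.2 ⟨_, by simp, hcomm⟩
    have heq : seqMom (u ++ [Y] ++ X :: v) = fun n => seqMom (u ++ X :: Y :: v) n
      + seqMom (u ++ (fun n => Y n * X n - X n * Y n) :: v) n
      + ptr n (Y n * X n - X n * Y n) * seqMom (u ++ v) n := by
      funext n
      rw [List.append_assoc]
      exact seqMom_comm u v Y X n
    have htrO := htr.isBigO_one ℝ
    refine ⟨?_, ?_⟩
    · rw [heq]
      refine (h1.1.add h2'.isBigO).add ?_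
      simpa using htrO.mul h3.1
    · rintro ⟨A, hA, hA0⟩
      rw [heq]
      have hA' : A = X ∨ A = Y ∨ A ∈ u ++ v := by
        simp only [List.mem_append, List.mem_cons, List.mem_nil_iff, or_false] at hA ⊢
        tauto
      have htr0 : (A = X ∨ A = Y) →
          (fun n => ptr n (Y n * X n - X n * Y n)) =o[atTop] (fun _ => (1 : ℝ)) := by
        rw [Asymptotics.isLittleO_one_iff]
        rintro (rfl | rfl)
        · simpa [halfPairing_zero_left, halfPairing_zero_right]
            using hs.tendsto_ptr_commutator hA0
        · simpa [halfPairing_zero_left, halfPairing_zero_right]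
            using hA0.tendsto_ptr_commutator ht
      refine ((h1.2 ⟨A, ?_, hA0⟩).add h2').add ?_
      · simp only [List.mem_append, List.mem_cons] at hA' ⊢
        tauto
      · rcases hA' with h | h | h
        · simpa using (htr0 (Or.inl h)).mul_isBigO h3.1
        · simpa using (htr0 (Or.inr h)).mul_isBigO h3.1
        · simpa using htrO.mul_isLittleO (h3.2 ⟨A, h, hA0⟩)

lemma ent_up (A : Module.End ℝ Vec) (i j : ℕ) :
    ent (A - low A) i j = if j < i then 0 else ent A i j := by
  rw [ent_sub, ent_low]
  split_ifs <;> simp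

/-- Splitting one operator into its strictly lower triangular and its upper triangular part. -/
lemma seqMom_split (u v : List (ℕ → Module.End ℝ Vec)) (A : ℕ → Module.End ℝ Vec) (n : ℕ) :
    seqMom (u ++ A :: v) n = seqMom (u ++ (fun n => low (A n)) :: v) n
      + seqMom (u ++ (fun n => A n - low (A n)) :: v) n := by
  simp only [seqMom, List.map_append, List.map_cons]
  rw [← cmom_add]
  have h : low (A n) + (A n - low (A n)) = A n := LinearMap.ext fun v => by simp
  rw [h]

/-- Induction on the number of factors: the last factor may be replaced by its strictly lower
triangular part, which is then moved to the front. -/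
theorem momBound (l : List (ℕ → Module.End ℝ Vec)) (hl : ∀ A ∈ l, ∃ s, HasSymbol A s) :
    MomBound l := by
  obtain ⟨k, hk⟩ : ∃ k, l.length ≤ k := ⟨_, le_rfl⟩
  induction k generalizing l with
  | zero =>
    obtain rfl : l = [] := List.length_eq_zero_iff.1 (by omega)
    have : seqMom [] = fun _ => (1 : ℝ) := by
      funext n; exact cmom_nil n
    rw [MomBound, this]
    exact ⟨Asymptotics.isBigO_refl _ _, by simp⟩
  | succ k ih =>
    rcases Nat.lt_or_ge l.length (k + 1) with h | h
    · exact ih l hl (by omega)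
    rcases List.eq_nil_or_concat' l with rfl | ⟨u, A, rfl⟩
    · simp at h
    rw [List.length_append, List.length_singleton] at h hk
    have hA : ∃ s, HasSymbol A s := hl A (by simp)
    have hu : ∀ B ∈ u, ∃ s, HasSymbol B s := fun B hB => hl B (by simp [hB])
    have heq : seqMom (u ++ [A]) = seqMom (u ++ [fun n => low (A n)]) := by
      funext n
      rw [seqMom_split]
      have : seqMom (u ++ [fun n => A n - low (A n)]) n = 0 := by
        simp only [seqMom, List.map_append, List.map_cons, List.map_nil]
        exact cmom_upper n _ _ fun i j hij => by rw [ent_up, if_pos hij]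
      rw [this, add_zero]
    have key := momBound_of_lower (k := k) (fun l hl' hl => ih l hl hl')
      (fun n => low (A n)) (by obtain ⟨s, hs⟩ := hA; exact ⟨_, hs.low⟩)
      (fun n i j hij => by rw [ent_low, if_neg (by omega)]) u [] (by simp; omega) hu (by simp)
    rw [MomBound, heq]
    refine ⟨key.1, ?_⟩
    rintro ⟨B, hB, hB0⟩
    rcases List.mem_append.1 hB with h' | h'
    · exact key.2 ⟨B, by simp [h'], hB0⟩
    · rw [List.mem_singleton] at h'
      subst h'
      refine key.2 ⟨fun n => low (B n), by simp, ?_⟩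
      have := hB0.low
      rwa [show lowSymbol 0 = 0 by ext; simp [coeff_lowSymbol]] at this

lemma tendsto_seqMom_zero {u v : List (ℕ → Module.End ℝ Vec)} {X : ℕ → Module.End ℝ Vec}
    (hu : ∀ A ∈ u, ∃ s, HasSymbol A s) (hv : ∀ A ∈ v, ∃ s, HasSymbol A s) (hX : HasSymbol X 0) :
    Tendsto (seqMom (u ++ X :: v)) atTop (𝓝 0) := by
  rw [← Asymptotics.isLittleO_one_iff ℝ]
  refine (momBound _ ?_).2 ⟨X, by simp, hX⟩
  intro A hA
  rcases List.mem_append.1 hA with h | h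
  · exact hu A h
  · rcases List.mem_cons.1 h with rfl | h
    exacts [⟨0, hX⟩, hv A h]

section Stein

variable {ι : Type*}

/-- The ordered monomial of a list of indices. -/
noncomputable def lmon (l : List ι) : MvPolynomial ι ℝ := (l.map MvPolynomial.X).prod

lemma lmon_append (u v : List ι) : lmon (u ++ v) = lmon u * lmon v := by
  simp [lmon]

lemma lmon_cons (a : ι) (v : List ι) : lmon (a :: v) = MvPolynomial.X a * lmon v := by
  simp [lmon]

lemma lmon_perm {u v : List ι} (h : u.Perm v) : lmon u = lmon v := (h.map _).prod_eq

lemma mkDerivation_lmon_congr {f g : ι → MvPolynomial ι ℝ} (u : List ι)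
    (h : ∀ i ∈ u, f i = g i) :
    MvPolynomial.mkDerivation ℝ f (lmon u) = MvPolynomial.mkDerivation ℝ g (lmon u) := by
  induction u with
  | nil => simp [lmon]
  | cons a u ih =>
    rw [lmon_cons, Derivation.leibniz, Derivation.leibniz, ih fun i hi => h i (by simp [hi]),
      MvPolynomial.mkDerivation_X, MvPolynomial.mkDerivation_X, h a (by simp)]

variable [LinearOrder ι] {A : ι → ℕ → Module.End ℝ Vec} {s : ι → AddMonoidAlgebra ℝ ℤ}

/-- The functionals `T n` on commuting polynomials are given, on monomials, by time-ordered
centred moments of operators. This is required for large `n` only: for the ensembles, the supports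
of the weights have to be large compared to the degree of the monomial. -/
def TimeOrdered (A : ι → ℕ → Module.End ℝ Vec) (T : ℕ → MvPolynomial ι ℝ →ₗ[ℝ] ℝ) : Prop :=
  ∀ l : List ι, l.Pairwise (· ≤ ·) → ∀ᶠ n in atTop, T n (lmon l) = seqMom (l.map A) n

variable {T : ℕ → MvPolynomial ι ℝ →ₗ[ℝ] ℝ}

/-- A strictly lower triangular part contracts with all the operators on its left. -/
lemma seqMom_sub_low (hA : ∀ i, HasSymbol (A i) (s i)) (hT : TimeOrdered A T) (r : ι)
    (u : List ι) : ∀ v : List ι, (u ++ v).Pairwise (· ≤ ·) →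
    Tendsto (fun n => seqMom (u.map A ++ (fun n => low (A r n)) :: v.map A) n
      - T n (MvPolynomial.mkDerivation ℝ
          (fun i => MvPolynomial.C (halfPairing (s i) (s r))) (lmon u) * lmon v)) atTop (𝓝 0) := by
  have hex : ∀ l : List ι, ∀ B ∈ l.map A, ∃ s, HasSymbol B s := by
    intro l B hB
    obtain ⟨i, -, rfl⟩ := List.mem_map.1 hB
    exact ⟨_, hA i⟩
  induction u using List.reverseRecOn with
  | nil =>
    intro v _
    refine tendsto_const_nhds.congr fun n => ?_
    have : seqMom (([] : List ι).map A ++ (fun n => low (A r n)) :: v.map A) n = 0 :=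
      cmom_lower n _ _ fun i j hij => by rw [ent_low, if_neg (by omega)]
    rw [this]
    simp [lmon]
  | append_singleton u y ih =>
    intro v hv
    have h1 := ih (y :: v) (by simpa using hv)
    have hcomm := (hA y).commutator (hA r).low
    have h2 := tendsto_seqMom_zero (hex u) (hex v) hcomm
    have hsub : (u ++ v).Pairwise (· ≤ ·) := hv.sublist (by simp)
    have h3 := (momBound _ (hex (u ++ v))).1
    have htr := (hA y).tendsto_ptr_commutator (hA r).low
    rw [halfPairing_lowSymbol_right, halfPairing_lowSymbol_left, sub_zero] at htr
    have h4 : Tendsto (fun n => (ptr n (A y n * low (A r n) - low (A r n) * A y n)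
        - halfPairing (s y) (s r)) * seqMom ((u ++ v).map A) n) atTop (𝓝 0) := by
      rw [← Asymptotics.isLittleO_one_iff ℝ]
      have : (fun n => ptr n (A y n * low (A r n) - low (A r n) * A y n)
        - halfPairing (s y) (s r)) =o[atTop] (fun _ => (1 : ℝ)) := by
        rw [Asymptotics.isLittleO_one_iff]
        simpa using htr.sub_const (halfPairing (s y) (s r))
      simpa using this.mul_isBigO h3
    have h5 := (h1.add h2).add h4
    simp only [add_zero] at h5
    refine h5.congr' ?_
    filter_upwards [hT (u ++ v) hsub] with n hn
    have e1 : seqMom ((u ++ [y]).map A ++ (fun n => low (A r n)) :: v.map A) n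
        = seqMom (u.map A ++ (fun n => low (A r n)) :: (y :: v).map A) n
          + seqMom (u.map A ++ (fun n => A y n * low (A r n) - low (A r n) * A y n) :: v.map A) n
          + ptr n (A y n * low (A r n) - low (A r n) * A y n) * seqMom ((u ++ v).map A) n := by
      have := seqMom_comm (u.map A) (v.map A) (A y) (fun n => low (A r n)) n
      simpa using this
    have e2 : MvPolynomial.mkDerivation ℝ
          (fun i => MvPolynomial.C (halfPairing (s i) (s r))) (lmon (u ++ [y])) * lmon v
        = MvPolynomial.mkDerivation ℝ
          (fun i => MvPolynomial.C (halfPairing (s i) (s r))) (lmon u) * lmon (y :: v)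
          + halfPairing (s y) (s r) • lmon (u ++ v) := by
      have e3 : lmon [y] = (MvPolynomial.X y : MvPolynomial ι ℝ) := by simp [lmon]
      rw [lmon_append, Derivation.leibniz, e3, MvPolynomial.mkDerivation_X, lmon_cons,
        lmon_append, MvPolynomial.smul_eq_C_mul]
      simp only [smul_eq_mul]
      ring
    rw [e1, e2, map_add, map_smul, hn, smul_eq_mul]
    ring

/-- An upper triangular part contracts with all the operators on its right. -/
lemma seqMom_sub_up (hA : ∀ i, HasSymbol (A i) (s i)) (hT : TimeOrdered A T) (r : ι)
    (v : List ι) : ∀ u : List ι, (u ++ v).Pairwise (· ≤ ·) →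
    Tendsto (fun n => seqMom (u.map A ++ (fun n => A r n - low (A r n)) :: v.map A) n
      - T n (lmon u * MvPolynomial.mkDerivation ℝ
          (fun i => MvPolynomial.C (halfPairing (s r) (s i))) (lmon v))) atTop (𝓝 0) := by
  have hex : ∀ l : List ι, ∀ B ∈ l.map A, ∃ s, HasSymbol B s := by
    intro l B hB
    obtain ⟨i, -, rfl⟩ := List.mem_map.1 hB
    exact ⟨_, hA i⟩
  have hup := (hA r).sub (hA r).low
  induction v with
  | nil =>
    intro u _
    refine tendsto_const_nhds.congr fun n => ?_
    have : seqMom (u.map A ++ (fun n => A r n - low (A r n)) :: ([] : List ι).map A) n = 0 := by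
      simp only [seqMom, List.map_append, List.map_cons, List.map_nil]
      exact cmom_upper n _ _ fun i j hij => by rw [ent_up, if_pos hij]
    rw [this]
    simp [lmon]
  | cons y v ih =>
    intro u hv
    have h1 := ih (u ++ [y]) (by simpa using hv)
    have hcomm := hup.commutator (hA y)
    have h2 := tendsto_seqMom_zero (hex u) (hex v) hcomm
    have hsub : (u ++ v).Pairwise (· ≤ ·) := hv.sublist (by simp)
    have h3 := (momBound _ (hex (u ++ v))).1
    have htr : Tendsto (fun n => ptr n ((A r n - low (A r n)) * A y n
        - A y n * (A r n - low (A r n)))) atTop (𝓝 (halfPairing (s r) (s y))) := by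
      have h6 := (hA r).tendsto_ptr_commutator (hA y)
      have h7 := (hA y).tendsto_ptr_commutator (hA r).low
      rw [halfPairing_lowSymbol_right, halfPairing_lowSymbol_left, sub_zero] at h7
      have h8 := h6.add h7
      rw [sub_add_cancel] at h8
      refine h8.congr fun n => ?_
      rw [← ptr_add]
      congr 1
      refine LinearMap.ext fun v => ?_
      simp only [LinearMap.add_apply, LinearMap.sub_apply, Module.End.mul_apply, map_sub]
      abel
    have h4 : Tendsto (fun n => (ptr n ((A r n - low (A r n)) * A y n
        - A y n * (A r n - low (A r n)))
        - halfPairing (s r) (s y)) * seqMom ((u ++ v).map A) n) atTop (𝓝 0) := by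
      rw [← Asymptotics.isLittleO_one_iff ℝ]
      have : (fun n => ptr n ((A r n - low (A r n)) * A y n
        - A y n * (A r n - low (A r n)))
        - halfPairing (s r) (s y)) =o[atTop] (fun _ => (1 : ℝ)) := by
        rw [Asymptotics.isLittleO_one_iff]
        simpa using htr.sub_const (halfPairing (s r) (s y))
      simpa using this.mul_isBigO h3
    have h5 := (h1.add h2).add h4
    simp only [add_zero] at h5
    refine h5.congr' ?_
    filter_upwards [hT (u ++ v) hsub] with n hn
    have e1 : seqMom (u.map A ++ (fun n => A r n - low (A r n)) :: (y :: v).map A) n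
        = seqMom ((u ++ [y]).map A ++ (fun n => A r n - low (A r n)) :: v.map A) n
          + seqMom (u.map A ++ (fun n => (A r n - low (A r n)) * A y n
            - A y n * (A r n - low (A r n))) :: v.map A) n
          + ptr n ((A r n - low (A r n)) * A y n - A y n * (A r n - low (A r n)))
            * seqMom ((u ++ v).map A) n := by
      have := seqMom_comm (u.map A) (v.map A) (fun n => A r n - low (A r n)) (A y) n
      simpa using this
    have e2 : lmon u * MvPolynomial.mkDerivation ℝ
          (fun i => MvPolynomial.C (halfPairing (s r) (s i))) (lmon (y :: v))
        = lmon (u ++ [y]) * MvPolynomial.mkDerivation ℝ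
          (fun i => MvPolynomial.C (halfPairing (s r) (s i))) (lmon v)
          + halfPairing (s r) (s y) • lmon (u ++ v) := by
      have e3 : lmon [y] = (MvPolynomial.X y : MvPolynomial ι ℝ) := by simp [lmon]
      rw [lmon_cons, Derivation.leibniz, lmon_append, e3, MvPolynomial.mkDerivation_X,
        lmon_append, MvPolynomial.smul_eq_C_mul]
      simp only [smul_eq_mul]
      ring
    rw [e1, e2, map_add, map_smul, hn, smul_eq_mul]
    ring

/-- The limiting covariance of the statistics attached to two symbols at two times. -/
noncomputable def symCov (s : ι → AddMonoidAlgebra ℝ ℤ) (r i : ι) : ℝ :=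
  halfPairing (s (min r i)) (s (max r i))

/-- Asymptotic Gaussian integration by parts (Stein's identity) for time-ordered moments. -/
theorem stein_identity (hA : ∀ i, HasSymbol (A i) (s i)) (hT : TimeOrdered A T) (r : ι)
    (P : MvPolynomial ι ℝ) :
    Tendsto (fun n => T n (MvPolynomial.X r * P) - T n (MvPolynomial.mkDerivation ℝ
      (fun i => MvPolynomial.C (symCov s r i)) P)) atTop (𝓝 0) := by
  have key : ∀ l : List ι, Tendsto (fun n => T n (MvPolynomial.X r * lmon l)
      - T n (MvPolynomial.mkDerivation ℝ (fun i => MvPolynomial.C (symCov s r i)) (lmon l)))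
      atTop (𝓝 0) := by
    intro l
    obtain ⟨u, v, huv, hperm, hu, hv⟩ : ∃ u v : List ι, (u ++ r :: v).Pairwise (· ≤ ·) ∧
        l.Perm (u ++ v) ∧ (∀ i ∈ u, i ≤ r) ∧ (∀ i ∈ v, r ≤ i) := by
      set l' := (r :: l).mergeSort (fun a b => decide (a ≤ b)) with hl'
      have hs : l'.Pairwise (· ≤ ·) := by
        have := List.pairwise_mergeSort (le := fun a b : ι => decide (a ≤ b))
          (by intro a b c; simpa using le_trans) (by intro a b; simpa using le_total a b) (r :: l)
        simpa using this
      have hp : l'.Perm (r :: l) := List.mergeSort_perm _ _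
      have hr : r ∈ l' := hp.mem_iff.2 (by simp)
      obtain ⟨u, v, huv⟩ := List.append_of_mem hr
      rw [huv] at hs hp
      refine ⟨u, v, hs, ?_, ?_, ?_⟩
      · have := (List.perm_middle.symm.trans hp)
        exact (List.perm_cons r).1 this.symm
      · intro i hi
        exact (List.pairwise_append.1 hs).2.2 i hi r (by simp)
      · intro i hi
        have := (List.pairwise_append.1 hs).2.1
        exact (List.pairwise_cons.1 this).1 i hi
    have hsub : (u ++ v).Pairwise (· ≤ ·) := huv.sublist (by simp)
    have h1 := seqMom_sub_low hA hT r u v hsub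
    have h2 := seqMom_sub_up hA hT r v u hsub
    have h3 := h1.add h2
    rw [add_zero] at h3
    refine h3.congr' ?_
    filter_upwards [hT (u ++ r :: v) huv] with n hn
    have e1 : T n (MvPolynomial.X r * lmon l) = seqMom (u.map A ++ A r :: v.map A) n := by
      rw [lmon_perm hperm, ← lmon_cons, lmon_perm (List.perm_middle.symm : (r :: (u ++ v)).Perm _),
        hn]
      simp
    have e2 : MvPolynomial.mkDerivation ℝ (fun i => MvPolynomial.C (symCov s r i)) (lmon l)
        = MvPolynomial.mkDerivation ℝ
            (fun i => MvPolynomial.C (halfPairing (s i) (s r))) (lmon u) * lmon v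
          + lmon u * MvPolynomial.mkDerivation ℝ
            (fun i => MvPolynomial.C (halfPairing (s r) (s i))) (lmon v) := by
      rw [lmon_perm hperm, lmon_append, Derivation.leibniz,
        mkDerivation_lmon_congr (g := fun i => MvPolynomial.C (halfPairing (s i) (s r))) u,
        mkDerivation_lmon_congr (g := fun i => MvPolynomial.C (halfPairing (s r) (s i))) v]
      · simp only [smul_eq_mul]; ring
      · intro i hi; rw [symCov, min_eq_left (hv i hi), max_eq_right (hv i hi)]
      · intro i hi; rw [symCov, min_eq_right (hu i hi), max_eq_left (hu i hi)]
    rw [e1, e2, seqMom_split (u.map A) (v.map A) (A r), map_add]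
    ring
  induction P using MvPolynomial.induction_on' with
  | add p q hp hq =>
    have := hp.add hq
    rw [add_zero] at this
    refine this.congr fun n => ?_
    rw [mul_add, map_add, map_add, map_add]
    ring
  | monomial m c =>
    obtain ⟨l, hl⟩ : ∃ l : List ι, MvPolynomial.monomial m (1 : ℝ) = lmon l := by
      refine ⟨(Finsupp.toMultiset m).toList, ?_⟩
      rw [lmon, ← Multiset.prod_coe, ← Multiset.map_coe, Multiset.coe_toList,
        Finsupp.toMultiset_map, Finsupp.prod_toMultiset, Finsupp.prod_mapDomain_index (by simp)
        (by intros; rw [pow_add]), MvPolynomial.monomial_eq]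
      simp
    have h1 : MvPolynomial.monomial m c = c • lmon l := by
      rw [← hl, MvPolynomial.smul_monomial, smul_eq_mul, mul_one]
    have := (key l).const_mul c
    rw [mul_zero] at this
    refine this.congr fun n => ?_
    rw [h1, mul_smul_comm, map_smul, Derivation.map_smul, map_smul, smul_eq_mul, smul_eq_mul]
    ring

/-- The moments of the sum of the variables obey asymptotically the recursion of Gaussian
moments. -/
theorem tendsto_moment_recursion [Fintype ι] (hA : ∀ i, HasSymbol (A i) (s i))
    (hT : TimeOrdered A T) (K : ℕ) :
    Tendsto (fun n => T n ((∑ i, MvPolynomial.X i) ^ (K + 1))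
      - K * (∑ r, ∑ i, symCov s r i) * T n ((∑ i, MvPolynomial.X i) ^ (K - 1))) atTop (𝓝 0) := by
  have h := tendsto_finsetSum Finset.univ fun (r : ι) _ =>
    stein_identity hA hT r ((∑ i, MvPolynomial.X i) ^ K)
  rw [Finset.sum_const_zero] at h
  refine h.congr fun n => ?_
  rw [Finset.sum_sub_distrib, ← map_sum, ← Finset.sum_mul, ← pow_succ']
  congr 1
  rw [Finset.mul_sum, Finset.sum_mul]
  refine Finset.sum_congr rfl fun r _ => ?_
  have e : MvPolynomial.mkDerivation ℝ (fun i => MvPolynomial.C (symCov s r i))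
      ((∑ i : ι, MvPolynomial.X i) ^ K)
      = ((K : ℝ) * ∑ i, symCov s r i) • (∑ i : ι, MvPolynomial.X i) ^ (K - 1) := by
    rw [Derivation.leibniz_pow, map_sum, MvPolynomial.smul_eq_C_mul, map_mul, nsmul_eq_mul,
      smul_eq_mul]
    simp only [MvPolynomial.mkDerivation_X, map_natCast, map_sum]
    ring
  rw [e, map_smul, smul_eq_mul]

end Stein

/-! ### Summation over configurations -/

lemma hasSum_pi_prod {X : Type*} {n : ℕ} (f : Fin n → X → ℝ) (hf : ∀ i, Summable (f i)) :
    HasSum (fun y : Fin n → X => ∏ i, f i (y i)) (∏ i, ∑' x, f i x) := by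
  induction n with
  | zero => simp
  | succ n ih =>
    have h := ih (fun i => f i.succ) fun i => hf i.succ
    rw [← (Fin.consEquiv fun _ : Fin (n + 1) => X).hasSum_iff, Fin.prod_univ_succ]
    have h2 : Summable fun z : X × (Fin n → X) => f 0 z.1 * ∏ i, f (Fin.succ i) (z.2 i) :=
      summable_mul_of_summable_norm (f := f 0)
        (g := fun y : Fin n → X => ∏ i, f (Fin.succ i) (y i)) (hf 0).norm h.summable.norm
    have h3 := HasSum.mul (f := f 0)
        (g := fun y : Fin n → X => ∏ i, f (Fin.succ i) (y i)) (hf 0).hasSum h h2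
    refine h3.congr_fun fun z => ?_
    simp [Fin.prod_univ_succ, Fin.consEquiv]

/-- The Andréief (Cauchy–Binet) identity for sums. -/
theorem hasSum_andreief {X : Type*} {n : ℕ} (f g : Fin n → X → ℝ)
    (hfg : ∀ i j, Summable fun x => f i x * g j x) :
    HasSum (fun y : Fin n → X => (Matrix.of fun i j => f i (y j)).det
        * (Matrix.of fun i j => g i (y j)).det)
      (n.factorial * (Matrix.of fun i j => ∑' x, f i x * g j x).det) := by
  set M : Matrix (Fin n) (Fin n) ℝ := Matrix.of fun i j => ∑' x, f i x * g j x with hM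
  have h1 : HasSum (fun y : Fin n → X => ∑ σ : Equiv.Perm (Fin n), ∑ τ : Equiv.Perm (Fin n),
      ((σ.sign : ℤ) : ℝ) * (((τ.sign : ℤ) : ℝ) * ∏ j, (f (τ j) (y j) * g (σ j) (y j))))
      (∑ σ : Equiv.Perm (Fin n), ∑ τ : Equiv.Perm (Fin n),
      ((σ.sign : ℤ) : ℝ) * (((τ.sign : ℤ) : ℝ) * ∏ j, ∑' x, (f (τ j) x * g (σ j) x))) := by
    refine hasSum_sum fun σ _ => hasSum_sum fun τ _ => ?_
    exact ((hasSum_pi_prod (fun j x => f (τ j) x * g (σ j) x)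
      fun j => hfg _ _).mul_left _).mul_left _
  have h2 : (∑ σ : Equiv.Perm (Fin n), ∑ τ : Equiv.Perm (Fin n),
      ((σ.sign : ℤ) : ℝ) * (((τ.sign : ℤ) : ℝ) * ∏ j, ∑' x, (f (τ j) x * g (σ j) x)))
      = n.factorial * M.det := by
    have h3 : ∀ σ : Equiv.Perm (Fin n), ∑ τ : Equiv.Perm (Fin n),
        ((σ.sign : ℤ) : ℝ) * (((τ.sign : ℤ) : ℝ) * ∏ j, ∑' x, (f (τ j) x * g (σ j) x))
        = M.det := by
      intro σ
      have h4 : (M.submatrix id σ).det = ∑ τ : Equiv.Perm (Fin n),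
          ((τ.sign : ℤ) : ℝ) * ∏ j, ∑' x, (f (τ j) x * g (σ j) x) := by
        rw [Matrix.det_apply']
        simp [hM]
      rw [← Finset.mul_sum, ← h4, Matrix.det_permute', ← mul_assoc, ← Int.cast_mul]
      simp
    rw [Finset.sum_congr rfl fun σ _ => h3 σ]
    simp [Fintype.card_perm]
  rw [h2] at h1
  refine h1.congr_fun fun y => ?_
  rw [Matrix.det_apply', Matrix.det_apply', Finset.mul_sum]
  refine Finset.sum_congr rfl fun σ _ => ?_
  rw [Finset.sum_mul]
  refine Finset.sum_congr rfl fun τ _ => ?_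
  simp only [Matrix.of_apply, Finset.prod_mul_distrib]
  ring

section Chain

variable {X : Type*}

/-- A product of transition weights along a chain of states. -/
noncomputable def chainProd {M : ℕ} (u : X → ℝ) (K : Fin M → X → X → ℝ) (h : X → ℝ)
    (y : Fin (M + 1) → X) : ℝ :=
  u (y 0) * (∏ m : Fin M, K m (y m.castSucc) (y m.succ)) * h (y (Fin.last M))

lemma chainProd_cons {M : ℕ} (u : X → ℝ) (K : Fin (M + 1) → X → X → ℝ) (h : X → ℝ) (x : X)
    (y : Fin (M + 1) → X) : chainProd u K h (Fin.cons x y : Fin (M + 2) → X)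
      = chainProd (fun z => u x * K 0 x z) (fun m => K m.succ) h y := by
  simp only [chainProd, Fin.prod_univ_succ, Fin.cons_zero, Fin.castSucc_zero, Fin.cons_succ,
    ← Fin.succ_last, ← Fin.succ_castSucc, mul_assoc]

/-- Summation along a chain, starting from its end: `B m x` is the sum over all states after time
`m`, given the state `x` at that time. Convergence of the iterated sums implies absolute convergence
only if the summands are non-negative, hence the alternative. -/
lemma hasSum_chainProd {M : ℕ} (K : Fin M → X → X → ℝ) (h : X → ℝ)
    (B : Fin (M + 1) → X → ℝ) (hB : B (Fin.last M) = h)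
    (hK : ∀ m x, HasSum (fun y => K m x y * B m.succ y) (B m.castSucc x)) (u : X → ℝ) {S : ℝ}
    (hu : HasSum (fun x => u x * B 0 x) S)
    (hc : (∀ y, 0 ≤ chainProd u K h y) ∨ Summable (chainProd u K h)) :
    HasSum (chainProd u K h) S := by
  induction M generalizing u S with
  | zero =>
    rw [← (Equiv.funUnique (Fin 1) X).symm.hasSum_iff]
    refine hu.congr_fun fun x => ?_
    have : B 0 = h := hB
    simp [chainProd, this]
  | succ M ih =>
    rw [← (Fin.consEquiv fun _ : Fin (M + 2) => X).hasSum_iff]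
    have hcons : ∀ z : X × (Fin (M + 1) → X),
        (chainProd u K h ∘ (Fin.consEquiv fun _ : Fin (M + 2) => X)) z
        = chainProd (fun x => u z.1 * K 0 z.1 x) (fun m => K m.succ) h z.2 := fun z =>
      chainProd_cons u K h z.1 z.2
    have hc' : (∀ z, 0 ≤ (chainProd u K h ∘ (Fin.consEquiv fun _ : Fin (M + 2) => X)) z) ∨
        Summable (chainProd u K h ∘ (Fin.consEquiv fun _ : Fin (M + 2) => X)) :=
      hc.imp (fun h z => h _) fun h => (Equiv.summable_iff _).2 h
    have hfib : ∀ x, HasSum (fun y => (chainProd u K h ∘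
        (Fin.consEquiv fun _ : Fin (M + 2) => X)) (x, y)) (u x * B 0 x) := by
      intro x
      simp only [hcons]
      refine ih (fun m => K m.succ) (fun m => B m.succ) (by rw [← hB, Fin.succ_last])
        (fun m x => hK m.succ x) (fun z => u x * K 0 x z) ?_ ?_
      · refine ((hK 0 x).mul_left (u x)).congr_fun fun y => ?_
        simp [mul_assoc]
      · refine hc'.imp (fun h y => ?_) fun h => ?_
        · rw [← hcons (x, y)]; exact h _
        · have := h.prod_factor x
          simpa only [hcons] using this
    have hsum : Summable (chainProd u K h ∘ (Fin.consEquiv fun _ : Fin (M + 2) => X)) := by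
      rcases hc' with h' | h'
      · refine (summable_prod_of_nonneg fun z => h' z).2 ⟨fun x => (hfib x).summable, ?_⟩
        refine hu.summable.congr fun x => ?_
        rw [(hfib x).tsum_eq]
      · exact h'
    have := hsum.hasSum
    rwa [(this.prod_fiberwise hfib).unique hu] at this

/-- Summation along a chain with one state kept fixed, from both ends: `A` is the result of summing
over the past and `B` that of summing over the future. -/
lemma hasSum_chainProd_marginal {M : ℕ} (K : Fin M → X → X → ℝ) (h : X → ℝ)
    (B : Fin (M + 1) → X → ℝ) (hB : B (Fin.last M) = h)
    (hK : ∀ m x, HasSum (fun y => K m x y * B m.succ y) (B m.castSucc x))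
    (u : X → ℝ) (A : Fin (M + 1) → X → ℝ) (hA : A 0 = u)
    (hK' : ∀ m y, HasSum (fun x => A m.castSucc x * K m x y) (A m.succ y))
    (F : X → ℝ) (j : Fin (M + 1)) {S : ℝ} (hS : HasSum (fun x => A j x * F x * B j x) S)
    (hc : Summable fun y => chainProd u K h y * F (y j)) :
    HasSum (fun y => chainProd u K h y * F (y j)) S := by
  induction M generalizing u S with
  | zero =>
    rw [← (Equiv.funUnique (Fin 1) X).symm.hasSum_iff]
    refine hS.congr_fun fun x => ?_
    obtain rfl : j = 0 := Fin.fin_one_eq_zero j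
    have : B 0 = h := hB
    simp [chainProd, this, hA]
    ring
  | succ M ih =>
    induction j using Fin.cases with
    | zero =>
      have heq : (fun y => chainProd u K h y * F (y 0))
          = chainProd (fun x => u x * F x) K h := by
        funext y
        simp only [chainProd]
        ring
      rw [heq] at hc ⊢
      refine hasSum_chainProd K h B hB hK _ ?_ (Or.inr hc)
      rw [← hA]
      exact hS
    | succ j =>
      have hc2 := ((Fin.consEquiv fun _ : Fin (M + 2) => X).trans (Equiv.refl _)).summable_iff.2 hc
      have hc3 := (Equiv.prodComm _ _).summable_iff.2 hc2
      set G : (Fin (M + 1) → X) × X → ℝ := fun z =>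
        chainProd (fun x => u z.2 * K 0 z.2 x) (fun m => K m.succ) h z.1 * F (z.1 j) with hG
      have hGeq : (((fun y => chainProd u K h y * F (y j.succ)) ∘
          ((Fin.consEquiv fun _ : Fin (M + 2) => X).trans (Equiv.refl _))) ∘
          (Equiv.prodComm _ _)) = G := by
        funext z
        have := chainProd_cons u K h z.2 z.1
        simp only [Function.comp_apply, hG, Equiv.trans_apply, Equiv.refl_apply,
          Equiv.prodComm_apply, Prod.swap]
        rw [← this]
        rfl
      have hfib : ∀ y : Fin (M + 1) → X, HasSum (fun x => G (y, x))
          (chainProd (A 1) (fun m => K m.succ) h y * F (y j)) := by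
        intro y
        have := hK' 0 (y 0)
        rw [Fin.castSucc_zero, hA] at this
        have h2 := this.mul_right ((∏ m : Fin M, K m.succ (y m.castSucc) (y m.succ))
          * h (y (Fin.last M)) * F (y j))
        have e1 : (fun x => G (y, x)) = fun x => u x * K 0 x (y 0)
            * ((∏ m : Fin M, K m.succ (y m.castSucc) (y m.succ))
              * h (y (Fin.last M)) * F (y j)) := by
          funext x
          simp only [hG, chainProd]
          ring
        have e2 : chainProd (A 1) (fun m => K m.succ) h y * F (y j) = A (Fin.succ 0) (y 0)
            * ((∏ m : Fin M, K m.succ (y m.castSucc) (y m.succ))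
              * h (y (Fin.last M)) * F (y j)) := by
          simp only [chainProd, Fin.succ_zero_eq_one]
          ring
        rw [e1, e2]
        exact h2
      rw [hGeq] at hc3
      have h4 := hc3.hasSum
      have h5 := h4.prod_fiberwise hfib
      have h6 := ih (fun m => K m.succ) (fun m => B m.succ) (by rw [← hB, Fin.succ_last])
        (fun m x => hK m.succ x) (A 1) (fun m => A m.succ) rfl (fun m y => hK' m.succ y) j hS
        h5.summable
      rw [h5.unique h6, ← hGeq] at h4
      have h7 := (Equiv.hasSum_iff _).1 ((Equiv.hasSum_iff _).1 h4)
      exact h7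

end Chain

/-! ### Orthogonal expansions in `ℓ²` -/

/-- Pairing of an `ℓ²`-convergent orthogonal expansion with the orthonormal functions. -/
lemma hasSum_orthogonal_expansion (I : Set ℕ) (e : ℕ → ℤ → ℝ) (he0 : ∀ k, k ∉ I → e k = 0)
    (he : ∀ j ∈ I, ∀ k ∈ I, HasSum (fun y => e j y * e k y) (if j = k then 1 else 0))
    (α : ℕ → ℝ) (hα : Summable fun k => ∑' y, (α k * e k y) ^ 2) {k : ℕ} (hk : k ∈ I) :
    HasSum (fun y => (∑' j, α j * e j y) * e k y) (α k) := by
  classical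
  have he' : ∀ j k, HasSum (fun y => e j y * e k y) (if j ∈ I ∧ j = k then 1 else 0) := by
    intro j k
    by_cases hj : j ∈ I
    · by_cases hk : k ∈ I
      · simpa [hj] using he j hj k hk
      · have : ¬ (j ∈ I ∧ j = k) := by rintro ⟨_, rfl⟩; exact hk hj
        rw [if_neg this, he0 k hk]
        simp
    · rw [if_neg (by tauto), he0 j hj]
      simp
  have hmem : ∀ k, Memℓp (e k) 2 := by
    intro k
    refine memℓp_gen ?_
    have := (he' k k).summable
    refine this.congr fun y => ?_
    simp [sq]
  set E : ℕ → lp (fun _ : ℤ => ℝ) 2 := fun k => ⟨e k, hmem k⟩ with hE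
  have hcoe : ∀ k y, (E k : ℤ → ℝ) y = e k y := fun k y => rfl
  have hinner : ∀ j k, inner ℝ (E j) (E k) = if j ∈ I ∧ j = k then (1 : ℝ) else 0 := by
    intro j k
    have h1 := lp.hasSum_inner (𝕜 := ℝ) (E j) (E k)
    refine h1.unique ((he' j k).congr_fun fun y => ?_)
    simp [hcoe, mul_comm]
  set v : ℕ → lp (fun _ : ℤ => ℝ) 2 := fun k => α k • E k with hv
  have horth : OrthogonalFamily ℝ (fun k => (ℝ ∙ v k : Submodule ℝ (lp (fun _ : ℤ => ℝ) 2)))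
      (fun k => (ℝ ∙ v k).subtypeₗᵢ) := by
    intro i j hij a b
    obtain ⟨a, ha⟩ := a
    obtain ⟨b, hb⟩ := b
    obtain ⟨r, rfl⟩ := Submodule.mem_span_singleton.1 ha
    obtain ⟨t, rfl⟩ := Submodule.mem_span_singleton.1 hb
    simp [hv, inner_smul_left, inner_smul_right, hinner, hij]
  have hnorm : ∀ k, ‖v k‖ ^ 2 = ∑' y, (α k * e k y) ^ 2 := by
    intro k
    rw [← real_inner_self_eq_norm_sq, ← (lp.hasSum_inner (𝕜 := ℝ) (v k) (v k)).tsum_eq]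
    refine tsum_congr fun y => ?_
    simp only [hv, lp.coeFn_smul, Pi.smul_apply, hcoe, smul_eq_mul, sq]
    refine (real_inner_self_eq_norm_sq _).trans ?_
    rw [Real.norm_eq_abs, sq_abs]
    ring
  have hsum : Summable v := by
    have := (horth.summable_iff_norm_sq_summable
      (fun k => ⟨v k, Submodule.mem_span_singleton_self (v k)⟩)).2 (by
        refine hα.congr fun k => ?_
        rw [← hnorm]
        rfl)
    exact this
  obtain ⟨V, hV⟩ := hsum
  have hVy : ∀ y, (V : ℤ → ℝ) y = ∑' j, α j * e j y := by
    intro y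
    have := hV.mapL (lp.evalCLM ℝ (fun _ : ℤ => ℝ) 2 y)
    refine (this.tsum_eq.symm.trans ?_ : (V : ℤ → ℝ) y = _)
    exact tsum_congr fun j => rfl
  have hin : inner ℝ V (E k) = α k := by
    have h1 := hV.mapL (innerSL ℝ (E k))
    rw [innerSL_apply_apply, real_inner_comm] at h1
    refine h1.unique ?_
    have h2 : (fun j => innerSL ℝ (E k) (v j)) = fun j => if j = k then α k else 0 := by
      funext j
      rw [innerSL_apply_apply, hv]
      simp only [inner_smul_right, hinner]
      by_cases hjk : j = k
      · subst hjk; simp [hk]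
      · rw [if_neg (by rintro ⟨_, h⟩; exact hjk h.symm), if_neg hjk, mul_zero]
    rw [h2]
    exact hasSum_ite_eq k (α k)
  rw [← hin]
  refine (lp.hasSum_inner (𝕜 := ℝ) V (E k)).congr_fun fun y => ?_
  simp [hVy, hcoe, mul_comm]

/-! ### Determinantal structure of the ensemble -/

section Ensemble

variable {N n : ℕ} (E : ExtendedEnsemble N n)

/-- The number of points in the support of the weight. -/
noncomputable def numSupp (m : Fin (N + 1)) : ℕ∞ := (Function.support (E.w m)).encard

/-- The orthonormal functions `r_k √w` in `ℓ²(ℤ)`. -/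
noncomputable def rho (m : Fin (N + 1)) (k : ℕ) (y : ℤ) : ℝ :=
  (E.p m k).eval (E.ν m y) * √(E.w m y)

lemma hasSum_rho_mul_rho (m : Fin (N + 1)) {j k : ℕ} (hj : (j : ℕ∞) < numSupp E m)
    (hk : (k : ℕ∞) < numSupp E m) :
    HasSum (fun y => rho E m j y * rho E m k y) (if j = k then 1 else 0) := by
  refine ((E.orthonormal m).orthonormal j k hj hk).congr_fun fun y => ?_
  have := Real.mul_self_sqrt (E.w_nonneg m y)
  simp only [rho]
  calc _ = (E.p m j).eval (E.ν m y) * (E.p m k).eval (E.ν m y)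
        * (√(E.w m y) * √(E.w m y)) := by ring
    _ = _ := by rw [this]

lemma rho_eq_zero (m : Fin (N + 1)) {k : ℕ} (hk : numSupp E m ≤ k) : rho E m k = 0 := by
  funext y
  simp [rho, (E.orthonormal m).eq_zero k hk]

/-- The transition function, symmetrized with respect to the counting measure. -/
noncomputable def symTrans (m : Fin N) (x y : ℤ) : ℝ :=
  √(E.w m.castSucc x) * transition E.ν E.p E.c m x y * √(E.w m.succ y)

lemma hasSum_symTrans_right (m : Fin N) (x : ℤ) {k : ℕ} (hk : (k : ℕ∞) < numSupp E m.succ) :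
    HasSum (fun y => symTrans E m x y * rho E m.succ k y)
      (E.c m.succ k / E.c m.castSucc k * rho E m.castSucc k x) := by
  by_cases hx : E.w m.castSucc x = 0
  · simp [symTrans, rho, hx]
  have h := hasSum_orthogonal_expansion {k | (k : ℕ∞) < numSupp E m.succ} (rho E m.succ)
    (fun k hk => rho_eq_zero E m.succ (not_lt.1 hk))
    (fun j hj k hk => hasSum_rho_mul_rho E m.succ hj hk)
    (fun k => E.c m.succ k / E.c m.castSucc k * (E.p m.castSucc k).eval (E.ν m.castSucc x))
    (by
      refine (E.transition_right m x hx).congr fun k => tsum_congr fun y => ?_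
      have := Real.sq_sqrt (E.w_nonneg m.succ y)
      simp only [transitionTerm, rho, mul_pow, this]
      ring) hk
  have h2 := h.mul_left √(E.w m.castSucc x)
  have e : √(E.w m.castSucc x) * (E.c m.succ k / E.c m.castSucc k
      * (E.p m.castSucc k).eval (E.ν m.castSucc x))
      = E.c m.succ k / E.c m.castSucc k * rho E m.castSucc k x := by
    simp only [rho]; ring
  rw [e] at h2
  refine h2.congr_fun fun y => ?_
  have e2 : ∑' j, E.c m.succ j / E.c m.castSucc j * (E.p m.castSucc j).eval (E.ν m.castSucc x)
      * rho E m.succ j y = transition E.ν E.p E.c m x y * √(E.w m.succ y) := by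
    rw [transition, ← tsum_mul_right]
    refine tsum_congr fun j => ?_
    simp only [rho, transitionTerm]; ring
  rw [e2, symTrans]
  ring

lemma hasSum_symTrans_left (m : Fin N) (y : ℤ) {k : ℕ} (hk : (k : ℕ∞) < numSupp E m.castSucc) :
    HasSum (fun x => rho E m.castSucc k x * symTrans E m x y)
      (E.c m.succ k / E.c m.castSucc k * rho E m.succ k y) := by
  by_cases hy : E.w m.succ y = 0
  · simp [symTrans, rho, hy]
  have h := hasSum_orthogonal_expansion {k | (k : ℕ∞) < numSupp E m.castSucc} (rho E m.castSucc)
    (fun k hk => rho_eq_zero E m.castSucc (not_lt.1 hk))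
    (fun j hj k hk => hasSum_rho_mul_rho E m.castSucc hj hk)
    (fun k => E.c m.succ k / E.c m.castSucc k * (E.p m.succ k).eval (E.ν m.succ y))
    (by
      refine (E.transition_left m y hy).congr fun k => tsum_congr fun x => ?_
      have := Real.sq_sqrt (E.w_nonneg m.castSucc x)
      simp only [transitionTerm, rho, mul_pow, this]
      ring) hk
  have h2 := h.mul_left √(E.w m.succ y)
  have e : √(E.w m.succ y) * (E.c m.succ k / E.c m.castSucc k
      * (E.p m.succ k).eval (E.ν m.succ y))
      = E.c m.succ k / E.c m.castSucc k * rho E m.succ k y := by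
    simp only [rho]; ring
  rw [e] at h2
  refine h2.congr_fun fun x => ?_
  have e2 : ∑' j, E.c m.succ j / E.c m.castSucc j * (E.p m.succ j).eval (E.ν m.succ y)
      * rho E m.castSucc j x = transition E.ν E.p E.c m x y * √(E.w m.castSucc x) := by
    rw [transition, ← tsum_mul_right]
    refine tsum_congr fun j => ?_
    simp only [rho, transitionTerm]; ring
  rw [e2, symTrans]
  ring

/-- The initial factor of the density. -/
noncomputable def initDet (x : Fin n → ℤ) : ℝ :=
  (Matrix.of fun k j : Fin n => E.c 0 k * rho E 0 k (x j)).det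

/-- The transition factors of the density. -/
noncomputable def transDet (m : Fin N) (x y : Fin n → ℤ) : ℝ :=
  (Matrix.of fun i j : Fin n => symTrans E m (x i) (y j)).det

/-- The final factor of the density. -/
noncomputable def finalDet (x : Fin n → ℤ) : ℝ :=
  (Matrix.of fun k j : Fin n => rho E (Fin.last N) k (x j) / E.c (Fin.last N) k).det

lemma density_eq_chainProd (y : Config N n) :
    density E.ν E.w E.p E.c y = chainProd (initDet E) (transDet E) (finalDet E) y := by
  set W : Fin (N + 1) → ℝ := fun m => ∏ j, √(E.w m (y m j)) with hW
  have h0 : initDet E (y 0) = W 0 *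
      (Matrix.of fun j k : Fin n => E.c 0 k * (E.p 0 k).eval (E.ν 0 (y 0 j))).det := by
    rw [hW, ← Matrix.det_mul_column, initDet, ← Matrix.det_transpose]
    congr 1
    ext j k
    simp [rho]; ring
  have hN : finalDet E (y (Fin.last N)) = W (Fin.last N) *
      (Matrix.of fun j k : Fin n =>
        (E.p (Fin.last N) k).eval (E.ν (Fin.last N) (y (Fin.last N) j))
          / E.c (Fin.last N) k).det := by
    rw [hW, ← Matrix.det_mul_column, finalDet, ← Matrix.det_transpose]
    congr 1
    ext j k
    simp [rho]; ring
  have hK : ∀ m : Fin N, transDet E m (y m.castSucc) (y m.succ) = W m.castSucc * (W m.succ *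
      (Matrix.of fun i j : Fin n =>
        transition E.ν E.p E.c m (y m.castSucc i) (y m.succ j)).det) := by
    intro m
    simp only [hW]
    rw [← Matrix.det_mul_row, ← Matrix.det_mul_column, transDet]
    congr 1
    ext i j
    simp [symTrans]; ring
  have hw : ∏ m : Fin (N + 1), ∏ j : Fin n, E.w m (y m j) = ∏ m, W m * W m := by
    refine Finset.prod_congr rfl fun m _ => ?_
    rw [← Finset.prod_mul_distrib]
    exact Finset.prod_congr rfl fun j _ => (Real.mul_self_sqrt (E.w_nonneg _ _)).symm
  have hw2 : ∏ m, W m * W m = W 0 * (∏ m : Fin N, W m.castSucc) * (∏ m : Fin N, W m.succ)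
      * W (Fin.last N) := by
    rw [Finset.prod_mul_distrib]
    nth_rewrite 1 [Fin.prod_univ_succ W]
    rw [Fin.prod_univ_castSucc W]
    ring
  rw [density, chainProd, h0, hN, hw, hw2]
  simp only [hK, Finset.prod_mul_distrib]
  ring

/-! ### Slater determinants as alternating forms -/

/-- Evaluation at `y` of the function `∑ₖ vₖ r_k √w / c_k` that belongs to a sequence `v`. -/
noncomputable def evalVec (m : Fin (N + 1)) (y : ℤ) : Vec →ₗ[ℝ] ℝ :=
  Finsupp.linearCombination ℝ fun k => rho E m k y / E.c m k

lemma evalVec_single (m : Fin (N + 1)) (y : ℤ) (k : ℕ) :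
    evalVec E m y (Finsupp.single k 1) = rho E m k y / E.c m k := by
  simp [evalVec]

lemma evalVec_apply (m : Fin (N + 1)) (y : ℤ) (v : Vec) :
    evalVec E m y v = ∑ k ∈ v.support, v k * (rho E m k y / E.c m k) := by
  simp [evalVec, Finsupp.linearCombination_apply, Finsupp.sum]

/-- The Slater determinant of `n` sequences at the points `y`, as an alternating form. -/
noncomputable def slater (m : Fin (N + 1)) (y : Fin n → ℤ) : Vec [⋀^Fin n]→ₗ[ℝ] ℝ :=
  (Matrix.detRowAlternating : (Fin n → ℝ) [⋀^Fin n]→ₗ[ℝ] ℝ).compLinearMap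
    (LinearMap.pi fun j => evalVec E m (y j))

lemma slater_apply (m : Fin (N + 1)) (y : Fin n → ℤ) (v : Fin n → Vec) :
    slater E m y v = (Matrix.of fun i j => evalVec E m (y j) (v i)).det := rfl

lemma slater_firstVecs_last (y : Fin n → ℤ) :
    slater E (Fin.last N) y (firstVecs n) = finalDet E y := by
  rw [slater_apply, finalDet]
  congr 1
  ext i j
  simp [firstVecs, evalVec_single]

/-- The sequence vanishes from the index `B` on. -/
def SuppBelow (B : ℕ) (v : Vec) : Prop := ∀ k, B ≤ k → v k = 0

lemma SuppBelow.apply_of_band {B d : ℕ} {v : Vec} (hv : SuppBelow B v) {A : Module.End ℝ Vec}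
    (hA : ∀ i j, j + d < i → ent A i j = 0) : SuppBelow (B + d) (A v) := by
  intro k hk
  rw [apply_eq_sum_ent]
  refine Finset.sum_eq_zero fun j hj => ?_
  by_cases h : j < B
  · simp only
    rw [hA k j (by omega), zero_mul]
  · exact absurd (hv j (by omega)) (Finsupp.mem_support_iff.1 hj)

lemma hasSum_symTrans_evalVec (m : Fin N) (x : ℤ) {B : ℕ} (hB : (B : ℕ∞) ≤ numSupp E m.succ)
    {v : Vec} (hv : SuppBelow B v) :
    HasSum (fun y => symTrans E m x y * evalVec E m.succ y v) (evalVec E m.castSucc x v) := by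
  have hlt : ∀ k ∈ v.support, (k : ℕ∞) < numSupp E m.succ := by
    intro k hk
    refine lt_of_lt_of_le ?_ hB
    by_contra h
    exact (Finsupp.mem_support_iff.1 hk) (hv k (by simpa using h))
  simp only [evalVec_apply, Finset.mul_sum]
  refine hasSum_sum fun k hk => ?_
  have hc := (E.c_pos m.succ k (hlt k hk)).ne'
  have := (hasSum_symTrans_right E m x (hlt k hk)).mul_left (v k / E.c m.succ k)
  have e : v k / E.c m.succ k * (E.c m.succ k / E.c m.castSucc k * rho E m.castSucc k x)
      = v k * (rho E m.castSucc k x / E.c m.castSucc k) := by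
    field_simp
  rw [e] at this
  refine this.congr_fun fun y => ?_
  ring

/-- Transporting a Slater determinant by the transition determinant. -/
lemma hasSum_transDet_slater (m : Fin N) (x : Fin n → ℤ) {B : ℕ}
    (hB : (B : ℕ∞) ≤ numSupp E m.succ) (v : Fin n → Vec) (hv : ∀ i, SuppBelow B (v i)) :
    HasSum (fun y => transDet E m x y * slater E m.succ y v)
      (n.factorial * slater E m.castSucc x v) := by
  have h := hasSum_andreief (fun i y => symTrans E m (x i) y)
    (fun i y => evalVec E m.succ y (v i))
    (fun i j => (hasSum_symTrans_evalVec E m (x i) hB (hv j)).summable)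
  have e : (Matrix.of fun i j => ∑' y, symTrans E m (x i) y * evalVec E m.succ y (v j)).det
      = slater E m.castSucc x v := by
    rw [slater_apply, ← Matrix.det_transpose]
    congr 1
    ext i j
    simp [(hasSum_symTrans_evalVec E m (x j) hB (hv i)).tsum_eq]
  rw [e] at h
  exact h

/-- Pairing with the initial determinant yields the dual vacuum. -/
lemma hasSum_initDet_slater (hn : (n : ℕ∞) ≤ numSupp E 0) (v : Fin n → Vec) :
    HasSum (fun y => initDet E y * slater E 0 y v) (n.factorial * vac n v) := by
  have hk : ∀ k : Fin n, ((k : ℕ) : ℕ∞) < numSupp E 0 := fun k =>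
    lt_of_lt_of_le (by exact_mod_cast k.2) hn
  have h1 : ∀ (k : Fin n) (v : Vec),
      HasSum (fun y => (E.c 0 k * rho E 0 k y) * evalVec E 0 y v) (v k) := by
    intro k v
    have h2 : HasSum (fun y => ∑ l ∈ v.support,
        (E.c 0 k * v l / E.c 0 l) * (rho E 0 k y * rho E 0 l y))
        (∑ l ∈ v.support, (E.c 0 k * v l / E.c 0 l) * (if (k : ℕ) = l then 1 else 0)) := by
      refine hasSum_sum fun l _ => ?_
      rcases lt_or_ge (l : ℕ∞) (numSupp E 0) with hl | hl
      · exact (hasSum_rho_mul_rho E 0 (hk k) hl).mul_left _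
      · have : (k : ℕ) ≠ l := by
          rintro h
          have := hk k
          rw [h] at this
          exact absurd this (not_lt.2 hl)
        simp [rho_eq_zero E 0 hl, this]
    have e : (∑ l ∈ v.support, (E.c 0 k * v l / E.c 0 l) * (if (k : ℕ) = l then 1 else 0))
        = v k := by
      simp only [mul_ite, mul_one, mul_zero, Finset.sum_ite_eq]
      have := (E.c_pos 0 k (hk k)).ne'
      by_cases h : v k = 0
      · simp [h]
      · rw [if_pos (Finsupp.mem_support_iff.2 h)]
        field_simp
    rw [e] at h2
    refine h2.congr_fun fun y => ?_
    rw [evalVec_apply, Finset.mul_sum]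
    refine Finset.sum_congr rfl fun l _ => ?_
    ring
  have h := hasSum_andreief (fun (k : Fin n) y => E.c 0 k * rho E 0 k y)
    (fun i y => evalVec E 0 y (v i)) (fun i j => (h1 i (v j)).summable)
  have e : (Matrix.of fun (i j : Fin n) =>
      ∑' y, (E.c 0 i * rho E 0 i y) * evalVec E 0 y (v j)).det = vac n v := by
    rw [← Matrix.det_transpose, vac]
    change _ = Matrix.det _
    congr 1
    ext i j
    simp [(h1 j (v i)).tsum_eq]
  rw [e] at h
  exact h

/-- Summation against a kernel commutes with the action of banded operators. -/
lemma hasSum_cact {X : Type*} {l : List (Module.End ℝ Vec)} {d B : ℕ}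
    (hl : ∀ A ∈ l, ∀ i j, j + d < i → ent A i j = 0) (K : X → ℝ)
    (Φ : X → Vec [⋀^Fin n]→ₗ[ℝ] ℝ) (Φ' : Vec [⋀^Fin n]→ₗ[ℝ] ℝ)
    (h : ∀ v : Fin n → Vec, (∀ i, SuppBelow (B + d * l.length) (v i)) →
      HasSum (fun x => K x * Φ x v) (Φ' v))
    (v : Fin n → Vec) (hv : ∀ i, SuppBelow B (v i)) :
    HasSum (fun x => K x * cact n l (Φ x) v) (cact n l Φ' v) := by
  induction l generalizing Φ Φ' with
  | nil => exact h v (by simpa using hv)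
  | cons A l ih =>
    simp only [cact, LinearMap.comp_apply]
    refine ih (fun A' hA' => hl A' (by simp [hA'])) (fun x => cder n A (Φ x)) (cder n A Φ') ?_
    intro v hv
    have hv' : ∀ i, SuppBelow (B + d * (A :: l).length) (v i) := by
      intro i k hk
      refine hv i k ?_
      rw [List.length_cons, mul_add] at hk
      omega
    have h1 := h v hv'
    have h2 : HasSum (fun x => ∑ j, K x * Φ x (Function.update v j (A (v j))))
        (∑ j, Φ' (Function.update v j (A (v j)))) := by
      refine hasSum_sum fun j _ => h _ fun i => ?_
      by_cases hij : i = j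
      · subst hij
        rw [Function.update_self]
        have := (hv i).apply_of_band (hl A (by simp))
        rw [List.length_cons, mul_add, mul_one, ← add_assoc]
        exact this
      · rw [Function.update_of_ne hij]
        exact hv' i
    have h3 := h2.sub (h1.mul_left (ptr n A))
    have e : ∀ Θ : Vec [⋀^Fin n]→ₗ[ℝ] ℝ, cder n A Θ v
        = ∑ j, Θ (Function.update v j (A (v j))) - ptr n A * Θ v := by
      intro Θ
      simp [cder, altDer_apply]
    rw [e]
    refine h3.congr_fun fun x => ?_
    rw [e, mul_sub, Finset.mul_sum]
    ring

end Ensemble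

/-! ### Jacobi operators -/

/-- The Jacobi operator with coefficients `a`, `b`, conjugated by the diagonal operator `c`: the
matrix of the multiplication by `ν` in the basis `r_k / c_k`. -/
noncomputable def jacobi (a b c : ℕ → ℝ) : Module.End ℝ Vec :=
  Finsupp.linearCombination ℝ fun l =>
    Finsupp.single (l + 1) (a l * (c (l + 1) / c l)) + Finsupp.single l (b l)
      + if l = 0 then 0 else Finsupp.single (l - 1) (a (l - 1) * (c (l - 1) / c l))

lemma jacobi_single (a b c : ℕ → ℝ) (l : ℕ) : jacobi a b c (Finsupp.single l 1) =
    Finsupp.single (l + 1) (a l * (c (l + 1) / c l)) + Finsupp.single l (b l)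
      + if l = 0 then 0 else Finsupp.single (l - 1) (a (l - 1) * (c (l - 1) / c l)) := by
  simp [jacobi]

lemma ent_jacobi (a b c : ℕ → ℝ) (i j : ℕ) : ent (jacobi a b c) i j =
    if i = j + 1 then a j * (c i / c j) else if i = j then b j
      else if i + 1 = j then a i * (c i / c j) else 0 := by
  rw [ent, jacobi_single]
  rcases j with _ | j
  · simp only [if_true, add_zero, Finsupp.add_apply, Finsupp.single_apply]
    split_ifs <;> first | contradiction | omega | (subst_vars; simp)
  · simp only [Nat.succ_ne_zero, if_false, Nat.add_sub_cancel, Finsupp.add_apply,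
      Finsupp.single_apply]
    split_ifs <;> first | contradiction | omega | (subst_vars; simp)

/-- The symbol of the Jacobi operator with limiting coefficients. -/
noncomputable def jacobiSymbol (α β τ : ℝ) : AddMonoidAlgebra ℝ ℤ :=
  AddMonoidAlgebra.single 1 (α * Real.exp (-τ)) + AddMonoidAlgebra.single 0 β
    + AddMonoidAlgebra.single (-1) (α * Real.exp τ)

lemma hasSymbol_jacobi (a b c : ℕ → ℕ → ℝ) (α β τ : ℝ)
    (ha : ∀ j : ℤ, Tendsto (fun n : ℕ => a n ((n : ℤ) + j).toNat) atTop (𝓝 α))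
    (hb : ∀ j : ℤ, Tendsto (fun n : ℕ => b n ((n : ℤ) + j).toNat) atTop (𝓝 β))
    (hc : ∀ k l : ℤ, Tendsto (fun n : ℕ => c n ((n : ℤ) + k).toNat / c n ((n : ℤ) + l).toNat) atTop
      (𝓝 (Real.exp (τ * (l - k))))) :
    HasSymbol (fun n => jacobi (a n) (b n) (c n)) (jacobiSymbol α β τ) := by
  refine ⟨⟨1, fun n i j h => ?_⟩, fun i j => ?_⟩
  · rw [ent_jacobi, if_neg (by omega), if_neg (by omega), if_neg (by omega)]
  · have hco : (jacobiSymbol α β τ).coeff (i - j) = if i = j + 1 then α * Real.exp (-τ)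
        else if i = j then β else if i + 1 = j then α * Real.exp τ else 0 := by
      simp only [jacobiSymbol, AddMonoidAlgebra.coeff_add, AddMonoidAlgebra.coeff_single,
        Finsupp.add_apply, Finsupp.single_apply]
      by_cases h1 : i = j + 1
      · subst h1; simp
      · by_cases h2 : i = j
        · subst h2; simp
        · by_cases h3 : i + 1 = j
          · subst h3; simp; intro h; omega
          · rw [if_neg (by omega), if_neg (by omega), if_neg (by omega), if_neg h1, if_neg h2,
              if_neg h3]
            simp
    rw [hco]
    have hlarge := eventually_ge_atTop (i.natAbs + j.natAbs + 1)
    by_cases h1 : i = j + 1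
    · rw [if_pos h1]
      have := (ha j).mul (hc i j)
      rw [show τ * ((j : ℝ) - i) = -τ by rw [h1]; push_cast; ring] at this
      refine this.congr' ?_
      filter_upwards [hlarge] with n hn
      rw [ent_jacobi, if_pos (by omega)]
    · rw [if_neg h1]
      by_cases h2 : i = j
      · rw [if_pos h2]
        refine (hb j).congr' ?_
        filter_upwards [hlarge] with n hn
        rw [ent_jacobi, if_neg (by omega), if_pos (by omega)]
      · rw [if_neg h2]
        by_cases h3 : i + 1 = j
        · rw [if_pos h3]
          have := (ha i).mul (hc i j)
          rw [show τ * ((j : ℝ) - i) = τ by rw [← h3]; push_cast; ring] at this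
          refine this.congr' ?_
          filter_upwards [hlarge] with n hn
          rw [ent_jacobi, if_neg (by omega), if_neg (by omega), if_pos (by omega)]
        · rw [if_neg h3]
          refine tendsto_const_nhds.congr' ?_
          filter_upwards [hlarge] with n hn
          rw [ent_jacobi, if_neg (by omega), if_neg (by omega), if_neg (by omega)]

section Ensemble

variable {N n : ℕ} (E : ExtendedEnsemble N n) {m : Fin (N + 1)} {a b : ℕ → ℝ}

/-- The Jacobi operator represents the multiplication by `ν`. -/
lemma evalVec_jacobi (h : IsRecurrence (E.ν m) (E.w m) (E.p m) a b) (y : ℤ) (v : Vec) :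
    evalVec E m y (jacobi a b (E.c m) v) = E.ν m y * evalVec E m y v := by
  induction v using Finsupp.induction_linear with
  | zero => simp
  | add v w hv hw => rw [map_add, map_add, map_add, hv, hw, mul_add]
  | single l x =>
    rw [← mul_one x, ← smul_eq_mul, ← Finsupp.smul_single, map_smul, map_smul, map_smul,
      smul_eq_mul, smul_eq_mul, mul_left_comm]
    congr 1
    rw [jacobi_single, evalVec_single, map_add, map_add]
    have hs : ∀ (k : ℕ) (z : ℝ), evalVec E m y (Finsupp.single k z)
        = z * (rho E m k y / E.c m k) := by
      intro k z
      rw [← evalVec_single, ← smul_eq_mul, ← map_smul, Finsupp.smul_single, smul_eq_mul, mul_one]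
    rcases lt_or_ge (l : ℕ∞) (numSupp E m) with hl | hl
    · have hcl := (E.c_pos m l hl).ne'
      have h1 : a l * (E.c m (l + 1) / E.c m l) * (rho E m (l + 1) y / E.c m (l + 1))
          = a l * rho E m (l + 1) y / E.c m l := by
        rcases lt_or_ge ((l + 1 : ℕ) : ℕ∞) (numSupp E m) with hl' | hl'
        · have := (E.c_pos m _ hl').ne'
          field_simp
        · rw [h.eq_zero l hl']; simp
      have h2 : evalVec E m y (if l = 0 then 0 else
            Finsupp.single (l - 1) (a (l - 1) * (E.c m (l - 1) / E.c m l)))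
          = (if l = 0 then 0 else a (l - 1) * rho E m (l - 1) y) / E.c m l := by
        split_ifs with h0
        · simp
        · have := (E.c_pos m (l - 1) (lt_of_le_of_lt (by exact_mod_cast Nat.sub_le l 1) hl)).ne'
          rw [hs]
          field_simp
      rw [hs, hs, h1, h2]
      have h3 : E.ν m y * rho E m l y = a l * rho E m (l + 1) y + b l * rho E m l y
          + if l = 0 then 0 else a (l - 1) * rho E m (l - 1) y := by
        by_cases hw : E.w m y = 0
        · simp [rho, hw]
        · have := h.recurrence l hl y hw
          simp only [rho]
          rw [← mul_assoc, this]
          split_ifs <;> ring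
      rw [← mul_div_assoc (E.ν m y), h3]
      ring
    · have h0 : rho E m l = 0 := rho_eq_zero E m hl
      have h1 : rho E m (l + 1) = 0 :=
        rho_eq_zero E m (hl.trans (by exact_mod_cast Nat.le_succ l))
      have h2 : evalVec E m y (if l = 0 then 0 else
            Finsupp.single (l - 1) (a (l - 1) * (E.c m (l - 1) / E.c m l))) = 0 := by
        split_ifs with h0
        · simp
        · rw [h.eq_zero (l - 1) (by rwa [Nat.sub_add_cancel (by omega)])]
          simp
      rw [hs, hs, h2, h0, h1]
      simp

lemma evalVec_aeval_jacobi (h : IsRecurrence (E.ν m) (E.w m) (E.p m) a b) (q : Polynomial ℝ)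
    (y : ℤ) (v : Vec) :
    evalVec E m y (Polynomial.aeval (jacobi a b (E.c m)) q v)
      = q.eval (E.ν m y) * evalVec E m y v := by
  induction q using Polynomial.induction_on' with
  | add p q hp hq =>
    rw [map_add, LinearMap.add_apply, map_add, hp, hq, Polynomial.eval_add, add_mul]
  | monomial k c =>
    have : ∀ v, evalVec E m y ((jacobi a b (E.c m) ^ k) v) = E.ν m y ^ k * evalVec E m y v := by
      induction k with
      | zero => simp
      | succ k ih =>
        intro v
        rw [pow_succ, Module.End.mul_apply, ih, evalVec_jacobi E h, pow_succ, mul_assoc]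
    rw [Polynomial.aeval_monomial, Algebra.algebraMap_eq_smul_one, smul_mul_assoc, one_mul,
      LinearMap.smul_apply, map_smul, this, Polynomial.eval_monomial, smul_eq_mul, mul_assoc]

/-- The one-time linear statistic of `g`. -/
noncomputable def stat (g : ℤ → ℝ) (x : Fin n → ℤ) : ℝ := ∑ j, g (x j)

lemma altDer_slater (h : IsRecurrence (E.ν m) (E.w m) (E.p m) a b) (q : Polynomial ℝ)
    (y : Fin n → ℤ) :
    altDer (Polynomial.aeval (jacobi a b (E.c m)) q) (slater E m y)
      = stat (fun z => q.eval (E.ν m z)) y • slater E m y := by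
  let f : Module.End ℝ (Fin n → ℝ) :=
    LinearMap.pi fun j => q.eval (E.ν m (y j)) • LinearMap.proj j
  rw [slater, altDer_compLinearMap _ f, altDer_det]
  · have : ∑ j, f (Pi.single j 1) j = stat (fun z => q.eval (E.ν m z)) y := by
      simp [f, stat]
    rw [this]
    rfl
  · intro v
    ext j
    simp [f, evalVec_aeval_jacobi E h]

/-- The statistic of `q ∘ ν`, centred at the vacuum expectation. -/
noncomputable def centredStat (m : Fin (N + 1)) (q : Polynomial ℝ) (A : Module.End ℝ Vec)
    (x : Fin n → ℤ) : ℝ :=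
  stat (fun z => q.eval (E.ν m z)) x - ptr n A

/-- Slater determinants are joint eigenvectors of the derivations that come from multiplication
operators, the eigenvalues being the centred statistics. -/
lemma cact_replicate_slater (h : IsRecurrence (E.ν m) (E.w m) (E.p m) a b) (q : Polynomial ℝ)
    (y : Fin n → ℤ) (k : ℕ) (l : List (Module.End ℝ Vec)) :
    cact n (List.replicate k (Polynomial.aeval (jacobi a b (E.c m)) q) ++ l) (slater E m y)
      = centredStat E m q (Polynomial.aeval (jacobi a b (E.c m)) q) y ^ k
        • cact n l (slater E m y) := by
  induction k with
  | zero => simp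
  | succ k ih =>
    have h1 : cder n (Polynomial.aeval (jacobi a b (E.c m)) q) (slater E m y)
        = centredStat E m q (Polynomial.aeval (jacobi a b (E.c m)) q) y • slater E m y := by
      ext v
      rw [cder, LinearMap.sub_apply, altDer_slater E h, LinearMap.smul_apply, LinearMap.id_apply]
      simp only [AlternatingMap.sub_apply, AlternatingMap.smul_apply, smul_eq_mul, centredStat]
      ring
    rw [List.replicate_succ, List.cons_append, cact, LinearMap.comp_apply, h1, map_smul, ih,
      smul_smul, pow_succ']

end Ensemble

/-- The moments of centred polynomial statistics, summed against the density, are time-ordered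
centred moments in the vacuum state. The operators enlarge the range of the occupied indices by at
most `d * ∑ i, k i`, and the orthonormal functions with these indices must exist. -/
theorem hasSum_density_moment {N n : ℕ} (E : ExtendedEnsemble N n) (a b : Fin N → ℕ → ℝ)
    (hab : ∀ m : Fin N, IsRecurrence (E.ν m.succ) (E.w m.succ) (E.p m.succ) (a m) (b m))
    (q : Fin N → Polynomial ℝ) (A : Fin N → Module.End ℝ Vec)
    (hA : ∀ m, A m = Polynomial.aeval (jacobi (a m) (b m) (E.c m.succ)) (q m)) (d : ℕ)
    (hd : ∀ m i j, j + d < i → ent (A m) i j = 0) (k : Fin N → ℕ)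
    (hS0 : (n : ℕ∞) ≤ numSupp E 0)
    (hS : ∀ m : Fin N, ((n + d * ∑ i, k i : ℕ) : ℕ∞) ≤ numSupp E m.succ) (Z : ℝ)
    (hc : (∀ y, 0 ≤ Z * density E.ν E.w E.p E.c y
          * ∏ m : Fin N, centredStat E m.succ (q m) (A m) (y m.succ) ^ k m) ∨
      Summable fun y => Z * density E.ν E.w E.p E.c y
          * ∏ m : Fin N, centredStat E m.succ (q m) (A m) (y m.succ) ^ k m) :
    HasSum (fun y => Z * density E.ν E.w E.p E.c y
          * ∏ m : Fin N, centredStat E m.succ (q m) (A m) (y m.succ) ^ k m)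
      (Z * (n.factorial : ℝ) ^ (N + 1)
        * cmom n ((List.finRange N).flatMap fun m => List.replicate (k m) (A m))) := by
  set F : Fin (N + 1) → (Fin n → ℤ) → ℝ := fun m x =>
    Fin.cases (motive := fun _ => ℝ) 1 (fun i => centredStat E i.succ (q i) (A i) x ^ k i) m with hF
  have hF0 : ∀ x, F 0 x = 1 := fun x => rfl
  have hFs : ∀ (i : Fin N) x, F i.succ x = centredStat E i.succ (q i) (A i) x ^ k i :=
    fun i x => rfl
  set K : Fin N → (Fin n → ℤ) → (Fin n → ℤ) → ℝ := fun m x y =>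
    F m.castSucc x * transDet E m x y with hK
  set h : (Fin n → ℤ) → ℝ := fun x => F (Fin.last N) x * finalDet E x with hh
  set u : (Fin n → ℤ) → ℝ := fun x => Z * initDet E x with hu
  set ops : ℕ → List (Module.End ℝ Vec) := fun i =>
    ((List.finRange N).drop i).flatMap fun m => List.replicate (k m) (A m) with hops
  have hops_band : ∀ i, ∀ B ∈ ops i, ∀ i j, j + d < i → ent B i j = 0 := by
    intro i B hB
    simp only [hops, List.mem_flatMap] at hB
    obtain ⟨m, -, hm⟩ := hB
    obtain rfl := List.eq_of_mem_replicate hm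
    exact hd m
  have hops_len : ∀ i, (ops i).length ≤ ∑ i, k i := by
    intro i
    simp only [hops, List.length_flatMap, List.length_replicate]
    have h1 : (((List.finRange N).drop i).map k).sum ≤ ((List.finRange N).map k).sum := by
      exact ((List.drop_sublist i _).map k).sum_le_sum (by simp)
    refine h1.trans ?_
    rw [← List.ofFn_eq_map, List.sum_ofFn]
  have hprod : (fun y : Config N n => Z * density E.ν E.w E.p E.c y
      * ∏ m : Fin N, centredStat E m.succ (q m) (A m) (y m.succ) ^ k m) = chainProd u K h := by
    funext y
    rw [density_eq_chainProd]
    simp only [chainProd, hu, hK, hh, Finset.prod_mul_distrib]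
    have e : (∏ m : Fin N, F m.castSucc (y m.castSucc)) * F (Fin.last N) (y (Fin.last N))
        = ∏ m : Fin N, centredStat E m.succ (q m) (A m) (y m.succ) ^ k m := by
      rw [← Fin.prod_univ_castSucc (fun m => F m (y m)), Fin.prod_univ_succ, hF0, one_mul]
      rfl
    rw [← e]
    ring
  have hprod' := fun y => congrFun hprod y
  rw [hprod] at hc ⊢
  -- the sum over the configurations after time `m`
  set B : Fin (N + 1) → (Fin n → ℤ) → ℝ := fun m x =>
    (n.factorial : ℝ) ^ (N - (m : ℕ)) * F m x * cact n (ops m) (slater E m x) (firstVecs n) with hB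
  have hsupp : ∀ i, SuppBelow n (firstVecs n i) := by
    intro i k hk
    rw [firstVecs, Finsupp.single_apply, if_neg (by have := i.2; omega)]
  refine hasSum_chainProd K h B ?_ ?_ u ?_ (hc.imp (fun h y => hprod' y ▸ h y) id)
  · funext x
    have e : ops (Fin.last N) = [] := by
      simp only [hops, Fin.val_last]
      rw [List.drop_eq_nil_of_le (by simp), List.flatMap_nil]
    simp only [hB, e, cact, LinearMap.id_apply, slater_firstVecs_last, hh]
    simp
  · intro m x
    have h1 : ∀ v : Fin n → Vec, (∀ i, SuppBelow (n + d * (ops m.castSucc).length) (v i)) →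
        HasSum (fun y => transDet E m x y * slater E m.succ y v)
          ((n.factorial • slater E m.castSucc x) v) := by
      intro v hv
      have := hasSum_transDet_slater E m x (hS m) v fun i k hk => hv i k (by
        refine le_trans ?_ hk
        gcongr
        exact hops_len _)
      simpa using this
    have h2 := hasSum_cact (hops_band _) _ _ _ h1 (firstVecs n) hsupp
    have h3 := h2.mul_left ((n.factorial : ℝ) ^ (N - ((m : ℕ) + 1)) * F m.castSucc x)
    have e1 : ops m.castSucc = List.replicate (k m) (A m) ++ ops m.succ := by
      simp only [hops, Fin.val_castSucc, Fin.val_succ]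
      rw [List.drop_eq_getElem_cons (by simp)]
      simp
    have e2 : B m.castSucc x = (n.factorial : ℝ) ^ (N - ((m : ℕ) + 1)) * F m.castSucc x
        * cact n (ops m.castSucc) (n.factorial • slater E m.castSucc x) (firstVecs n) := by
      have : N - (m : ℕ) = N - ((m : ℕ) + 1) + 1 := by have := m.2; omega
      simp only [hB, Fin.val_castSucc, map_nsmul, this, pow_succ, AlternatingMap.smul_apply,
        nsmul_eq_mul]
      ring
    rw [e2]
    refine h3.congr_fun fun y => ?_
    simp only [hK, hB, e1, Fin.val_succ]
    have e3 := cact_replicate_slater E (hab m) (q m) y (k m) (ops (m.succ : Fin (N + 1)))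
    rw [← hA] at e3
    simp only [Fin.val_succ] at e3
    rw [e3, hFs, AlternatingMap.smul_apply, smul_eq_mul]
    ring
  · have h1 : ∀ v : Fin n → Vec, (∀ i, SuppBelow (n + d * (ops 0).length) (v i)) →
        HasSum (fun y => initDet E y * slater E 0 y v) ((n.factorial • vac n) v) := by
      intro v _
      simpa using hasSum_initDet_slater E hS0 v
    have h2 := hasSum_cact (hops_band _) _ _ _ h1 (firstVecs n) hsupp
    have h3 := h2.mul_left (Z * (n.factorial : ℝ) ^ N)
    have e : Z * (n.factorial : ℝ) ^ N * cact n (ops 0) (n.factorial • vac n) (firstVecs n)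
        = Z * (n.factorial : ℝ) ^ (N + 1)
        * cmom n ((List.finRange N).flatMap fun m => List.replicate (k m) (A m)) := by
      simp only [map_nsmul, AlternatingMap.smul_apply, nsmul_eq_mul, cmom, hops, List.drop_zero]
      ring
    rw [e] at h3
    refine h3.congr_fun fun x => ?_
    simp only [hu, hB, hF0, Fin.val_zero, Nat.sub_zero]
    ring

/-! ### Expectations of polynomial statistics -/

section Countable

variable {Ω : Type*} [MeasurableSpace Ω] [Countable Ω] [MeasurableSingletonClass Ω]
  {P : Measure Ω}

lemma integrable_iff_summable_real [IsFiniteMeasure P] (f : Ω → ℝ) :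
    Integrable f P ↔ Summable fun x => P.real {x} * f x := by
  conv_lhs => rw [← Measure.sum_smul_dirac P]
  rw [integrable_sum_dirac_iff fun x => measure_ne_top _ _,
    ← summable_norm_iff (f := fun x => P.real {x} * f x)]
  refine summable_congr fun x => ?_
  rw [norm_mul, Real.norm_of_nonneg measureReal_nonneg]
  rfl

lemma hasSum_real_integral [IsFiniteMeasure P] {f : Ω → ℝ} (hf : Integrable f P) :
    HasSum (fun x => P.real {x} * f x) (∫ x, f x ∂P) := by
  rw [integral_countable hf]
  exact ((integrable_iff_summable_real f).1 hf).hasSum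

lemma hasSum_real_singleton [IsProbabilityMeasure P] : HasSum (fun x => P.real {x}) 1 := by
  have := hasSum_real_integral (P := P) (f := fun _ => 1) (integrable_const _)
  simpa using this

end Countable

section Ensemble

variable {N n : ℕ} (E : ExtendedEnsemble N n)

lemma exists_law_ne_zero : ∃ y, E.law.real {y} ≠ 0 := by
  by_contra! h
  have h1 := hasSum_real_singleton (P := E.law)
  simp only [h] at h1
  exact zero_ne_one (hasSum_zero.unique h1)

/-- If the support of the initial weight had fewer than `n` points, a row of the first determinant
would vanish, and so would the probability mass function. -/
lemma le_numSupp_zero : (n : ℕ∞) ≤ numSupp E 0 := by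
  obtain ⟨Z, hZ⟩ := E.law_eq
  obtain ⟨y, hy⟩ := exists_law_ne_zero E
  have h1 : initDet E (y 0) ≠ 0 := by
    intro h0
    apply hy
    rw [hZ, density_eq_chainProd, chainProd, h0]
    simp
  by_contra! h
  obtain ⟨s, hs⟩ := ENat.ne_top_iff_exists.1 h.ne_top
  rw [← hs] at h
  have hsn : s < n := by exact_mod_cast h
  apply h1
  refine Matrix.det_eq_zero_of_row_eq_zero ⟨s, hsn⟩ fun j => ?_
  simp [rho_eq_zero E 0 hs.symm.le]

variable (a b : Fin N → ℕ → ℝ)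
    (hab : ∀ m : Fin N, IsRecurrence (E.ν m.succ) (E.w m.succ) (E.p m.succ) (a m) (b m))
include hab

/-- The normalization constant of the density. -/
lemma normalization (hS : ∀ m : Fin N, (n : ℕ∞) ≤ numSupp E m.succ) {Z : ℝ}
    (hZ : ∀ y : Config N n, E.law.real {y} = Z * density E.ν E.w E.p E.c y) :
    Z * (n.factorial : ℝ) ^ (N + 1) = 1 := by
  have h := hasSum_density_moment E a b hab (fun _ => 0) (fun _ => 0) (fun m => by simp) 0
    (fun m i j _ => by simp [ent]) (fun _ => 0) (le_numSupp_zero E) (fun m => by simpa using hS m) Z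
    (Or.inl fun y => by simp [← hZ y])
  simp only [pow_zero, Finset.prod_const_one, mul_one, ← hZ, List.replicate_zero] at h
  have h2 := h.unique hasSum_real_singleton
  rw [List.flatMap_eq_nil_iff.2 (by simp), cmom_nil, mul_one] at h2
  exact h2

/-- Expectations of products of centred polynomial statistics. Integrability comes first from the
even powers, for which the summands are non-negative. -/
theorem integral_prod_centredStat (q : Fin N → Polynomial ℝ) (A : Fin N → Module.End ℝ Vec)
    (hA : ∀ m, A m = Polynomial.aeval (jacobi (a m) (b m) (E.c m.succ)) (q m)) (d : ℕ)
    (hd : ∀ m i j, j + d < i → ent (A m) i j = 0) (k : Fin N → ℕ)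
    (hS : ∀ m : Fin N, ((n + d * ∑ i, 2 * k i : ℕ) : ℕ∞) ≤ numSupp E m.succ) :
    Integrable (fun y : Config N n => ∏ m : Fin N,
        centredStat E m.succ (q m) (A m) (y m.succ) ^ k m) E.law ∧
    ∫ y : Config N n, ∏ m : Fin N, centredStat E m.succ (q m) (A m) (y m.succ) ^ k m ∂E.law
      = cmom n ((List.finRange N).flatMap fun m => List.replicate (k m) (A m)) := by
  obtain ⟨Z, hZ⟩ := E.law_eq
  have hS1 : ∀ m : Fin N, (n : ℕ∞) ≤ numSupp E m.succ := fun m =>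
    le_trans (by exact_mod_cast Nat.le_add_right _ _) (hS m)
  have hnorm := normalization E a b hab hS1 hZ
  have h2 := (hasSum_density_moment E a b hab q A hA d hd (fun i => 2 * k i) (le_numSupp_zero E)
    hS Z (Or.inl fun y => by
      rw [← hZ y]
      refine mul_nonneg measureReal_nonneg (Finset.prod_nonneg fun m _ => ?_)
      rw [pow_mul']
      positivity)).summable
  have hint : Integrable (fun y : Config N n => ∏ m : Fin N,
      centredStat E m.succ (q m) (A m) (y m.succ) ^ k m) E.law := by
    rw [integrable_iff_summable_real]
    have h3 := (hasSum_real_singleton (P := E.law)).summable.add h2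
    refine Summable.of_norm_bounded h3 fun y => ?_
    rw [norm_mul, Real.norm_of_nonneg measureReal_nonneg, ← hZ y]
    have h4 : ∏ m : Fin N, centredStat E m.succ (q m) (A m) (y m.succ) ^ (2 * k m)
        = (∏ m : Fin N, centredStat E m.succ (q m) (A m) (y m.succ) ^ k m) ^ 2 := by
      rw [← Finset.prod_pow]
      exact Finset.prod_congr rfl fun m _ => by rw [← pow_mul, mul_comm]
    rw [h4]
    set t := ∏ m : Fin N, centredStat E m.succ (q m) (A m) (y m.succ) ^ k m
    have h5 : |t| ≤ 1 + t ^ 2 := by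
      rw [← sq_abs t]
      nlinarith [sq_nonneg (|t| - 1), abs_nonneg t]
    calc E.law.real {y} * ‖t‖ ≤ E.law.real {y} * (1 + t ^ 2) :=
          mul_le_mul_of_nonneg_left h5 measureReal_nonneg
      _ = _ := by ring
  refine ⟨hint, ?_⟩
  have h3 := hasSum_real_integral hint
  have h6 := hasSum_density_moment E a b hab q A hA d hd k (le_numSupp_zero E)
    (fun m => le_trans (by gcongr; omega) (hS m)) Z
    (Or.inr (h3.summable.congr fun y => by rw [← hZ y]))
  rw [hnorm, one_mul] at h6
  refine h3.unique (h6.congr_fun fun y => ?_)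
  rw [← hZ y]

end Ensemble

lemma sorted_eq_flatMap_replicate {N : ℕ} {l : List (Fin N)} (hl : l.Pairwise (· ≤ ·)) :
    l = (List.finRange N).flatMap fun m => List.replicate (l.count m) m := by
  have hperm : l.Perm ((List.finRange N).flatMap fun m => List.replicate (l.count m) m) := by
    rw [List.perm_iff_count]
    intro i
    rw [List.count_flatMap]
    have : (List.count i ∘ fun m => List.replicate (l.count m) m)
        = fun m => if m = i then l.count m else 0 := by
      funext m
      simp [List.count_replicate]
    rw [this, ← List.ofFn_eq_map, List.sum_ofFn]
    simp
  refine hperm.eq_of_pairwise (fun a b _ _ h1 h2 => le_antisymm h1 h2) hl ?_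
  rw [List.pairwise_flatMap]
  refine ⟨fun m _ => List.pairwise_replicate.2 (Or.inr le_rfl), ?_⟩
  refine (List.pairwise_lt_finRange N).imp ?_
  intro i j hij x hx y hy
  rw [List.eq_of_mem_replicate hx, List.eq_of_mem_replicate hy]
  exact hij.le

section Functional

variable {ι Ω : Type*} [Fintype ι] [MeasurableSpace Ω]

/-- The expectation of polynomials in random variables, extended linearly from monomials, so that it
is linear whether or not the monomials are integrable. -/
noncomputable def polyExp (P : Measure Ω) (ξ : ι → Ω → ℝ) : MvPolynomial ι ℝ →ₗ[ℝ] ℝ :=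
  (MvPolynomial.basisMonomials ι ℝ).constr ℝ fun s => ∫ ω, ∏ i, ξ i ω ^ s i ∂P

lemma polyExp_monomial (P : Measure Ω) (ξ : ι → Ω → ℝ) (s : ι →₀ ℕ) :
    polyExp P ξ (MvPolynomial.monomial s 1) = ∫ ω, ∏ i, ξ i ω ^ s i ∂P := by
  have := (MvPolynomial.basisMonomials ι ℝ).constr_basis ℝ
    (fun s => ∫ ω, ∏ i, ξ i ω ^ s i ∂P) s
  simpa [polyExp] using this

lemma polyExp_eq_integral (P : Measure Ω) (ξ : ι → Ω → ℝ) (p : MvPolynomial ι ℝ)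
    (h : ∀ s ∈ p.support, Integrable (fun ω => ∏ i, ξ i ω ^ s i) P) :
    Integrable (fun ω => MvPolynomial.eval (fun i => ξ i ω) p) P ∧
    polyExp P ξ p = ∫ ω, MvPolynomial.eval (fun i => ξ i ω) p ∂P := by
  have e : (fun ω => MvPolynomial.eval (fun i => ξ i ω) p)
      = fun ω => ∑ s ∈ p.support, p.coeff s * ∏ i, ξ i ω ^ s i := by
    funext ω
    rw [MvPolynomial.eval_eq']
  rw [e, integral_finsetSum _ fun s hs => (h s hs).const_mul _]
  refine ⟨integrable_finsetSum _ fun s hs => (h s hs).const_mul _, ?_⟩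
  conv_lhs => rw [p.as_sum, map_sum]
  refine Finset.sum_congr rfl fun s _ => ?_
  rw [integral_const_mul, ← polyExp_monomial P ξ s, ← smul_eq_mul, ← map_smul,
    MvPolynomial.smul_monomial, smul_eq_mul, mul_one]

end Functional

section Asymptotics

variable {N : ℕ} (E : ∀ n : ℕ, ExtendedEnsemble N n) (a b : ℕ → Fin N → ℕ → ℝ)
    (hab : ∀ n m, IsRecurrence ((E n).ν m.succ) ((E n).w m.succ) ((E n).p m.succ)
      (a n m) (b n m))
    (α β τ : Fin N → ℝ) (hα : ∀ m, 0 < α m)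
    (ha : ∀ m (j : ℤ), Tendsto (fun n : ℕ => a n m ((n : ℤ) + j).toNat) atTop (𝓝 (α m)))
    (hb : ∀ m (j : ℤ), Tendsto (fun n : ℕ => b n m ((n : ℤ) + j).toNat) atTop (𝓝 (β m)))
    (hc : ∀ (m : Fin N) (k l : ℤ), Tendsto (fun n : ℕ =>
      (E n).c m.succ ((n : ℤ) + k).toNat / (E n).c m.succ ((n : ℤ) + l).toNat) atTop
      (𝓝 (Real.exp (τ m * (l - k)))))

include hab hα ha in
/-- As `a_{n+D}` converges to a positive number, it is eventually different from zero, which forces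
the support of the weight to have more than `n + D` points. -/
lemma eventually_le_numSupp (D : ℕ) :
    ∀ᶠ n : ℕ in atTop, ∀ m : Fin N, ((n + D : ℕ) : ℕ∞) ≤ numSupp (E n) m.succ := by
  rw [eventually_all]
  intro m
  filter_upwards [(ha m D).eventually_const_lt (hα m)] with n hn
  by_contra! h
  have h2 := (hab n m).eq_zero (n + D) (h.le.trans (by exact_mod_cast Nat.le_succ _))
  rw [show ((n : ℤ) + (D : ℤ)).toNat = n + D by omega, h2] at hn
  exact lt_irrefl _ hn

/-- The operator of multiplication by `q m ∘ ν` at time `t_{m+1}`. -/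
noncomputable def multOp (q : Fin N → Polynomial ℝ) (m : Fin N) (n : ℕ) : Module.End ℝ Vec :=
  Polynomial.aeval (jacobi (a n m) (b n m) ((E n).c m.succ)) (q m)

include ha hb hc in
lemma hasSymbol_multOp (q : Fin N → Polynomial ℝ) (m : Fin N) :
    HasSymbol (multOp E a b q m) (Polynomial.aeval (jacobiSymbol (α m) (β m) (τ m)) (q m)) :=
  (hasSymbol_jacobi (fun n => a n m) (fun n => b n m) (fun n => (E n).c m.succ) (α m) (β m) (τ m)
    (ha m) (hb m) (hc m)).aeval (q m)

/-- The centred statistics of polynomials as random variables. -/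
noncomputable def centredVar (q : Fin N → Polynomial ℝ) (n : ℕ) (m : Fin N) (y : Config N n) : ℝ :=
  centredStat (E n) m.succ (q m) (multOp E a b q m n) (y m.succ)

include hab hα ha hb hc in
lemma eventually_integral_prod (q : Fin N → Polynomial ℝ) (k : Fin N → ℕ) :
    ∀ᶠ n : ℕ in atTop,
      Integrable (fun y => ∏ m, centredVar E a b q n m y ^ k m) (E n).law ∧
      ∫ y, ∏ m, centredVar E a b q n m y ^ k m ∂(E n).law
        = cmom n ((List.finRange N).flatMap fun m => List.replicate (k m) (multOp E a b q m n)) := by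
  have h := fun m => (hasSymbol_multOp E a b α β τ ha hb hc q m).1
  choose d hd using h
  filter_upwards [eventually_le_numSupp E a b hab α hα ha ((∑ m, d m) * ∑ i, 2 * k i)] with n hn
  refine integral_prod_centredStat (E n) (a n) (b n) (hab n) q (fun m => multOp E a b q m n)
    (fun m => rfl) (∑ m, d m) ?_ k hn
  intro m i j hij
  refine hd m n i j (Or.inl (lt_of_le_of_lt ?_ hij))
  have := Finset.single_le_sum (fun i _ => Nat.zero_le (d i)) (Finset.mem_univ m)
  omega

include hab hα ha hb hc in
/-- Independence of the order of commuting variables lets every monomial be written in the order of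
time, and there the vacuum moments give the expectation. -/
lemma timeOrdered_polyExp (q : Fin N → Polynomial ℝ) :
    TimeOrdered (multOp E a b q) fun n => polyExp (E n).law (centredVar E a b q n) := by
  intro l hl
  filter_upwards [eventually_integral_prod E a b hab α β τ hα ha hb hc q fun m => l.count m]
    with n hn
  have e : lmon l = MvPolynomial.monomial (Finsupp.equivFunOnFinite.symm fun m => l.count m)
      (1 : ℝ) := by
    rw [MvPolynomial.monomial_eq, Finsupp.prod_fintype _ _ (by simp), lmon,
      Finset.prod_list_map_count, ← Finset.prod_subset (Finset.subset_univ l.toFinset)]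
    · simp
    · intro m _ hm
      rw [List.mem_toFinset] at hm
      simp [List.count_eq_zero_of_not_mem hm]
  rw [e, polyExp_monomial]
  refine hn.2.trans ?_
  conv_rhs => rw [sorted_eq_flatMap_replicate hl]
  simp only [seqMom, List.map_flatMap, List.map_replicate]

include hab hα ha hb hc in
lemma eventually_integrable_pow (q : Fin N → Polynomial ℝ) (K : ℕ) :
    ∀ᶠ n : ℕ in atTop,
      Integrable (fun y => (∑ m, centredVar E a b q n m y) ^ K) (E n).law ∧
      polyExp (E n).law (centredVar E a b q n) ((∑ m, MvPolynomial.X m) ^ K)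
        = ∫ y, (∑ m, centredVar E a b q n m y) ^ K ∂(E n).law := by
  have h : ∀ᶠ n : ℕ in atTop, ∀ s ∈ ((∑ m, MvPolynomial.X m : MvPolynomial (Fin N) ℝ) ^ K).support,
      Integrable (fun y => ∏ m, centredVar E a b q n m y ^ s m) (E n).law := by
    rw [Filter.eventually_all_finset]
    intro s _
    exact (eventually_integral_prod E a b hab α β τ hα ha hb hc q s).mono fun n hn => hn.1
  filter_upwards [h] with n hn
  have := polyExp_eq_integral (E n).law (centredVar E a b q n) _ hn
  simpa using this

include hab hα ha hb hc in
/-- The moments of the total centred polynomial statistic obey asymptotically the recursion of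
Gaussian moments. -/
theorem tendsto_integral_pow_recursion (q : Fin N → Polynomial ℝ) (K : ℕ) :
    Tendsto (fun n => ∫ y, (∑ m, centredVar E a b q n m y) ^ (K + 1) ∂(E n).law
      - K * (∑ r, ∑ i, symCov (fun m => Polynomial.aeval (jacobiSymbol (α m) (β m) (τ m)) (q m)) r i)
        * ∫ y, (∑ m, centredVar E a b q n m y) ^ (K - 1) ∂(E n).law) atTop (𝓝 0) := by
  have h := tendsto_moment_recursion (hasSymbol_multOp E a b α β τ ha hb hc q)
    (timeOrdered_polyExp E a b hab α β τ hα ha hb hc q) K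
  refine h.congr' ?_
  filter_upwards [eventually_integrable_pow E a b hab α β τ hα ha hb hc q (K + 1),
    eventually_integrable_pow E a b hab α β τ hα ha hb hc q (K - 1)] with n h1 h2
  rw [h1.2, h2.2]

end Asymptotics

/-! ### Variance of linear statistics of a projection ensemble -/

section Projection

variable {n : ℕ} {e : Fin n → ℤ → ℝ} {g : ℤ → ℝ}

/-- The matrix of the multiplication by `g`. -/
noncomputable def gMat (e : Fin n → ℤ → ℝ) (g : ℤ → ℝ) (i j : Fin n) : ℝ :=
  ∑' y, g y * (e i y * e j y)

/-- The component of `g eₖ` that is orthogonal to the span of the `eₗ`. -/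
noncomputable def orthPart (e : Fin n → ℤ → ℝ) (g : ℤ → ℝ) (k : Fin n) (y : ℤ) : ℝ :=
  g y * e k y - ∑ l, gMat e g l k * e l y

/-- The variance `∑ₖ ‖(1 - P) g eₖ‖²` of the linear statistic of `g`, where `P` is the orthogonal
projection onto the span of the `eₖ`. -/
noncomputable def projVar (e : Fin n → ℤ → ℝ) (g : ℤ → ℝ) : ℝ :=
  ∑ k, (∑' y, (g y * e k y) ^ 2 - ∑ l, gMat e g l k ^ 2)

variable (he : ∀ i j, HasSum (fun y => e i y * e j y) (if i = j then 1 else 0))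
  (hg : ∀ i, Summable fun y => (g y * e i y) ^ 2)

include hg in
lemma summable_mul_sq (i j : Fin n) : Summable fun y => g y ^ 2 * (e i y * e j y) := by
  refine Summable.of_norm_bounded ((hg i).add (hg j)) fun y => ?_
  rw [Real.norm_eq_abs, abs_le]
  constructor <;> nlinarith [sq_nonneg (g y * e i y + g y * e j y),
    sq_nonneg (g y * e i y - g y * e j y), sq_nonneg (g y * e i y), sq_nonneg (g y * e j y)]

include he hg in
lemma hasSum_gMat (i j : Fin n) : HasSum (fun y => g y * (e i y * e j y)) (gMat e g i j) := by
  refine Summable.hasSum ?_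
  refine Summable.of_norm_bounded ((hg i).add (he j j).summable) fun y => ?_
  rw [Real.norm_eq_abs, abs_le]
  constructor <;> nlinarith [sq_nonneg (g y * e i y + e j y),
    sq_nonneg (g y * e i y - e j y), sq_nonneg (g y * e i y), sq_nonneg (e j y)]

include he hg in
lemma hasSum_mul_orthPart (l k : Fin n) : HasSum (fun y => e l y * orthPart e g k y) 0 := by
  have h1 := (hasSum_gMat he hg l k).sub
    (hasSum_sum (s := Finset.univ) fun (i : Fin n) _ => (he l i).mul_left (gMat e g i k))
  have h2 : gMat e g l k - ∑ i, gMat e g i k * (if l = i then 1 else 0) = 0 := by simp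
  rw [h2] at h1
  refine h1.congr_fun fun y => ?_
  rw [orthPart, mul_sub, Finset.mul_sum]
  congr 1
  · ring
  · exact Finset.sum_congr rfl fun i _ => by ring

include he hg in
lemma hasSum_orthPart_sq (k : Fin n) : HasSum (fun y => orthPart e g k y * orthPart e g k y)
    (∑' y, (g y * e k y) ^ 2 - ∑ l, gMat e g l k ^ 2) := by
  have h1 := ((hg k).hasSum.sub
    (hasSum_sum (s := Finset.univ) fun (i : Fin n) _ =>
      (hasSum_gMat he hg i k).mul_left (gMat e g i k))).sub
    (hasSum_sum (s := Finset.univ) fun (i : Fin n) _ =>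
      (hasSum_mul_orthPart he hg i k).mul_left (gMat e g i k))
  have h2 : ∑' y, (g y * e k y) ^ 2 - ∑ i, gMat e g i k * gMat e g i k
      - ∑ i, gMat e g i k * 0 = ∑' y, (g y * e k y) ^ 2 - ∑ l, gMat e g l k ^ 2 := by
    simp [sq]
  rw [h2] at h1
  refine h1.congr_fun fun y => ?_
  have h3 : ∑ i, gMat e g i k * (g y * (e i y * e k y))
      = g y * e k y * ∑ i, gMat e g i k * e i y := by
    rw [Finset.mul_sum]
    exact Finset.sum_congr rfl fun i _ => by ring
  have h4 : ∑ i, gMat e g i k * (e i y * orthPart e g k y)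
      = (∑ i, gMat e g i k * e i y) * orthPart e g k y := by
    rw [Finset.sum_mul]
    exact Finset.sum_congr rfl fun i _ => by ring
  rw [h3, h4, orthPart]
  ring

/-- Multiplication by the centred statistic replaces, in turn, each `eₖ` by the component of `g eₖ`
orthogonal to the span: the component in the span contributes the trace only. -/
lemma stat_sub_mul_det (x : Fin n → ℤ) :
    (stat g x - ∑ k, gMat e g k k) * (Matrix.of fun k j => e k (x j)).det
      = ∑ k, (Matrix.of fun i j => Function.update e k (orthPart e g k) i (x j)).det := by
  set v : Fin n → (Fin n → ℝ) := fun k j => e k (x j) with hv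
  let f : Module.End ℝ (Fin n → ℝ) := LinearMap.pi fun j => g (x j) • LinearMap.proj j
  have h1 := congrArg (fun Θ : (Fin n → ℝ) [⋀^Fin n]→ₗ[ℝ] ℝ => Θ v) (altDer_det f)
  simp only [altDer_apply, AlternatingMap.smul_apply] at h1
  have h2 : ∑ j, f (Pi.single j 1) j = stat g x := by simp [f, stat]
  have hdet : (Matrix.of fun k j => e k (x j)).det
      = (Matrix.detRowAlternating : (Fin n → ℝ) [⋀^Fin n]→ₗ[ℝ] ℝ) v := rfl
  rw [h2, smul_eq_mul] at h1
  rw [hdet, sub_mul, ← h1, Finset.sum_mul, ← Finset.sum_sub_distrib]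
  refine Finset.sum_congr rfl fun k _ => ?_
  have h3 : f (v k) = (fun j => orthPart e g k (x j)) + ∑ l, gMat e g l k • v l := by
    ext j
    simp [f, orthPart, hv]
  have h4 : ∑ l, (Matrix.detRowAlternating : (Fin n → ℝ) [⋀^Fin n]→ₗ[ℝ] ℝ)
      (Function.update v k (gMat e g l k • v l))
      = gMat e g k k * (Matrix.detRowAlternating : (Fin n → ℝ) [⋀^Fin n]→ₗ[ℝ] ℝ) v := by
    rw [Finset.sum_eq_single k]
    · rw [AlternatingMap.map_update_smul, Function.update_eq_self, smul_eq_mul]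
    · intro l _ hlk
      rw [AlternatingMap.map_update_smul, AlternatingMap.map_eq_zero_of_eq _ _ _ hlk, smul_zero]
      rw [Function.update_self, Function.update_of_ne hlk]
    · simp
  rw [h3, AlternatingMap.map_update_add, AlternatingMap.map_update_sum, h4, add_sub_cancel_right]
  change Matrix.det _ = _
  congr 1
  ext i j
  by_cases hik : i = k
  · subst hik; simp
  · simp [hik, hv]

include he hg in
lemma hasSum_update_mul_update (k l i j : Fin n) :
    HasSum (fun y => Function.update e k (orthPart e g k) i y
        * Function.update e l (orthPart e g l) j y)
      (∑' y, Function.update e k (orthPart e g k) i y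
        * Function.update e l (orthPart e g l) j y) := by
  refine Summable.hasSum ?_
  by_cases hik : i = k
  · subst hik
    by_cases hjl : j = l
    · subst hjl
      simp only [Function.update_self]
      refine Summable.of_norm_bounded ((hasSum_orthPart_sq he hg i).summable.add
        (hasSum_orthPart_sq he hg j).summable) fun y => ?_
      rw [Real.norm_eq_abs, abs_le]
      constructor <;> nlinarith [sq_nonneg (orthPart e g i y + orthPart e g j y),
        sq_nonneg (orthPart e g i y - orthPart e g j y), sq_nonneg (orthPart e g i y),
        sq_nonneg (orthPart e g j y)]
    · simp only [Function.update_self, Function.update_of_ne hjl]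
      simpa only [mul_comm] using (hasSum_mul_orthPart he hg j i).summable
  · simp only [Function.update_of_ne hik]
    by_cases hjl : j = l
    · subst hjl
      simp only [Function.update_self]
      exact (hasSum_mul_orthPart he hg i j).summable
    · simp only [Function.update_of_ne hjl]
      exact (he i j).summable

include he hg in
/-- The second moment of the centred statistic of `g` against the squared Slater determinant. -/
lemma hasSum_stat_sq : HasSum (fun x : Fin n → ℤ =>
    ((stat g x - ∑ k, gMat e g k k) * (Matrix.of fun k j => e k (x j)).det) ^ 2)
    (n.factorial * projVar e g) := by
  have h1 : HasSum (fun x : Fin n → ℤ => ∑ k, ∑ l,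
      (Matrix.of fun i j => Function.update e k (orthPart e g k) i (x j)).det
        * (Matrix.of fun i j => Function.update e l (orthPart e g l) i (x j)).det)
      (∑ k, ∑ l, n.factorial * (Matrix.of fun i j =>
        ∑' y, Function.update e k (orthPart e g k) i y
          * Function.update e l (orthPart e g l) j y).det) :=
    hasSum_sum fun k _ => hasSum_sum fun l _ => hasSum_andreief _ _
      fun i j => (hasSum_update_mul_update he hg k l i j).summable
  have h2 : ∀ k l, k ≠ l → (Matrix.of fun i j =>
        ∑' y, Function.update e k (orthPart e g k) i y
          * Function.update e l (orthPart e g l) j y).det = 0 := by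
    intro k l hkl
    refine Matrix.det_eq_zero_of_row_eq_zero l fun j => ?_
    simp only [Matrix.of_apply, Function.update_of_ne hkl.symm]
    by_cases hj : j = l
    · subst hj
      simp only [Function.update_self]
      exact (hasSum_mul_orthPart he hg j j).tsum_eq
    · simp only [Function.update_of_ne hj]
      rw [(he l j).tsum_eq, if_neg (Ne.symm hj)]
  have h3 : ∀ k, (Matrix.of fun i j =>
        ∑' y, Function.update e k (orthPart e g k) i y
          * Function.update e k (orthPart e g k) j y).det
        = ∑' y, (g y * e k y) ^ 2 - ∑ l, gMat e g l k ^ 2 := by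
    intro k
    have : (Matrix.of fun i j =>
        ∑' y, Function.update e k (orthPart e g k) i y
          * Function.update e k (orthPart e g k) j y)
        = Matrix.diagonal (Function.update (fun _ => (1 : ℝ)) k
          (∑' y, (g y * e k y) ^ 2 - ∑ l, gMat e g l k ^ 2)) := by
      ext i j
      rw [Matrix.of_apply, Matrix.diagonal_apply]
      by_cases hi : i = k
      · subst hi
        by_cases hj : j = i
        · subst hj
          simp only [Function.update_self, if_true]
          exact (hasSum_orthPart_sq he hg j).tsum_eq
        · simp only [Function.update_self, Function.update_of_ne hj, if_neg (Ne.symm hj)]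
          rw [← (hasSum_mul_orthPart he hg j i).tsum_eq]
          exact tsum_congr fun y => mul_comm _ _
      · simp only [Function.update_of_ne hi]
        by_cases hj : j = k
        · subst hj
          simp only [Function.update_self, if_neg hi]
          exact (hasSum_mul_orthPart he hg i j).tsum_eq
        · simp only [Function.update_of_ne hj]
          exact (he i j).tsum_eq
    rw [this, Matrix.det_diagonal, Finset.prod_update_of_mem (Finset.mem_univ k)]
    simp
  have h4 : (∑ k, ∑ l, (n.factorial : ℝ) * (Matrix.of fun i j =>
        ∑' y, Function.update e k (orthPart e g k) i y
          * Function.update e l (orthPart e g l) j y).det) = n.factorial * projVar e g := by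
    rw [projVar, Finset.mul_sum]
    refine Finset.sum_congr rfl fun k _ => ?_
    rw [Finset.sum_eq_single k, h3]
    · intro l _ hl
      rw [h2 k l hl.symm, mul_zero]
    · simp
  rw [h4] at h1
  refine h1.congr_fun fun x => ?_
  rw [stat_sub_mul_det, sq, Finset.sum_mul_sum]

include he hg in
/-- The mean of the statistic of `g` is the trace of `g` on the span. -/
lemma hasSum_stat_mean : HasSum (fun x : Fin n → ℤ =>
    (stat g x - ∑ k, gMat e g k k) * (Matrix.of fun k j => e k (x j)).det ^ 2) 0 := by
  have hs : ∀ k i j, HasSum (fun y => Function.update e k (orthPart e g k) i y * e j y)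
      (if i = k then 0 else if i = j then 1 else 0) := by
    intro k i j
    by_cases hi : i = k
    · subst hi
      simp only [Function.update_self, if_true]
      simpa only [mul_comm] using hasSum_mul_orthPart he hg j i
    · simp only [Function.update_of_ne hi, if_neg hi]
      exact he i j
  have h1 : HasSum (fun x : Fin n → ℤ => ∑ k,
      (Matrix.of fun i j => Function.update e k (orthPart e g k) i (x j)).det
        * (Matrix.of fun i j => e i (x j)).det)
      (∑ k, n.factorial * (Matrix.of fun i j =>
        ∑' y, Function.update e k (orthPart e g k) i y * e j y).det) :=
    hasSum_sum fun k _ => hasSum_andreief _ _ fun i j => (hs k i j).summable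
  have h2 : ∀ k, (Matrix.of fun i j =>
        ∑' y, Function.update e k (orthPart e g k) i y * e j y).det = 0 := by
    intro k
    refine Matrix.det_eq_zero_of_row_eq_zero k fun j => ?_
    rw [Matrix.of_apply, (hs k k j).tsum_eq, if_pos rfl]
  simp only [h2, mul_zero, Finset.sum_const_zero] at h1
  refine h1.congr_fun fun x => ?_
  rw [← Finset.sum_mul, ← stat_sub_mul_det]
  ring

/-- The reproducing kernel. -/
noncomputable def kern (e : Fin n → ℤ → ℝ) (x y : ℤ) : ℝ := ∑ k, e k x * e k y

include he hg in
/-- The variance as a double sum of squared increments. -/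
lemma hasSum_increments : HasSum (fun z : ℤ × ℤ => (g z.1 - g z.2) ^ 2 * kern e z.1 z.2 ^ 2)
    (2 * projVar e g) := by
  have hQ := fun i j => (summable_mul_sq hg i j).hasSum
  have hprod : ∀ {f h : ℤ → ℝ} {s t : ℝ}, HasSum f s → HasSum h t →
      HasSum (fun z : ℤ × ℤ => f z.1 * h z.2) (s * t) := fun hf hh =>
    hf.mul hh (summable_mul_of_summable_norm hf.summable.norm hh.summable.norm)
  have h1 : HasSum (fun z : ℤ × ℤ => ∑ i, ∑ j,
      ((g z.1 ^ 2 * (e i z.1 * e j z.1)) * (e i z.2 * e j z.2)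
        - 2 * ((g z.1 * (e i z.1 * e j z.1)) * (g z.2 * (e i z.2 * e j z.2)))
        + (e i z.1 * e j z.1) * (g z.2 ^ 2 * (e i z.2 * e j z.2))))
      (∑ i, ∑ j, ((∑' y, g y ^ 2 * (e i y * e j y)) * (if i = j then 1 else 0)
        - 2 * (gMat e g i j * gMat e g i j)
        + (if i = j then 1 else 0) * (∑' y, g y ^ 2 * (e i y * e j y)))) :=
    hasSum_sum fun i _ => hasSum_sum fun j _ =>
      ((hprod (hQ i j) (he i j)).sub
        ((hprod (hasSum_gMat he hg i j) (hasSum_gMat he hg i j)).mul_left 2)).add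
        (hprod (he i j) (hQ i j))
  have h2 : (∑ i, ∑ j, ((∑' y, g y ^ 2 * (e i y * e j y)) * (if i = j then 1 else 0)
        - 2 * (gMat e g i j * gMat e g i j)
        + (if i = j then 1 else 0) * (∑' y, g y ^ 2 * (e i y * e j y)))) = 2 * projVar e g := by
    rw [projVar, Finset.sum_sub_distrib, mul_sub, Finset.mul_sum, Finset.mul_sum]
    simp only [Finset.sum_add_distrib, Finset.sum_sub_distrib, mul_ite, mul_one, mul_zero, ite_mul,
      one_mul, zero_mul, Finset.sum_ite_eq, Finset.mem_univ, if_true]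
    have e1 : ∀ i, ∑' y, g y ^ 2 * (e i y * e i y) = ∑' y, (g y * e i y) ^ 2 := fun i =>
      tsum_congr fun y => by ring
    have e2 : ∑ i, ∑ j, 2 * (gMat e g i j * gMat e g i j)
        = ∑ i, 2 * ∑ l, gMat e g l i ^ 2 := by
      rw [Finset.sum_comm]
      refine Finset.sum_congr rfl fun i _ => ?_
      rw [Finset.mul_sum]
      exact Finset.sum_congr rfl fun j _ => by ring
    rw [e2]
    simp only [e1, ← Finset.mul_sum]
    ring
  rw [h2] at h1
  refine h1.congr_fun fun z => ?_
  rw [kern, sq (∑ k, _), Finset.sum_mul_sum, Finset.mul_sum]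
  refine Finset.sum_congr rfl fun i _ => ?_
  rw [Finset.mul_sum]
  exact Finset.sum_congr rfl fun j _ => by ring

include he in
/-- A bounded function that vanishes off `L` and is Lipschitz with respect to `h` on `L` has a
variance controlled by that of `h` and by the mass off `L`. -/
lemma projVar_le (h : ℤ → ℝ) {V M ε : ℝ}
    (hh : HasSum (fun z : ℤ × ℤ => (h z.1 - h z.2) ^ 2 * kern e z.1 z.2 ^ 2) (2 * V))
    (L : Set ℤ) (hM : ∀ y, |g y| ≤ M) (h0 : ∀ y, y ∉ L → g y = 0)
    (hL : ∀ x ∈ L, ∀ y ∈ L, |g x - g y| ≤ ε * |h x - h y|) :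
    projVar e g ≤ ε ^ 2 * V + M ^ 2 * ∑ k, gMat e (Lᶜ.indicator fun _ => 1) k k := by
  classical
  set χ : ℤ → ℝ := Lᶜ.indicator fun _ => 1 with hχ
  have hχ01 : ∀ y, χ y = 0 ∨ χ y = 1 := by
    intro y
    by_cases hy : y ∈ Lᶜ
    · right; simp [hχ, Set.indicator_of_mem hy]
    · left; simp [hχ, Set.indicator_of_notMem hy]
  have hbd : ∀ {u : ℤ → ℝ} {C : ℝ}, (∀ y, |u y| ≤ C) → ∀ i,
      Summable fun y => (u y * e i y) ^ 2 := by
    intro u C hu i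
    refine Summable.of_norm_bounded ((he i i).summable.mul_left (C ^ 2)) fun y => ?_
    rw [Real.norm_eq_abs, abs_of_nonneg (sq_nonneg _), mul_pow, sq (e i y)]
    refine mul_le_mul_of_nonneg_right ?_ (mul_self_nonneg _)
    exact sq_le_sq' (by linarith [neg_le_of_abs_le (hu y)]) (le_of_abs_le (hu y))
  have hgs := hbd hM
  have hχs := hbd (u := χ) (C := 1) fun y => by rcases hχ01 y with h | h <;> simp [h]
  have hkern : HasSum (fun z : ℤ × ℤ => χ z.1 * kern e z.1 z.2 ^ 2) (∑ k, gMat e χ k k) := by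
    have hprod : ∀ {f h : ℤ → ℝ} {s t : ℝ}, HasSum f s → HasSum h t →
        HasSum (fun z : ℤ × ℤ => f z.1 * h z.2) (s * t) := fun hf hh =>
      hf.mul hh (summable_mul_of_summable_norm hf.summable.norm hh.summable.norm)
    have h1 : HasSum (fun z : ℤ × ℤ => ∑ i, ∑ j,
        (χ z.1 * (e i z.1 * e j z.1)) * (e i z.2 * e j z.2))
        (∑ i, ∑ j, gMat e χ i j * (if i = j then 1 else 0)) :=
      hasSum_sum fun i _ => hasSum_sum fun j _ => hprod (hasSum_gMat he hχs i j) (he i j)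
    have h2 : (∑ i, ∑ j, gMat e χ i j * (if i = j then 1 else 0)) = ∑ k, gMat e χ k k := by
      simp
    rw [h2] at h1
    refine h1.congr_fun fun z => ?_
    rw [kern, sq, Finset.sum_mul_sum, Finset.mul_sum]
    refine Finset.sum_congr rfl fun i _ => ?_
    rw [Finset.mul_sum]
    exact Finset.sum_congr rfl fun j _ => by ring
  have hkern' : HasSum (fun z : ℤ × ℤ => χ z.2 * kern e z.1 z.2 ^ 2) (∑ k, gMat e χ k k) := by
    refine ((Equiv.prodComm ℤ ℤ).hasSum_iff.2 hkern).congr_fun fun z => ?_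
    have : kern e z.2 z.1 = kern e z.1 z.2 := Finset.sum_congr rfl fun k _ => mul_comm _ _
    simp [this]
  have hM0 : 0 ≤ M := (abs_nonneg _).trans (hM 0)
  have hle := hasSum_le (fun z => ?_) (hasSum_increments he hgs)
    ((hh.mul_left (ε ^ 2)).add ((hkern.add hkern').mul_left (M ^ 2)))
  · linarith
  · have h1 : (g z.1 - g z.2) ^ 2 ≤ ε ^ 2 * (h z.1 - h z.2) ^ 2 + M ^ 2 * (χ z.1 + χ z.2) := by
      by_cases hx : z.1 ∈ L
      · by_cases hy : z.2 ∈ L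
        · have := hL _ hx _ hy
          have h2 : (g z.1 - g z.2) ^ 2 ≤ ε ^ 2 * (h z.1 - h z.2) ^ 2 := by
            rw [← sq_abs, ← sq_abs (h z.1 - h z.2), ← mul_pow]
            exact pow_le_pow_left₀ (abs_nonneg _) this 2
          have h3 : 0 ≤ χ z.1 + χ z.2 := by
            rcases hχ01 z.1 with h | h <;> rcases hχ01 z.2 with h' | h' <;> norm_num [h, h']
          nlinarith [mul_nonneg (sq_nonneg M) h3]
        · have h2 : χ z.2 = 1 := by simp [hχ, hy]
          have h3 : χ z.1 = 0 := by simp [hχ, hx]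
          rw [h2, h3, h0 _ hy]
          have := sq_le_sq' (by linarith [neg_le_of_abs_le (hM z.1)]) (le_of_abs_le (hM z.1))
          nlinarith [mul_nonneg (sq_nonneg ε) (sq_nonneg (h z.1 - h z.2))]
      · have h2 : χ z.1 = 1 := by simp [hχ, hx]
        have h3 : 0 ≤ χ z.2 := by rcases hχ01 z.2 with h' | h' <;> norm_num [h']
        rw [h2, h0 _ hx]
        have := sq_le_sq' (by linarith [neg_le_of_abs_le (hM z.2)]) (le_of_abs_le (hM z.2))
        nlinarith [mul_nonneg (sq_nonneg ε) (sq_nonneg (h z.1 - h z.2)),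
          mul_nonneg (sq_nonneg M) h3]
    calc (g z.1 - g z.2) ^ 2 * kern e z.1 z.2 ^ 2
        ≤ (ε ^ 2 * (h z.1 - h z.2) ^ 2 + M ^ 2 * (χ z.1 + χ z.2)) * kern e z.1 z.2 ^ 2 :=
          mul_le_mul_of_nonneg_right h1 (sq_nonneg _)
      _ = _ := by ring

end Projection

/-! ### One-time marginals -/

section Ensemble

variable {N n : ℕ} (E : ExtendedEnsemble N n)

/-- The determinant of the first `n` orthonormal functions at `n` points. -/
noncomputable def rhoDet (m : Fin (N + 1)) (x : Fin n → ℤ) : ℝ :=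
  (Matrix.of fun k j : Fin n => rho E m k (x j)).det

lemma hasSum_forward_transDet (m : Fin N) (hS : (n : ℕ∞) ≤ numSupp E m.castSucc)
    (y : Fin n → ℤ) :
    HasSum (fun x => (∏ k : Fin n, E.c m.castSucc k) * rhoDet E m.castSucc x * transDet E m x y)
      (n.factorial * ((∏ k : Fin n, E.c m.succ k) * rhoDet E m.succ y)) := by
  have hk : ∀ k : Fin n, ((k : ℕ) : ℕ∞) < numSupp E m.castSucc := fun k =>
    lt_of_lt_of_le (by exact_mod_cast k.2) hS
  have h1 : ∀ i j : Fin n, HasSum (fun x => E.c m.castSucc i * rho E m.castSucc i x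
      * symTrans E m x (y j)) (E.c m.succ i * rho E m.succ i (y j)) := by
    intro i j
    have := (hasSum_symTrans_left E m (y j) (hk i)).mul_left (E.c m.castSucc i)
    have hc := (E.c_pos m.castSucc i (hk i)).ne'
    have e : E.c m.castSucc i * (E.c m.succ i / E.c m.castSucc i * rho E m.succ i (y j))
        = E.c m.succ i * rho E m.succ i (y j) := by
      field_simp
    rw [e] at this
    exact this.congr_fun fun x => by ring
  have h := hasSum_andreief (fun (k : Fin n) x => E.c m.castSucc k * rho E m.castSucc k x)
    (fun j x => symTrans E m x (y j)) (fun i j => (h1 i j).summable)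
  have e : (Matrix.of fun i j : Fin n => ∑' x, E.c m.castSucc i * rho E m.castSucc i x
      * symTrans E m x (y j)).det = (∏ k : Fin n, E.c m.succ k) * rhoDet E m.succ y := by
    rw [rhoDet, ← Matrix.det_mul_column]
    congr 1
    ext i j
    simp [(h1 i j).tsum_eq]
  rw [e] at h
  refine h.congr_fun fun x => ?_
  rw [rhoDet, ← Matrix.det_mul_column, transDet, ← Matrix.det_transpose (Matrix.of fun i j =>
    symTrans E m (x i) (y j))]
  rfl

lemma slater_firstVecs (m : Fin (N + 1)) (x : Fin n → ℤ) :
    slater E m x (firstVecs n) = (∏ k : Fin n, (E.c m k)⁻¹) * rhoDet E m x := by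
  rw [slater_apply, rhoDet, ← Matrix.det_mul_column]
  congr 1
  ext i j
  simp [firstVecs, evalVec_single]
  ring

variable (a b : Fin N → ℕ → ℝ)
    (hab : ∀ m : Fin N, IsRecurrence (E.ν m.succ) (E.w m.succ) (E.p m.succ) (a m) (b m))
    (hS : ∀ m : Fin N, (n : ℕ∞) ≤ numSupp E m.succ)
include hab hS

/-- At each time the points form an orthogonal polynomial ensemble. -/
lemma map_real_singleton (m : Fin (N + 1)) (z : Fin n → ℤ) :
    (E.law.map fun y : Config N n => y m).real {z} = rhoDet E m z ^ 2 / n.factorial := by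
  obtain ⟨Z, hZ⟩ := E.law_eq
  have hnorm := normalization E a b hab hS hZ
  have hS' : ∀ m, (n : ℕ∞) ≤ numSupp E m := fun m => by
    induction m using Fin.cases with
    | zero => exact le_numSupp_zero E
    | succ m => exact hS m
  set F : (Fin n → ℤ) → ℝ := Set.indicator {z} 1 with hF
  have hmeas : MeasurableSet {y : Config N n | y m = z} := .of_discrete
  have hint : Integrable (fun y : Config N n => F (y m)) E.law := by
    have : (fun y : Config N n => F (y m)) = Set.indicator {y | y m = z} 1 := rfl
    rw [this]
    exact (integrable_const (1 : ℝ)).indicator hmeas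
  have hval : ∫ y : Config N n, F (y m) ∂E.law
      = (E.law.map fun y : Config N n => y m).real {z} := by
    have : (fun y : Config N n => F (y m)) = Set.indicator {y | y m = z} 1 := rfl
    rw [this, integral_indicator_one hmeas, measureReal_def, measureReal_def,
      Measure.map_apply .of_discrete (.of_discrete)]
    rfl
  have h1 := hasSum_real_integral hint
  rw [hval] at h1
  have hch : ∀ y : Config N n, E.law.real {y} * F (y m)
      = chainProd (fun x => Z * initDet E x) (transDet E) (finalDet E) y * F (y m) := by
    intro y
    rw [hZ, density_eq_chainProd]
    simp only [chainProd]
    ring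
  have h2 := hasSum_chainProd_marginal (transDet E) (finalDet E)
    (fun m x => (n.factorial : ℝ) ^ (N - (m : ℕ)) * slater E m x (firstVecs n))
    (by funext x; simp [slater_firstVecs_last])
    (fun m x => by
      have := (hasSum_transDet_slater E m x (hS m) (firstVecs n) (fun i k hk => by
        rw [firstVecs, Finsupp.single_apply, if_neg (by have := i.2; omega)])).mul_left
          ((n.factorial : ℝ) ^ (N - ((m : ℕ) + 1)))
      have e : N - (m : ℕ) = N - ((m : ℕ) + 1) + 1 := by have := m.2; omega
      simp only [Fin.val_castSucc, Fin.val_succ, e, pow_succ, mul_assoc]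
      exact this.congr_fun fun y => by ring)
    (fun x => Z * initDet E x)
    (fun m x => Z * (n.factorial : ℝ) ^ (m : ℕ) * ((∏ k : Fin n, E.c m k) * rhoDet E m x))
    (by
      funext x
      rw [initDet, rhoDet, ← Matrix.det_mul_column]
      simp)
    (fun m y => by
      have := (hasSum_forward_transDet E m (hS' _) y).mul_left (Z * (n.factorial : ℝ) ^ (m : ℕ))
      simp only [Fin.val_castSucc, Fin.val_succ, pow_succ]
      have e : Z * ((n.factorial : ℝ) ^ (m : ℕ) * n.factorial)
          * ((∏ k : Fin n, E.c m.succ k) * rhoDet E m.succ y)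
          = Z * (n.factorial : ℝ) ^ (m : ℕ)
            * (n.factorial * ((∏ k : Fin n, E.c m.succ k) * rhoDet E m.succ y)) := by ring
      rw [e]
      exact this.congr_fun fun x => by ring)
    F m (S := rhoDet E m z ^ 2 / n.factorial) (by
      have e : rhoDet E m z ^ 2 / n.factorial = Z * (n.factorial : ℝ) ^ (m : ℕ)
          * ((∏ k : Fin n, E.c m k) * rhoDet E m z) * F z
          * ((n.factorial : ℝ) ^ (N - (m : ℕ)) * slater E m z (firstVecs n)) := by
        have hFz : F z = 1 := by simp [hF]
        have hc : (∏ k : Fin n, E.c m k) * (∏ k : Fin n, (E.c m k)⁻¹) = 1 := by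
          rw [← Finset.prod_mul_distrib]
          refine Finset.prod_eq_one fun k _ => mul_inv_cancel₀ ?_
          exact (E.c_pos m k (lt_of_lt_of_le (by exact_mod_cast k.2) (hS' m))).ne'
        have hp : Z * ((n.factorial : ℝ) ^ (m : ℕ) * (n.factorial : ℝ) ^ (N - (m : ℕ)))
            * n.factorial = 1 := by
          rw [← pow_add, show (m : ℕ) + (N - m) = N by have := m.2; omega, mul_assoc, ← pow_succ,
            hnorm]
        have hn0 : (n.factorial : ℝ) ≠ 0 := by positivity
        rw [hFz, slater_firstVecs, div_eq_iff hn0]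
        calc _ = (Z * ((n.factorial : ℝ) ^ (m : ℕ) * (n.factorial : ℝ) ^ (N - (m : ℕ)))
            * n.factorial) * ((∏ k : Fin n, E.c m k) * (∏ k : Fin n, (E.c m k)⁻¹))
            * rhoDet E m z ^ 2 := by rw [hc, hp]; ring
          _ = _ := by ring
      rw [e]
      refine hasSum_single z fun x hx => ?_
      have : F x = 0 := by simp [hF, hx]
      simp [this])
    (h1.summable.congr hch)
  exact h1.unique (h2.congr_fun fun y => hch y)

omit hab hS in
lemma orthonormal_rho (m : Fin (N + 1)) (hS : (n : ℕ∞) ≤ numSupp E m) (i j : Fin n) :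
    HasSum (fun y => rho E m i y * rho E m j y) (if i = j then 1 else 0) := by
  have := hasSum_rho_mul_rho E m (lt_of_lt_of_le (by exact_mod_cast i.2) hS)
    (lt_of_lt_of_le (by exact_mod_cast j.2) hS) (j := i) (k := j)
  simpa only [Fin.val_inj] using this

/-- Mean and variance of a linear statistic at a fixed time. -/
lemma integral_stat (m : Fin N) (g : ℤ → ℝ)
    (hg : ∀ i : Fin n, Summable fun y => (g y * rho E m.succ i y) ^ 2) :
    MemLp (fun y : Config N n => stat g (y m.succ)) 2 E.law ∧
    ∫ y : Config N n, stat g (y m.succ) ∂E.law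
      = ∑ k, gMat (fun k : Fin n => rho E m.succ k) g k k ∧
    ∫ y : Config N n, (stat g (y m.succ)
      - ∑ k, gMat (fun k : Fin n => rho E m.succ k) g k k) ^ 2 ∂E.law
      = projVar (fun k : Fin n => rho E m.succ k) g := by
  set e : Fin n → ℤ → ℝ := fun k => rho E m.succ k with he_def
  have he : ∀ i j, HasSum (fun y => e i y * e j y) (if i = j then 1 else 0) :=
    orthonormal_rho E m.succ (hS m)
  set P := E.law.map fun y : Config N n => y m.succ with hP
  have hmeas : Measurable fun y : Config N n => y m.succ := .of_discrete
  have : IsProbabilityMeasure P := Measure.isProbabilityMeasure_map hmeas.aemeasurable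
  have hreal : ∀ z, P.real {z} = rhoDet E m.succ z ^ 2 / n.factorial :=
    map_real_singleton E a b hab hS m.succ
  have hn0 : (n.factorial : ℝ) ≠ 0 := by positivity
  set c := ∑ k, gMat e g k k with hc
  have h2 : HasSum (fun z => P.real {z} * (stat g z - c) ^ 2) (projVar e g) := by
    have := (hasSum_stat_sq he hg).div_const (n.factorial : ℝ)
    rw [mul_div_cancel_left₀ _ hn0] at this
    refine this.congr_fun fun z => ?_
    rw [hreal, rhoDet]
    ring
  have h1 : HasSum (fun z => P.real {z} * (stat g z - c)) 0 := by
    have := (hasSum_stat_mean he hg).div_const (n.factorial : ℝ)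
    rw [zero_div] at this
    refine this.congr_fun fun z => ?_
    rw [hreal, rhoDet]
    ring
  have i1 : Integrable (fun z => stat g z - c) P := (integrable_iff_summable_real _).2 h1.summable
  have i2 : Integrable (fun z => (stat g z - c) ^ 2) P :=
    (integrable_iff_summable_real _).2 h2.summable
  have v1 : ∫ z, (stat g z - c) ∂P = 0 := (hasSum_real_integral i1).unique h1
  have v2 : ∫ z, (stat g z - c) ^ 2 ∂P = projVar e g := (hasSum_real_integral i2).unique h2
  have i0 : Integrable (fun z => stat g z) P := by
    exact (i1.add (integrable_const c)).congr (.of_forall fun z => by simp)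
  have v0 : ∫ z, stat g z ∂P = c := by
    rw [integral_sub i0 (integrable_const c)] at v1
    simp at v1
    linarith
  have hmem : MemLp (fun z => stat g z) 2 P := by
    have : MemLp (fun z => stat g z - c) 2 P :=
      (memLp_two_iff_integrable_sq i1.aestronglyMeasurable).2 i2
    have h3 := this.add (memLp_const c)
    exact h3.ae_eq (.of_forall fun z => by simp)
  refine ⟨hmem.comp_of_map hmeas.aemeasurable, ?_, ?_⟩
  · rw [← v0, hP, integral_map hmeas.aemeasurable (Measurable.of_discrete).aestronglyMeasurable]
  · rw [← v2, hP, integral_map hmeas.aemeasurable (Measurable.of_discrete).aestronglyMeasurable]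

/-! ### The Christoffel–Darboux formula -/

omit hS in
lemma recurrence_rho (m : Fin N) {k : ℕ} (hk : (k : ℕ∞) < numSupp E m.succ) (y : ℤ) :
    E.ν m.succ y * rho E m.succ k y = a m k * rho E m.succ (k + 1) y + b m k * rho E m.succ k y
      + (if k = 0 then 0 else a m (k - 1) * rho E m.succ (k - 1) y) := by
  by_cases hy : E.w m.succ y = 0
  · simp [rho, hy]
  have := (hab m).recurrence k hk y hy
  simp only [rho]
  rw [← mul_assoc, this]
  split_ifs <;> ring

omit hS in
lemma christoffel_darboux (m : Fin N) (x y : ℤ) (k : ℕ)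
    (hk : (k : ℕ∞) ≤ numSupp E m.succ) :
    (E.ν m.succ x - E.ν m.succ y) * ∑ i ∈ Finset.range k, rho E m.succ i x * rho E m.succ i y
      = if k = 0 then 0 else a m (k - 1) * (rho E m.succ k x * rho E m.succ (k - 1) y
          - rho E m.succ (k - 1) x * rho E m.succ k y) := by
  induction k with
  | zero => simp
  | succ k ih =>
    have hk' : (k : ℕ∞) < numSupp E m.succ := lt_of_lt_of_le (by exact_mod_cast k.lt_succ_self) hk
    have hx := recurrence_rho E a b hab m hk' x
    have hy := recurrence_rho E a b hab m hk' y
    rw [Finset.sum_range_succ, mul_add, ih hk'.le, if_neg (Nat.succ_ne_zero k),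
      Nat.add_sub_cancel]
    have e : (E.ν m.succ x - E.ν m.succ y) * (rho E m.succ k x * rho E m.succ k y)
        = (E.ν m.succ x * rho E m.succ k x) * rho E m.succ k y
          - rho E m.succ k x * (E.ν m.succ y * rho E m.succ k y) := by ring
    rw [e, hx, hy]
    split_ifs <;> ring

omit hS in
/-- The increments of `ν` against the squared kernel: the variance of the linear statistic of `ν`
is `a_{n-1}²`. -/
lemma hasSum_increments_nu (m : Fin N) (hn : n ≠ 0) (hS : (n : ℕ∞) < numSupp E m.succ) :
    HasSum (fun z : ℤ × ℤ => (E.ν m.succ z.1 - E.ν m.succ z.2) ^ 2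
      * kern (fun k : Fin n => rho E m.succ k) z.1 z.2 ^ 2) (2 * a m (n - 1) ^ 2) := by
  have hs1 : ((n - 1 : ℕ) : ℕ∞) < numSupp E m.succ :=
    lt_of_le_of_lt (by exact_mod_cast Nat.sub_le n 1) hS
  have h1 := hasSum_rho_mul_rho E m.succ hS hS
  have h2 := hasSum_rho_mul_rho E m.succ hs1 hs1
  have h3 := hasSum_rho_mul_rho E m.succ hS hs1
  have hprod : ∀ {f h : ℤ → ℝ} {s t : ℝ}, HasSum f s → HasSum h t →
      HasSum (fun z : ℤ × ℤ => f z.1 * h z.2) (s * t) := fun hf hh =>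
    hf.mul hh (summable_mul_of_summable_norm hf.summable.norm hh.summable.norm)
  rw [if_pos rfl] at h1 h2
  rw [if_neg (by omega)] at h3
  have h := (((hprod h1 h2).add (hprod h2 h1)).sub ((hprod h3 h3).mul_left 2)).mul_left
    (a m (n - 1) ^ 2)
  have e : a m (n - 1) ^ 2 * ((1 : ℝ) * 1 + 1 * 1 - 2 * (0 * 0)) = 2 * a m (n - 1) ^ 2 := by ring
  rw [e] at h
  refine h.congr_fun fun z => ?_
  have hcd := christoffel_darboux E a b hab m z.1 z.2 n hS.le
  rw [if_neg hn] at hcd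
  have hk : kern (fun k : Fin n => rho E m.succ k) z.1 z.2
      = ∑ i ∈ Finset.range n, rho E m.succ i z.1 * rho E m.succ i z.2 := by
    rw [kern, Finset.sum_range]
  rw [← mul_pow, hk, hcd]
  ring

end Ensemble

/-! ### Fourier coefficients of the symbol -/

/-- The Fourier cosine coefficients of `F` in the variable `β + 2 α cos θ`. -/
noncomputable def chebCoeff (α β : ℝ) (F : ℝ → ℝ) (j : ℤ) : ℝ :=
  1 / Real.pi * ∫ θ in (0 : ℝ)..Real.pi, F (β + 2 * α * Real.cos θ) * Real.cos (j * θ)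

lemma chebCoeff_neg (α β : ℝ) (F : ℝ → ℝ) (j : ℤ) : chebCoeff α β F (-j) = chebCoeff α β F j := by
  simp [chebCoeff]

lemma integral_cos_int_mul (j : ℤ) :
    ∫ θ in (0 : ℝ)..Real.pi, Real.cos (j * θ) = if j = 0 then Real.pi else 0 := by
  split_ifs with h
  · simp [h]
  · have hj : (j : ℝ) ≠ 0 := by exact_mod_cast h
    rw [intervalIntegral.integral_comp_mul_left (fun x => Real.cos x) hj]
    simp [Real.sin_int_mul_pi]

section Coeff

variable (α β : ℝ) {F G : ℝ → ℝ}

lemma intervalIntegrable_cheb (hF : Continuous F) (j : ℤ) : IntervalIntegrable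
    (fun θ => F (β + 2 * α * Real.cos θ) * Real.cos (j * θ)) volume 0 Real.pi :=
  Continuous.intervalIntegrable (by fun_prop) _ _

lemma chebCoeff_add (hF : Continuous F) (hG : Continuous G) (j : ℤ) :
    chebCoeff α β (fun u => F u + G u) j = chebCoeff α β F j + chebCoeff α β G j := by
  simp only [chebCoeff, add_mul]
  rw [intervalIntegral.integral_add (intervalIntegrable_cheb α β hF j)
    (intervalIntegrable_cheb α β hG j)]
  ring

lemma chebCoeff_sub (hF : Continuous F) (hG : Continuous G) (j : ℤ) :
    chebCoeff α β (fun u => F u - G u) j = chebCoeff α β F j - chebCoeff α β G j := by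
  simp only [chebCoeff, sub_mul]
  rw [intervalIntegral.integral_sub (intervalIntegrable_cheb α β hF j)
    (intervalIntegrable_cheb α β hG j)]
  ring

lemma chebCoeff_const_mul (c : ℝ) (j : ℤ) :
    chebCoeff α β (fun u => c * F u) j = c * chebCoeff α β F j := by
  simp only [chebCoeff, mul_assoc, intervalIntegral.integral_const_mul]
  ring

lemma chebCoeff_one (j : ℤ) : chebCoeff α β (fun _ => 1) j = if j = 0 then 1 else 0 := by
  simp only [chebCoeff, one_mul, integral_cos_int_mul]
  split_ifs
  · field_simp
  · simp

lemma chebCoeff_id_mul (hF : Continuous F) (j : ℤ) : chebCoeff α β (fun u => u * F u) j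
    = α * chebCoeff α β F (j - 1) + β * chebCoeff α β F j + α * chebCoeff α β F (j + 1) := by
  have h1 := (intervalIntegrable_cheb α β hF (j - 1)).const_mul α
  have h2 := (intervalIntegrable_cheb α β hF j).const_mul β
  have h3 := (intervalIntegrable_cheb α β hF (j + 1)).const_mul α
  have e : ∫ θ in (0 : ℝ)..Real.pi, (β + 2 * α * Real.cos θ) * F (β + 2 * α * Real.cos θ)
      * Real.cos (j * θ)
      = ∫ θ in (0 : ℝ)..Real.pi, (α * (F (β + 2 * α * Real.cos θ) * Real.cos ((j - 1 : ℤ) * θ))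
        + β * (F (β + 2 * α * Real.cos θ) * Real.cos (j * θ))
        + α * (F (β + 2 * α * Real.cos θ) * Real.cos ((j + 1 : ℤ) * θ))) := by
    refine intervalIntegral.integral_congr fun θ _ => ?_
    have e1 : Real.cos ((j - 1 : ℤ) * θ) + Real.cos ((j + 1 : ℤ) * θ)
        = 2 * Real.cos θ * Real.cos (j * θ) := by
      push_cast
      rw [sub_mul, add_mul, one_mul, Real.cos_sub, Real.cos_add]
      ring
    linear_combination (-α * F (β + 2 * α * Real.cos θ)) * e1
  rw [chebCoeff, e, intervalIntegral.integral_add (h1.add h2) h3,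
    intervalIntegral.integral_add h1 h2, intervalIntegral.integral_const_mul,
    intervalIntegral.integral_const_mul, intervalIntegral.integral_const_mul]
  simp only [chebCoeff]
  ring

end Coeff

lemma coeff_jacobiSymbol_mul (α β τ : ℝ) (s : AddMonoidAlgebra ℝ ℤ) (j : ℤ) :
    (jacobiSymbol α β τ * s).coeff j = α * Real.exp (-τ) * s.coeff (j - 1) + β * s.coeff j
      + α * Real.exp τ * s.coeff (j + 1) := by
  have h : ∀ (i : ℤ) (r : ℝ), (AddMonoidAlgebra.single i r * s).coeff j = r * s.coeff (j - i) := by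
    intro i r
    rw [AddMonoidAlgebra.coeff_single_mul_apply]
    ring_nf
  simp only [jacobiSymbol, add_mul, AddMonoidAlgebra.coeff_add, Finsupp.add_apply, h]
  ring_nf

/-- The coefficients of a polynomial in the symbol of the Jacobi operator are Fourier
coefficients. -/
theorem coeff_aeval_jacobiSymbol (α β τ : ℝ) (q : Polynomial ℝ) (j : ℤ) :
    (Polynomial.aeval (jacobiSymbol α β τ) q).coeff j
      = Real.exp (-τ * j) * chebCoeff α β (fun u => q.eval u) j := by
  have hmul : ∀ p : Polynomial ℝ, (∀ j, (Polynomial.aeval (jacobiSymbol α β τ) p).coeff j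
      = Real.exp (-τ * j) * chebCoeff α β (fun u => p.eval u) j) →
      ∀ j, (Polynomial.aeval (jacobiSymbol α β τ) (Polynomial.X * p)).coeff j
      = Real.exp (-τ * j) * chebCoeff α β (fun u => (Polynomial.X * p).eval u) j := by
    intro p hp j
    simp only [map_mul, Polynomial.aeval_X, Polynomial.eval_mul, Polynomial.eval_X]
    rw [coeff_jacobiSymbol_mul, hp, hp, hp, chebCoeff_id_mul α β p.continuous]
    have e1 : Real.exp (-τ) * Real.exp (-τ * (j - 1 : ℤ)) = Real.exp (-τ * j) := by
      rw [← Real.exp_add]; push_cast; ring_nf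
    have e2 : Real.exp τ * Real.exp (-τ * (j + 1 : ℤ)) = Real.exp (-τ * j) := by
      rw [← Real.exp_add]; push_cast; ring_nf
    linear_combination (α * chebCoeff α β (fun u => p.eval u) (j - 1)) * e1
      + (α * chebCoeff α β (fun u => p.eval u) (j + 1)) * e2
  induction q using Polynomial.induction_on' generalizing j with
  | add p q hp hq =>
    simp only [map_add, AddMonoidAlgebra.coeff_add, Finsupp.add_apply, Polynomial.eval_add]
    rw [hp, hq, chebCoeff_add α β p.continuous q.continuous]
    ring
  | monomial k c =>
    have h1 : ∀ (k : ℕ) (j : ℤ),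
      (Polynomial.aeval (jacobiSymbol α β τ) (Polynomial.X ^ k : Polynomial ℝ)).coeff j
      = Real.exp (-τ * j) * chebCoeff α β (fun u => (Polynomial.X ^ k : Polynomial ℝ).eval u) j := by
      intro k
      induction k with
      | zero =>
        intro j
        simp only [pow_zero, map_one, Polynomial.eval_one, chebCoeff_one]
        rw [AddMonoidAlgebra.one_def, AddMonoidAlgebra.coeff_single, Finsupp.single_apply]
        rcases eq_or_ne j 0 with rfl | hj
        · simp
        · simp [hj, hj.symm]
      | succ k ih =>
        rw [pow_succ']
        exact hmul _ ih
    rw [← Polynomial.smul_X_eq_monomial]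
    simp only [map_smul, AddMonoidAlgebra.coeff_smul, Finsupp.smul_apply, Polynomial.eval_smul,
      smul_eq_mul, chebCoeff_const_mul]
    rw [h1]
    ring

/-! ### Bessel's inequality -/

lemma integral_sin_mul_sin (j k : ℕ) (hj : j ≠ 0) :
    ∫ θ in (0 : ℝ)..Real.pi, Real.sin (j * θ) * Real.sin (k * θ)
      = if j = k then Real.pi / 2 else 0 := by
  have e : ∀ θ : ℝ, Real.sin (j * θ) * Real.sin (k * θ)
      = 1 / 2 * Real.cos (((j : ℤ) - k : ℤ) * θ) - 1 / 2 * Real.cos (((j : ℤ) + k : ℤ) * θ) := by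
    intro θ
    push_cast
    rw [sub_mul, add_mul, Real.cos_sub, Real.cos_add]
    ring
  simp only [e]
  rw [intervalIntegral.integral_sub (Continuous.intervalIntegrable (by fun_prop) _ _)
    (Continuous.intervalIntegrable (by fun_prop) _ _), intervalIntegral.integral_const_mul,
    intervalIntegral.integral_const_mul, integral_cos_int_mul, integral_cos_int_mul,
    if_neg (by omega : ¬ ((j : ℤ) + k = 0))]
  by_cases h : j = k
  · simp [h]; ring
  · rw [if_neg (by omega), if_neg h]; simp

lemma bessel_sin (G : ℝ → ℝ) (hG : Continuous G) (S : Finset ℕ) (hS : 0 ∉ S) :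
    ∑ k ∈ S, (1 / Real.pi * ∫ θ in (0 : ℝ)..Real.pi, G θ * Real.sin (k * θ)) ^ 2
      ≤ 1 / (2 * Real.pi) * ∫ θ in (0 : ℝ)..Real.pi, G θ ^ 2 := by
  set c : ℕ → ℝ := fun k => 1 / Real.pi * ∫ θ in (0 : ℝ)..Real.pi, G θ * Real.sin (k * θ) with hc
  set T : ℝ → ℝ := fun θ => ∑ k ∈ S, 2 * c k * Real.sin (k * θ) with hT
  have hTc : Continuous T := by fun_prop
  have h0 : 0 ≤ ∫ θ in (0 : ℝ)..Real.pi, (G θ - T θ) ^ 2 :=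
    intervalIntegral.integral_nonneg Real.pi_pos.le fun θ _ => sq_nonneg _
  have h1 : ∫ θ in (0 : ℝ)..Real.pi, G θ * T θ = ∑ k ∈ S, 2 * Real.pi * c k ^ 2 := by
    simp only [hT, Finset.mul_sum]
    rw [intervalIntegral.integral_finsetSum
      fun k _ => Continuous.intervalIntegrable (by fun_prop) _ _]
    refine Finset.sum_congr rfl fun k _ => ?_
    have e : ∀ θ, G θ * (2 * c k * Real.sin (k * θ)) = 2 * c k * (G θ * Real.sin (k * θ)) := by
      intro θ; ring
    simp only [e, intervalIntegral.integral_const_mul]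
    have e2 : ∫ θ in (0 : ℝ)..Real.pi, G θ * Real.sin (k * θ) = Real.pi * c k := by
      simp only [hc]; field_simp
    rw [e2]; ring
  have h2 : ∫ θ in (0 : ℝ)..Real.pi, T θ * T θ = ∑ k ∈ S, 2 * Real.pi * c k ^ 2 := by
    have e : ∀ θ, T θ * T θ = ∑ j ∈ S, ∑ k ∈ S,
        4 * c j * c k * (Real.sin (j * θ) * Real.sin (k * θ)) := by
      intro θ
      simp only [hT, Finset.sum_mul_sum]
      exact Finset.sum_congr rfl fun j _ => Finset.sum_congr rfl fun k _ => by ring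
    simp only [e]
    rw [intervalIntegral.integral_finsetSum
      fun k _ => Continuous.intervalIntegrable (by fun_prop) _ _]
    refine Finset.sum_congr rfl fun j hj => ?_
    rw [intervalIntegral.integral_finsetSum
      fun k _ => Continuous.intervalIntegrable (by fun_prop) _ _]
    have hj0 : j ≠ 0 := fun h => hS (h ▸ hj)
    simp only [intervalIntegral.integral_const_mul, integral_sin_mul_sin j _ hj0, mul_ite,
      mul_zero, Finset.sum_ite_eq, if_pos hj]
    ring
  have h3 : ∫ θ in (0 : ℝ)..Real.pi, (G θ - T θ) ^ 2
      = (∫ θ in (0 : ℝ)..Real.pi, G θ ^ 2) - 2 * (∫ θ in (0 : ℝ)..Real.pi, G θ * T θ)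
        + ∫ θ in (0 : ℝ)..Real.pi, T θ * T θ := by
    rw [← intervalIntegral.integral_const_mul, ← intervalIntegral.integral_sub
      (Continuous.intervalIntegrable (by fun_prop) _ _)
      (Continuous.intervalIntegrable (by fun_prop) _ _), ← intervalIntegral.integral_add
      (Continuous.intervalIntegrable (by fun_prop) _ _)
      (Continuous.intervalIntegrable (by fun_prop) _ _)]
    exact intervalIntegral.integral_congr fun θ _ => by ring
  rw [h3, h1, h2, ← Finset.mul_sum] at h0
  have hpi := Real.pi_pos
  rw [one_div_mul_eq_div (2 * Real.pi), le_div_iff₀ (by positivity)]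
  linarith

/-- Integration by parts turns `k` times the cosine coefficient of `F` into a sine coefficient of
its derivative, to which Bessel's inequality applies. -/
lemma bessel_cheb (α β : ℝ) (hα : 0 ≤ α) {F : ℝ → ℝ} (hF : ContDiff ℝ 1 F) {M : ℝ}
    (hM : ∀ u ∈ Set.Icc (β - 2 * α) (β + 2 * α), |deriv F u| ≤ M) (S : Finset ℕ) :
    ∑ k ∈ S, (k * chebCoeff α β F k) ^ 2 ≤ 2 * α ^ 2 * M ^ 2 := by
  classical
  have hF' : Continuous (deriv F) := hF.continuous_deriv le_rfl
  set G : ℝ → ℝ := fun θ => 2 * α * Real.sin θ * deriv F (β + 2 * α * Real.cos θ) with hG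
  have hGc : Continuous G := by fun_prop
  have hFc : Continuous F := hF.continuous
  have hpi := Real.pi_pos
  have key : ∀ k : ℕ, k * chebCoeff α β F k
      = 1 / Real.pi * ∫ θ in (0 : ℝ)..Real.pi, G θ * Real.sin (k * θ) := by
    intro k
    have hd : ∀ θ ∈ Set.uIcc 0 Real.pi, HasDerivAt
        (fun θ => F (β + 2 * α * Real.cos θ) * Real.sin (k * θ))
        (F (β + 2 * α * Real.cos θ) * (k * Real.cos (k * θ)) - G θ * Real.sin (k * θ)) θ := by
      intro θ _
      have h1 : HasDerivAt (fun θ => β + 2 * α * Real.cos θ) (2 * α * -Real.sin θ) θ :=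
        ((Real.hasDerivAt_cos θ).const_mul _).const_add β
      have h2 := ((hF.differentiable one_ne_zero (β + 2 * α * Real.cos θ)).hasDerivAt).comp θ h1
      have h3 : HasDerivAt (fun θ => Real.sin (k * θ)) (Real.cos (k * θ) * (k * 1)) θ :=
        ((hasDerivAt_id θ).const_mul (k : ℝ)).sin
      refine (h2.mul h3).congr_deriv ?_
      simp only [hG, Function.comp]
      ring
    have h := intervalIntegral.integral_eq_sub_of_hasDerivAt hd
      (Continuous.intervalIntegrable (by fun_prop) _ _)
    rw [intervalIntegral.integral_sub (Continuous.intervalIntegrable (by fun_prop) _ _)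
      (Continuous.intervalIntegrable (by fun_prop) _ _)] at h
    simp only [Real.sin_nat_mul_pi, mul_zero, Real.sin_zero, sub_self] at h
    rw [sub_eq_zero] at h
    rw [← h, chebCoeff]
    have e : ∀ θ : ℝ, F (β + 2 * α * Real.cos θ) * (k * Real.cos (k * θ))
        = k * (F (β + 2 * α * Real.cos θ) * Real.cos (k * θ)) := fun θ => by ring
    simp only [e, intervalIntegral.integral_const_mul, Int.cast_natCast]
    ring
  have h1 : ∑ k ∈ S, (k * chebCoeff α β F k) ^ 2
      = ∑ k ∈ S.erase 0, (1 / Real.pi * ∫ θ in (0 : ℝ)..Real.pi, G θ * Real.sin (k * θ)) ^ 2 := by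
    simp only [← key]
    refine (Finset.sum_subset (Finset.erase_subset _ _) fun k _ hk2 => ?_).symm
    have : k = 0 := by
      by_contra h
      exact hk2 (Finset.mem_erase.2 ⟨h, by assumption⟩)
    simp [this]
  rw [h1]
  refine (bessel_sin G hGc _ (by simp)).trans ?_
  have h2 : ∫ θ in (0 : ℝ)..Real.pi, G θ ^ 2 ≤ ∫ _ in (0 : ℝ)..Real.pi, (2 * α * M) ^ 2 := by
    refine intervalIntegral.integral_mono_on hpi.le
      (Continuous.intervalIntegrable (by fun_prop) _ _) (Continuous.intervalIntegrable (by fun_prop) _ _) fun θ _ => ?_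
    have hc := Real.abs_cos_le_one θ
    have hu := hM (β + 2 * α * Real.cos θ) ⟨by nlinarith [abs_le.1 hc], by nlinarith [abs_le.1 hc]⟩
    have hs := Real.abs_sin_le_one θ
    rw [← sq_abs]
    have : |G θ| ≤ 2 * α * M := by
      simp only [hG, abs_mul, abs_two, abs_of_nonneg hα]
      calc 2 * α * |Real.sin θ| * |deriv F (β + 2 * α * Real.cos θ)| ≤ 2 * α * 1 * M := by
            gcongr
        _ = _ := by ring
    gcongr
  rw [intervalIntegral.integral_const, sub_zero, smul_eq_mul] at h2
  calc _ ≤ 1 / (2 * Real.pi) * (Real.pi * (2 * α * M) ^ 2) := by gcongr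
    _ = _ := by field_simp

/-! ### The limiting covariance -/

/-- The summands of the limiting covariance. -/
noncomputable def covTerm (α β α' β' l : ℝ) (F G : ℝ → ℝ) (k : ℕ) : ℝ :=
  k * Real.exp (-l * k) * chebCoeff α β F k * chebCoeff α' β' G k

section Cov

variable {α β α' β' l : ℝ} {F G : ℝ → ℝ}

/-- As `k ≤ k²`, each of the two coefficients may be given a factor `k`, so that `bessel_cheb` and the
Cauchy–Schwarz inequality bound the series by the derivatives alone. -/
lemma covTerm_bound (hα : 0 ≤ α) (hα' : 0 ≤ α') (hl : 0 ≤ l) (hF : ContDiff ℝ 1 F)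
    (hG : ContDiff ℝ 1 G) {M M' : ℝ} (hM0 : 0 ≤ M) (hM0' : 0 ≤ M')
    (hM : ∀ u ∈ Set.Icc (β - 2 * α) (β + 2 * α), |deriv F u| ≤ M)
    (hM' : ∀ u ∈ Set.Icc (β' - 2 * α') (β' + 2 * α'), |deriv G u| ≤ M') :
    Summable (covTerm α β α' β' l F G) ∧
      |∑' k, covTerm α β α' β' l F G k| ≤ 2 * (α * M) * (α' * M') := by
  have hb : ∀ k, |covTerm α β α' β' l F G k|
      ≤ |k * chebCoeff α β F k| * |k * chebCoeff α' β' G k| := by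
    intro k
    have h1 : Real.exp (-l * k) ≤ 1 := by
      rw [Real.exp_le_one_iff]
      have : 0 ≤ l * k := by positivity
      linarith
    have h2 : (k : ℝ) ≤ k * k := by
      rcases Nat.eq_zero_or_pos k with rfl | hk
      · simp
      · have : (1 : ℝ) ≤ k := by exact_mod_cast hk
        nlinarith
    have h3 : (k : ℝ) * Real.exp (-l * k) ≤ k * k := by
      calc (k : ℝ) * Real.exp (-l * k) ≤ k * 1 := by gcongr
        _ ≤ _ := by linarith
    simp only [covTerm, abs_mul, Nat.abs_cast, Real.abs_exp]
    calc _ ≤ (k : ℝ) * k * |chebCoeff α β F k| * |chebCoeff α' β' G k| := by gcongr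
      _ = _ := by ring
  have hfin : ∀ S : Finset ℕ, ∑ k ∈ S, |covTerm α β α' β' l F G k|
      ≤ 2 * (α * M) * (α' * M') := by
    intro S
    have h1 := bessel_cheb α β hα hF hM S
    have h2 := bessel_cheb α' β' hα' hG hM' S
    rw [mul_assoc, ← mul_pow] at h1 h2
    have h3 := Real.sum_mul_le_sqrt_mul_sqrt S (fun k : ℕ => |k * chebCoeff α β F k|)
      (fun k : ℕ => |k * chebCoeff α' β' G k|)
    simp only [sq_abs] at h3
    have h4 : √(2 * (α * M) ^ 2) * √(2 * (α' * M') ^ 2) = 2 * (α * M) * (α' * M') := by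
      rw [← Real.sqrt_mul (by positivity), show 2 * (α * M) ^ 2 * (2 * (α' * M') ^ 2)
        = (2 * (α * M) * (α' * M')) ^ 2 by ring, Real.sqrt_sq (by positivity)]
    rw [← h4]
    exact (Finset.sum_le_sum fun k _ => hb k).trans (h3.trans (mul_le_mul
      (Real.sqrt_le_sqrt h1) (Real.sqrt_le_sqrt h2) (Real.sqrt_nonneg _) (Real.sqrt_nonneg _)))
  have hs : Summable fun k => |covTerm α β α' β' l F G k| :=
    summable_of_sum_le (fun k => abs_nonneg _) hfin
  refine ⟨hs.of_abs, ?_⟩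
  refine le_trans ?_ (hs.tsum_le_of_sum_le hfin)
  exact norm_tsum_le_tsum_norm (f := covTerm α β α' β' l F G) hs

lemma covTerm_sub (hF : Continuous F) (hG : Continuous G) {P Q : ℝ → ℝ} (hP : Continuous P)
    (hQ : Continuous Q) (k : ℕ) :
    covTerm α β α' β' l F G k - covTerm α β α' β' l P Q k
      = covTerm α β α' β' l (fun u => F u - P u) G k
        + covTerm α β α' β' l P (fun u => G u - Q u) k := by
  simp only [covTerm, chebCoeff_sub _ _ hF hP, chebCoeff_sub _ _ hG hQ]
  ring

end Cov

/-- For polynomials the covariance of the symbols is the limiting covariance. -/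
theorem symCov_eq_tsum {N : ℕ} (α β τ : Fin N → ℝ) (hτ : StrictMono τ) (q : Fin N → Polynomial ℝ)
    (r i : Fin N) :
    symCov (fun m => Polynomial.aeval (jacobiSymbol (α m) (β m) (τ m)) (q m)) r i
      = ∑' k, covTerm (α r) (β r) (α i) (β i) |τ r - τ i| (fun u => (q r).eval u)
          (fun u => (q i).eval u) k := by
  have main : ∀ r i : Fin N, r ≤ i →
      halfPairing (Polynomial.aeval (jacobiSymbol (α r) (β r) (τ r)) (q r))
        (Polynomial.aeval (jacobiSymbol (α i) (β i) (τ i)) (q i))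
      = ∑' k, covTerm (α r) (β r) (α i) (β i) |τ r - τ i| (fun u => (q r).eval u)
          (fun u => (q i).eval u) k := by
    intro r i hri
    obtain ⟨d, hd⟩ := exists_coeff_eq_zero (Polynomial.aeval (jacobiSymbol (α i) (β i) (τ i)) (q i))
    have hterm : ∀ k : ℕ, covTerm (α r) (β r) (α i) (β i) |τ r - τ i| (fun u => (q r).eval u)
          (fun u => (q i).eval u) k
        = k * ((Polynomial.aeval (jacobiSymbol (α r) (β r) (τ r)) (q r)).coeff (-k)
          * (Polynomial.aeval (jacobiSymbol (α i) (β i) (τ i)) (q i)).coeff k) := by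
      intro k
      rw [coeff_aeval_jacobiSymbol, coeff_aeval_jacobiSymbol, chebCoeff_neg, covTerm,
        abs_of_nonpos (sub_nonpos.2 (hτ.monotone hri))]
      have : Real.exp (- -(τ r - τ i) * k)
          = Real.exp (-τ r * ((-(k : ℤ) : ℤ) : ℝ)) * Real.exp (-τ i * ((k : ℤ) : ℝ)) := by
        rw [← Real.exp_add]
        push_cast
        ring_nf
      rw [this]
      ring
    rw [halfPairing_eq_sum _ _ d (fun k hk => hd k (hk.trans_le (le_abs_self k))),
      tsum_eq_sum (s := Finset.range (d + 1))]
    · exact Finset.sum_congr rfl fun k _ => (hterm k).symm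
    · intro k hk
      rw [hterm, hd k (by rw [Finset.mem_range] at hk; rw [Nat.abs_cast]; omega)]
      simp
  rcases le_total r i with h | h
  · rw [symCov, min_eq_left h, max_eq_right h]
    exact main r i h
  · rw [symCov, min_eq_right h, max_eq_left h]
    refine (main i r h).trans (tsum_congr fun k => ?_)
    rw [covTerm, covTerm, abs_sub_comm]
    ring

/-! ### The method of moments -/

/-- Taylor's formula for the exponential on the imaginary half-axes. -/
lemma norm_exp_sub_sum_le_pow {s : ℂ} (hs : s.re = 0) (hs1 : ‖s‖ ≤ 1) (n : ℕ) {x : ℝ}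
    (hx : 0 ≤ x) :
    ‖Complex.exp (s * x) - ∑ k ∈ Finset.range n, (s * x) ^ k / k.factorial‖
      ≤ x ^ n / n.factorial := by
  induction n generalizing x with
  | zero =>
    simp [Complex.norm_exp, hs]
  | succ n ih =>
    set f : ℝ → ℂ := fun x => Complex.exp (s * x)
      - ∑ k ∈ Finset.range (n + 1), (s * x) ^ k / k.factorial with hf
    set f' : ℝ → ℂ := fun x => s * (Complex.exp (s * x)
      - ∑ k ∈ Finset.range n, (s * x) ^ k / k.factorial) with hf'
    have hlin : ∀ x : ℝ, HasDerivAt (fun x : ℝ => s * (x : ℂ)) s x := by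
      intro x
      simpa using (Complex.ofRealCLM.hasDerivAt (x := x)).const_mul s
    have hd : ∀ x, HasDerivAt f (f' x) x := by
      intro x
      have h1 := (hlin x).cexp
      have h2 : HasDerivAt (fun x : ℝ => ∑ k ∈ Finset.range (n + 1), (s * x) ^ k / k.factorial)
          (∑ k ∈ Finset.range (n + 1), (k * (s * x) ^ (k - 1) * s) / k.factorial) x :=
        HasDerivAt.fun_sum fun k _ => ((hlin x).pow k).div_const _
      refine (h1.sub h2).congr_deriv ?_
      rw [Finset.sum_range_succ']
      simp only [hf', mul_sub, Finset.mul_sum]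
      have e : ∀ k : ℕ, ((k + 1 : ℕ) : ℂ) * (s * x) ^ (k + 1 - 1) * s / (k + 1).factorial
          = s * ((s * x) ^ k / k.factorial) := by
        intro k
        have h1 : ((k + 1 : ℕ) : ℂ) ≠ 0 := by exact_mod_cast Nat.succ_ne_zero k
        have h2 : (k.factorial : ℂ) ≠ 0 := by exact_mod_cast k.factorial_ne_zero
        rw [Nat.factorial_succ, Nat.add_sub_cancel, Nat.cast_mul]
        field_simp
      rw [Finset.sum_congr rfl fun k _ => e k]
      simp
      ring
    have hB : ∀ x : ℝ, HasDerivAt (fun x : ℝ => x ^ (n + 1) / (n + 1).factorial)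
        (x ^ n / n.factorial) x := by
      intro x
      refine ((hasDerivAt_pow (n + 1) x).div_const _).congr_deriv ?_
      rw [Nat.factorial_succ, Nat.add_sub_cancel, Nat.cast_mul]
      have h1 : ((n + 1 : ℕ) : ℝ) ≠ 0 := by positivity
      have h2 : (n.factorial : ℝ) ≠ 0 := by positivity
      field_simp
    refine image_norm_le_of_norm_deriv_right_le_deriv_boundary' (f := f) (f' := f') (a := 0) (b := x)
      (fun y _ => (hd y).continuousAt.continuousWithinAt) (fun y _ => (hd y).hasDerivWithinAt)
      (B := fun x : ℝ => x ^ (n + 1) / (n + 1).factorial) (B' := fun x => x ^ n / n.factorial)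
      ?_ (fun y _ => (hB y).continuousAt.continuousWithinAt) (fun y _ => (hB y).hasDerivWithinAt)
      (fun y hy => ?_) ⟨hx, le_rfl⟩
    · simp only [hf, Finset.sum_range_succ']
      simp
    · simp only [hf', norm_mul]
      calc _ ≤ 1 * (y ^ n / n.factorial) := by
            have := ih hy.1
            gcongr
        _ = _ := one_mul _

lemma norm_exp_I_sub_sum_le (n : ℕ) (u : ℝ) :
    ‖Complex.exp (u * Complex.I) - ∑ k ∈ Finset.range n, (u * Complex.I) ^ k / k.factorial‖
      ≤ |u| ^ n / n.factorial := by
  rcases le_total 0 u with h | h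
  · have := norm_exp_sub_sum_le_pow (s := Complex.I) (by simp) (by simp) n h
    rw [abs_of_nonneg h]
    simpa only [mul_comm] using this
  · have := norm_exp_sub_sum_le_pow (s := -Complex.I) (by simp) (by simp) n (neg_nonneg.2 h)
    rw [abs_of_nonpos h]
    have e : -Complex.I * ((-u : ℝ) : ℂ) = u * Complex.I := by push_cast; ring
    rwa [e] at this

/-- The moments of the centred Gaussian distribution of variance `v`. -/
noncomputable def gaussMoment (v : ℝ) : ℕ → ℝ
  | 0 => 1
  | 1 => 0
  | k + 2 => (k + 1) * v * gaussMoment v k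

lemma gaussMoment_odd (v : ℝ) (j : ℕ) : gaussMoment v (2 * j + 1) = 0 := by
  induction j with
  | zero => rfl
  | succ j ih =>
    rw [show 2 * (j + 1) + 1 = (2 * j + 1) + 2 by ring, gaussMoment, ih, mul_zero]

lemma gaussMoment_even (v : ℝ) (j : ℕ) :
    gaussMoment v (2 * j) / (2 * j).factorial = (v / 2) ^ j / j.factorial := by
  induction j with
  | zero => simp [gaussMoment]
  | succ j ih =>
    have h1 : ((2 * j).factorial : ℝ) ≠ 0 := by positivity
    have h2 : (j.factorial : ℝ) ≠ 0 := by positivity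
    rw [div_eq_div_iff h1 h2] at ih
    rw [show 2 * (j + 1) = 2 * j + 2 by ring, gaussMoment, Nat.factorial_succ, Nat.factorial_succ,
      Nat.factorial_succ j, div_eq_div_iff (by positivity) (by positivity)]
    push_cast
    rw [pow_succ]
    linear_combination ((2 * (j : ℝ) + 1) * v * (j + 1)) * ih

section Moments

variable {Ω : ℕ → Type*} [∀ n, MeasurableSpace (Ω n)] {P : ∀ n, Measure (Ω n)}
  [∀ n, IsProbabilityMeasure (P n)] {Y : ∀ n, Ω n → ℝ} {v : ℝ}

/-- For `K = 0` the truncated `K - 1` carries the factor `K`, so that the hypothesis says there that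
the means tend to zero. -/
lemma tendsto_gaussMoment
    (hrec : ∀ K : ℕ, Tendsto (fun n => ∫ ω, Y n ω ^ (K + 1) ∂P n
      - K * v * ∫ ω, Y n ω ^ (K - 1) ∂P n) atTop (𝓝 0)) (K : ℕ) :
    Tendsto (fun n => ∫ ω, Y n ω ^ K ∂P n) atTop (𝓝 (gaussMoment v K)) := by
  induction K using Nat.strong_induction_on with
  | _ K ih =>
    match K with
    | 0 => simp [gaussMoment]
    | 1 => simpa [gaussMoment] using hrec 0
    | K + 2 =>
      have h1 := (ih K (by omega)).const_mul ((K + 1 : ℝ) * v)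
      have h2 := (hrec (K + 1)).add h1
      rw [zero_add] at h2
      refine h2.congr fun n => ?_
      simp

/-- Random variables whose moments obey asymptotically the recursion of Gaussian moments have
asymptotically Gaussian characteristic functions. -/
theorem tendsto_charFun_of_moments
    (hint : ∀ K : ℕ, ∀ᶠ n in atTop, Integrable (fun ω => Y n ω ^ K) (P n))
    (hrec : ∀ K : ℕ, Tendsto (fun n => ∫ ω, Y n ω ^ (K + 1) ∂P n
      - K * v * ∫ ω, Y n ω ^ (K - 1) ∂P n) atTop (𝓝 0)) (t : ℝ) :
    Tendsto (fun n => ∫ ω, Complex.exp ((t * Y n ω : ℝ) * Complex.I) ∂P n) atTop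
      (𝓝 (Complex.exp ((-(v * t ^ 2 / 2) : ℝ)))) := by
  have hm := tendsto_gaussMoment hrec
  set x : ℝ := v * t ^ 2 / 2 with hx
  -- the Taylor polynomial has even degree bound, so that the remainder is an even moment
  set T : ℕ → ℕ → ℂ := fun J n => ∑ k ∈ Finset.range (2 * J),
    (t * Complex.I) ^ k / k.factorial * ((∫ ω, Y n ω ^ k ∂P n : ℝ) : ℂ) with hT
  have hTlim : ∀ J, Tendsto (T J) atTop
      (𝓝 (∑ j ∈ Finset.range J, ((-x : ℝ) : ℂ) ^ j / j.factorial)) := by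
    intro J
    have h1 : Tendsto (T J) atTop (𝓝 (∑ k ∈ Finset.range (2 * J),
        (t * Complex.I) ^ k / k.factorial * ((gaussMoment v k : ℝ) : ℂ))) :=
      tendsto_finsetSum _ fun k _ =>
        ((Complex.continuous_ofReal.tendsto _).comp (hm k)).const_mul _
    have h2 : ∑ k ∈ Finset.range (2 * J),
        (t * Complex.I) ^ k / k.factorial * ((gaussMoment v k : ℝ) : ℂ)
        = ∑ j ∈ Finset.range J, ((-x : ℝ) : ℂ) ^ j / j.factorial := by
      clear h1
      induction J with
      | zero => simp
      | succ J ih =>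
        rw [show 2 * (J + 1) = 2 * J + 1 + 1 by ring, Finset.sum_range_succ, Finset.sum_range_succ,
          ih, Finset.sum_range_succ, gaussMoment_odd]
        have e := congrArg (fun r : ℝ => (r : ℂ)) (gaussMoment_even v J)
        push_cast at e
        have e2 : ((t : ℂ) * Complex.I) ^ (2 * J) = (-(t : ℂ) ^ 2) ^ J := by
          rw [pow_mul, mul_pow, Complex.I_sq]; ring
        rw [e2, div_mul_eq_mul_div, mul_div_assoc, e, hx]
        push_cast
        rw [show -((v : ℂ) * t ^ 2 / 2) = (-(t : ℂ) ^ 2) * (v / 2) by ring, mul_zero,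
          add_zero, mul_pow _ _ J, mul_div_assoc]
    rwa [h2] at h1
  have hexp : Tendsto (fun J => ∑ j ∈ Finset.range J, ((-x : ℝ) : ℂ) ^ j / j.factorial) atTop
      (𝓝 (Complex.exp ((-x : ℝ)))) := by
    have := (NormedSpace.expSeries_div_hasSum_exp ((-x : ℝ) : ℂ)).tendsto_sum_nat
    rwa [← Complex.exp_eq_exp_ℂ] at this
  have hfac : Tendsto (fun J : ℕ => x ^ J / J.factorial) atTop (𝓝 0) :=
    FloorSemiring.tendsto_pow_div_factorial_atTop x
  have herr : ∀ J, ∀ᶠ n in atTop, ‖(∫ ω, Complex.exp ((t * Y n ω : ℝ) * Complex.I) ∂P n) - T J n‖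
      ≤ t ^ (2 * J) / (2 * J).factorial * ∫ ω, Y n ω ^ (2 * J) ∂P n := by
    intro J
    have hall : ∀ᶠ n in atTop, ∀ k ∈ Finset.range (2 * J + 1),
        Integrable (fun ω => Y n ω ^ k) (P n) := by
      rw [Filter.eventually_all_finset]
      exact fun k _ => hint k
    filter_upwards [hall, hint 1] with n hn hn1
    have hae : AEStronglyMeasurable (Y n) (P n) := by
      simpa using hn1.aestronglyMeasurable
    have hI1 : Integrable (fun ω => Complex.exp ((t * Y n ω : ℝ) * Complex.I)) (P n) := by
      refine Integrable.of_bound (C := 1) ?_ (.of_forall fun ω => ?_)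
      · exact (Continuous.comp_aestronglyMeasurable
          (g := fun y : ℝ => Complex.exp ((t * y : ℝ) * Complex.I)) (by fun_prop) hae)
      · rw [Complex.norm_exp_ofReal_mul_I]
    have hI2 : ∀ k ∈ Finset.range (2 * J), Integrable (fun ω =>
        (t * Complex.I) ^ k / k.factorial * ((Y n ω ^ k : ℝ) : ℂ)) (P n) := fun k hk =>
      ((hn k (Finset.mem_range.2 (by rw [Finset.mem_range] at hk; omega))).ofReal).const_mul _
    have hTeq : T J n = ∫ ω, ∑ k ∈ Finset.range (2 * J),
        (t * Complex.I) ^ k / k.factorial * ((Y n ω ^ k : ℝ) : ℂ) ∂P n := by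
      rw [integral_finsetSum _ hI2]
      refine Finset.sum_congr rfl fun k _ => ?_
      rw [integral_const_mul, integral_complex_ofReal]
    rw [hTeq, ← integral_sub hI1 (integrable_finsetSum _ hI2), ← integral_const_mul]
    refine norm_integral_le_of_norm_le ((hn (2 * J) (by simp)).const_mul _) (.of_forall fun ω => ?_)
    have := norm_exp_I_sub_sum_le (2 * J) (t * Y n ω)
    rw [abs_mul, mul_pow, pow_mul |t|, pow_mul |Y n ω|, sq_abs, sq_abs, ← pow_mul, ← pow_mul] at this
    refine le_trans (le_of_eq ?_) (this.trans (le_of_eq (by ring)))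
    congr 2
    refine Finset.sum_congr rfl fun k _ => ?_
    push_cast
    ring
  have hbound : ∀ J, Tendsto (fun n => t ^ (2 * J) / (2 * J).factorial
      * ∫ ω, Y n ω ^ (2 * J) ∂P n) atTop (𝓝 (x ^ J / J.factorial)) := by
    intro J
    have h1 := (hm (2 * J)).const_mul (t ^ (2 * J) / (2 * J).factorial : ℝ)
    have e : t ^ (2 * J) / (2 * J).factorial * gaussMoment v (2 * J) = x ^ J / J.factorial := by
      rw [div_mul_eq_mul_div, mul_div_assoc, gaussMoment_even, hx, pow_mul,
        show v * t ^ 2 / 2 = t ^ 2 * (v / 2) by ring, mul_pow]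
      ring
    rwa [e] at h1
  rw [Metric.tendsto_nhds]
  intro ε hε
  obtain ⟨J, hJ1, hJ2⟩ := ((hfac.eventually_lt_const (show (0 : ℝ) < ε / 3 by positivity)).and
    (Metric.tendsto_nhds.1 hexp (ε / 3) (by positivity))).exists
  filter_upwards [herr J, (hbound J).eventually_lt_const hJ1,
    Metric.tendsto_nhds.1 (hTlim J) (ε / 3) (by positivity)] with n h1 h2 h3
  have h4 := dist_triangle4 (∫ ω, Complex.exp ((t * Y n ω : ℝ) * Complex.I) ∂P n) (T J n)
    (∑ j ∈ Finset.range J, ((-x : ℝ) : ℂ) ^ j / j.factorial) (Complex.exp ((-x : ℝ)))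
  rw [dist_eq_norm _ (T J n)] at h4
  linarith

end Moments

section Approximation

variable {Ω : Type*} [MeasurableSpace Ω] {P : Measure Ω} [IsProbabilityMeasure P]

lemma norm_integral_exp_sub_le {X Y : Ω → ℝ} (hX : AEStronglyMeasurable X P)
    (hY : AEStronglyMeasurable Y P) (h : Integrable (fun ω => X ω - Y ω) P) (t : ℝ) :
    ‖(∫ ω, Complex.exp ((t * X ω : ℝ) * Complex.I) ∂P)
      - ∫ ω, Complex.exp ((t * Y ω : ℝ) * Complex.I) ∂P‖ ≤ |t| * ∫ ω, |X ω - Y ω| ∂P := by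
  have hI : ∀ Z : Ω → ℝ, AEStronglyMeasurable Z P →
      Integrable (fun ω => Complex.exp ((t * Z ω : ℝ) * Complex.I)) P := by
    intro Z hZ
    refine Integrable.of_bound (C := 1) ?_ (.of_forall fun ω => ?_)
    · exact (Continuous.comp_aestronglyMeasurable
        (g := fun y : ℝ => Complex.exp ((t * y : ℝ) * Complex.I)) (by fun_prop) hZ)
    · rw [Complex.norm_exp_ofReal_mul_I]
  rw [← integral_sub (hI X hX) (hI Y hY), ← integral_const_mul]
  refine norm_integral_le_of_norm_le (h.abs.const_mul _) (.of_forall fun ω => ?_)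
  have h1 := norm_exp_I_sub_sum_le 1 (t * (X ω - Y ω))
  have e : Complex.exp ((t * X ω : ℝ) * Complex.I) - Complex.exp ((t * Y ω : ℝ) * Complex.I)
      = Complex.exp ((t * Y ω : ℝ) * Complex.I)
        * (Complex.exp ((t * (X ω - Y ω) : ℝ) * Complex.I) - 1) := by
    rw [mul_sub, ← Complex.exp_add, mul_one]
    congr 2
    push_cast
    ring
  rw [e, norm_mul, Complex.norm_exp_ofReal_mul_I, one_mul, ← abs_mul]
  simpa using h1

end Approximation

/-- Random variables that can be approximated in `L¹`, arbitrarily well, by asymptotically Gaussian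
ones are asymptotically Gaussian. -/
theorem tendsto_charFun_of_approx {Ω : ℕ → Type*} [∀ n, MeasurableSpace (Ω n)]
    {P : ∀ n, Measure (Ω n)} [∀ n, IsProbabilityMeasure (P n)] {X : ∀ n, Ω n → ℝ} {v : ℝ}
    (hX : ∀ n, AEStronglyMeasurable (X n) (P n))
    (happ : ∀ ε > 0, ∃ (Y : ∀ n, Ω n → ℝ) (v' : ℝ), |v' - v| ≤ ε ∧
      (∀ n, AEStronglyMeasurable (Y n) (P n)) ∧
      (∀ᶠ n in atTop, Integrable (fun ω => X n ω - Y n ω) (P n) ∧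
        ∫ ω, |X n ω - Y n ω| ∂P n ≤ ε) ∧
      ∀ t : ℝ, Tendsto (fun n => ∫ ω, Complex.exp ((t * Y n ω : ℝ) * Complex.I) ∂P n) atTop
        (𝓝 (Complex.exp ((-(v' * t ^ 2 / 2) : ℝ))))) (t : ℝ) :
    Tendsto (fun n => ∫ ω, Complex.exp ((t * X n ω : ℝ) * Complex.I) ∂P n) atTop
      (𝓝 (Complex.exp ((-(v * t ^ 2 / 2) : ℝ)))) := by
  rw [Metric.tendsto_nhds]
  intro ε hε
  have hcont : ContinuousAt (fun v' : ℝ => Complex.exp ((-(v' * t ^ 2 / 2) : ℝ))) v := by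
    fun_prop
  obtain ⟨δ, hδ, hδ'⟩ := Metric.continuousAt_iff.1 hcont (ε / 3) (by positivity)
  obtain ⟨Y, v', hv, hY, hXY, hlim⟩ := happ (min (δ / 2) (ε / (3 * (|t| + 1))))
    (by positivity)
  filter_upwards [hXY, Metric.tendsto_nhds.1 (hlim t) (ε / 3) (by positivity)] with n h1 h2
  have h3 := norm_integral_exp_sub_le (hX n) (hY n) h1.1 t
  have h4 : |t| * ∫ ω, |X n ω - Y n ω| ∂P n ≤ ε / 3 := by
    calc _ ≤ (|t| + 1) * (ε / (3 * (|t| + 1))) := by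
          gcongr
          · linarith
          · exact h1.2.trans (min_le_right _ _)
      _ = _ := by field_simp
  have h5 := hδ' (x := v') (by
    rw [Real.dist_eq]
    exact (hv.trans (min_le_left _ _)).trans_lt (by linarith))
  have h6 := dist_triangle4 (∫ ω, Complex.exp ((t * X n ω : ℝ) * Complex.I) ∂P n)
    (∫ ω, Complex.exp ((t * Y n ω : ℝ) * Complex.I) ∂P n)
    (Complex.exp ((-(v' * t ^ 2 / 2) : ℝ))) (Complex.exp ((-(v * t ^ 2 / 2) : ℝ)))
  rw [← dist_eq_norm] at h3
  linarith

/-- Lévy's continuity theorem for a centred Gaussian limit. -/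
theorem tendstoInDistribution_gaussian {Ω : ℕ → Type*} [∀ n, MeasurableSpace (Ω n)]
    {P : ∀ n, Measure (Ω n)} [∀ n, IsProbabilityMeasure (P n)] {X : ∀ n, Ω n → ℝ} {v : ℝ}
    (hv : 0 ≤ v) (hX : ∀ n, AEMeasurable (X n) (P n))
    (h : ∀ t : ℝ, Tendsto (fun n => ∫ ω, Complex.exp ((t * X n ω : ℝ) * Complex.I) ∂P n) atTop
      (𝓝 (Complex.exp ((-(v * t ^ 2 / 2) : ℝ))))) :
    TendstoInDistribution X atTop (id : ℝ → ℝ) P (gaussianReal 0 v.toNNReal) where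
  forall_aemeasurable := hX
  aemeasurable_limit := aemeasurable_id
  tendsto := by
    refine ProbabilityMeasure.tendsto_of_tendsto_charFun ?_
    intro t
    have e1 : charFun (Measure.map id (gaussianReal 0 v.toNNReal)) t
        = Complex.exp ((-(v * t ^ 2 / 2) : ℝ)) := by
      rw [Measure.map_id, charFun_gaussianReal]
      congr 1
      have : ((v.toNNReal : ℝ) : ℂ) = v := by rw [Real.coe_toNNReal v hv]
      rw [show ((v.toNNReal : NNReal) : ℂ) = ((v.toNNReal : ℝ) : ℂ) from rfl, this]
      push_cast
      ring
    have e2 : ∀ n, charFun (Measure.map (X n) (P n)) t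
        = ∫ ω, Complex.exp ((t * X n ω : ℝ) * Complex.I) ∂P n := by
      intro n
      rw [charFun_apply_real, integral_map (hX n) (by fun_prop)]
      simp
    simp only [ProbabilityMeasure.coe_mk, e1, e2]
    exact h t

/-! ### Diagonal entries and one-point functions -/

section Ensemble

variable {N n : ℕ} (E : ExtendedEnsemble N n) (a b : Fin N → ℕ → ℝ)
    (hab : ∀ m : Fin N, IsRecurrence (E.ν m.succ) (E.w m.succ) (E.p m.succ) (a m) (b m))
include hab

/-- Integrals of polynomials in `ν` against the squared orthonormal functions. -/
lemma hasSum_eval_mul_rho_sq (m : Fin N) (q : Polynomial ℝ) {i : ℕ}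
    (hi : (i : ℕ∞) < numSupp E m.succ) :
    HasSum (fun y => q.eval (E.ν m.succ y) * (rho E m.succ i y * rho E m.succ i y))
      (ent (Polynomial.aeval (jacobi (a m) (b m) (E.c m.succ)) q) i i) := by
  set A := Polynomial.aeval (jacobi (a m) (b m) (E.c m.succ)) q with hA
  set v := A (Finsupp.single i 1) with hv
  have hc := (E.c_pos m.succ i hi).ne'
  have hsum : HasSum (fun y => ∑ k ∈ v.support, E.c m.succ i * v k / E.c m.succ k
      * (rho E m.succ k y * rho E m.succ i y))
      (∑ k ∈ v.support, E.c m.succ i * v k / E.c m.succ k * (if k = i then 1 else 0)) := by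
    refine hasSum_sum fun k _ => ?_
    rcases lt_or_ge (k : ℕ∞) (numSupp E m.succ) with hk | hk
    · exact (hasSum_rho_mul_rho E m.succ hk hi).mul_left _
    · have : k ≠ i := by
        rintro rfl
        exact absurd hi (not_lt.2 hk)
      simp [rho_eq_zero E m.succ hk, this]
  have e : ∑ k ∈ v.support, E.c m.succ i * v k / E.c m.succ k * (if k = i then 1 else 0)
      = ent A i i := by
    simp only [mul_ite, mul_one, mul_zero, Finset.sum_ite_eq']
    rw [ent, ← hv]
    by_cases h : v i = 0
    · simp [h]
    · rw [if_pos (Finsupp.mem_support_iff.2 h)]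
      field_simp
  rw [e] at hsum
  refine hsum.congr_fun fun y => ?_
  have h1 := evalVec_aeval_jacobi E (hab m) q y (Finsupp.single i 1)
  rw [← hA, ← hv, evalVec_single, evalVec_apply] at h1
  have h2 : q.eval (E.ν m.succ y) * rho E m.succ i y
      = E.c m.succ i * ∑ k ∈ v.support, v k * (rho E m.succ k y / E.c m.succ k) := by
    rw [h1]
    field_simp
  rw [← mul_assoc, h2, Finset.mul_sum, Finset.sum_mul]
  exact Finset.sum_congr rfl fun k _ => by ring

lemma summable_sq_of_le_eval (m : Fin N) (q : Polynomial ℝ) {i : ℕ}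
    (hi : (i : ℕ∞) < numSupp E m.succ) {g : ℤ → ℝ} (hg : ∀ y, |g y| ≤ |q.eval (E.ν m.succ y)|) :
    Summable fun y => (g y * rho E m.succ i y) ^ 2 := by
  refine Summable.of_nonneg_of_le (fun y => sq_nonneg _) (fun y => ?_)
    (hasSum_eval_mul_rho_sq E a b hab m (q ^ 2) hi).summable
  rw [mul_pow, Polynomial.eval_pow, ← sq]
  exact mul_le_mul_of_nonneg_right (sq_le_sq.2 (hg y)) (sq_nonneg _)

variable (hS : ∀ m : Fin N, (n : ℕ∞) ≤ numSupp E m.succ)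
include hS

omit hab in
lemma lt_numSupp_of_fin (m : Fin N) (i : Fin n) : ((i : ℕ) : ℕ∞) < numSupp E m.succ :=
  lt_of_lt_of_le (by exact_mod_cast i.2) (hS m)

/-- The expectation of a polynomial statistic is the trace on the first `n` basis vectors. -/
lemma integral_stat_eval (m : Fin N) (q : Polynomial ℝ) :
    MemLp (fun y : Config N n => stat (fun z => q.eval (E.ν m.succ z)) (y m.succ)) 2 E.law ∧
    ∫ y : Config N n, stat (fun z => q.eval (E.ν m.succ z)) (y m.succ) ∂E.law
      = ptr n (Polynomial.aeval (jacobi (a m) (b m) (E.c m.succ)) q) := by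
  have h := integral_stat E a b hab hS m (fun z => q.eval (E.ν m.succ z)) fun i =>
    summable_sq_of_le_eval E a b hab m q (lt_numSupp_of_fin E hS m i) fun y => le_rfl
  refine ⟨h.1, h.2.1.trans ?_⟩
  rw [ptr]
  refine Finset.sum_congr rfl fun k _ => ?_
  exact (hasSum_eval_mul_rho_sq E a b hab m q (lt_numSupp_of_fin E hS m k)).tsum_eq

/-- The mass of a single squared orthonormal function is dominated by the expected statistic. -/
lemma tsum_mul_rho_sq_le (m : Fin N) (q : Polynomial ℝ) {g : ℤ → ℝ} (hg0 : ∀ y, 0 ≤ g y)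
    (hg : ∀ y, |g y| ≤ |q.eval (E.ν m.succ y)|) (i : Fin n) :
    Summable (fun y => g y * (rho E m.succ i y * rho E m.succ i y)) ∧
    ∑' y, g y * (rho E m.succ i y * rho E m.succ i y)
      ≤ ∫ y : Config N n, stat g (y m.succ) ∂E.law := by
  have hsq : ∀ i : Fin n, Summable fun y => (g y * rho E m.succ i y) ^ 2 := fun i =>
    summable_sq_of_le_eval E a b hab m q (lt_numSupp_of_fin E hS m i) hg
  have h := (integral_stat E a b hab hS m g hsq).2.1
  refine ⟨(hasSum_gMat (e := fun k : Fin n => rho E m.succ k)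
    (orthonormal_rho E m.succ (hS m)) hsq i i).summable, ?_⟩
  rw [h]
  exact Finset.single_le_sum (f := fun k : Fin n => gMat (fun k : Fin n => rho E m.succ k) g k k)
    (fun k _ => tsum_nonneg fun y => mul_nonneg (hg0 y) (mul_self_nonneg _)) (Finset.mem_univ i)

end Ensemble

/-! ### Tail estimates -/

lemma tendsto_integral_of_lintegral {Ω : ℕ → Type*} [∀ n, MeasurableSpace (Ω n)]
    {P : ∀ n, Measure (Ω n)} {f g : ∀ n, Ω n → ℝ}
    (hm : ∀ n, AEStronglyMeasurable (f n) (P n)) (h0 : ∀ n ω, 0 ≤ f n ω)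
    (hfg : ∀ n ω, f n ω ≤ g n ω)
    (h : Tendsto (fun n : ℕ => (n : ENNReal) * ∫⁻ ω, ENNReal.ofReal (g n ω) ∂P n) atTop (𝓝 0)) :
    (∀ᶠ n in atTop, Integrable (f n) (P n)) ∧ Tendsto (fun n => ∫ ω, f n ω ∂P n) atTop (𝓝 0) := by
  have h1 : Tendsto (fun n => ∫⁻ ω, ENNReal.ofReal (f n ω) ∂P n) atTop (𝓝 0) := by
    refine tendsto_of_tendsto_of_tendsto_of_le_of_le' tendsto_const_nhds h
      (.of_forall fun n => zero_le) ?_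
    filter_upwards [eventually_ge_atTop 1] with n hn
    calc _ ≤ ∫⁻ ω, ENNReal.ofReal (g n ω) ∂P n :=
          lintegral_mono fun ω => ENNReal.ofReal_le_ofReal (hfg n ω)
      _ = 1 * ∫⁻ ω, ENNReal.ofReal (g n ω) ∂P n := (one_mul _).symm
      _ ≤ _ := by gcongr; exact_mod_cast hn
  constructor
  · filter_upwards [h1.eventually_lt_const ENNReal.zero_lt_top] with n hn
    exact ⟨hm n, (hasFiniteIntegral_iff_ofReal (.of_forall (h0 n))).2 hn⟩
  · have h2 := (ENNReal.tendsto_toReal ENNReal.zero_ne_top).comp h1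
    rw [ENNReal.toReal_zero] at h2
    refine h2.congr fun n => ?_
    rw [integral_eq_lintegral_of_nonneg_ae (.of_forall (h0 n)) (hm n)]
    rfl

lemma stat_mono {n : ℕ} {g h : ℤ → ℝ} (hgh : ∀ y, g y ≤ h y) (x : Fin n → ℤ) :
    stat g x ≤ stat h x := Finset.sum_le_sum fun _ _ => hgh _

lemma stat_nonneg {n : ℕ} {g : ℤ → ℝ} (hg : ∀ y, 0 ≤ g y) (x : Fin n → ℤ) : 0 ≤ stat g x :=
  Finset.sum_nonneg fun _ _ => hg _

section Tail

variable {N : ℕ} (E : ∀ n : ℕ, ExtendedEnsemble N n) (μ : Fin N → ℝ → ℝ) (K : Fin N → Set ℝ)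
    (hKmoment : ∀ k : ℕ, Tendsto (fun n : ℕ => (n : ENNReal) *
      ∫⁻ y, ENNReal.ofReal (outerMoment (E n) K k y) ∂(E n).law) atTop (𝓝 0))
    (hKmoment' : ∀ k : ℕ, Tendsto (fun n : ℕ => (n : ENNReal) *
      ∫⁻ y, ENNReal.ofReal (linStat
        (fun m => Set.indicator (K m)ᶜ fun x => |μ m x| ^ k) y) ∂(E n).law) atTop (𝓝 0))

include hKmoment in
lemma tail_nu (m : Fin N) (k : ℕ) :
    (∀ᶠ n in atTop, Integrable (fun y : Config N n =>
      stat ((lattice n (K m))ᶜ.indicator fun z => |(E n).ν m.succ z| ^ k) (y m.succ)) (E n).law) ∧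
    Tendsto (fun n => ∫ y : Config N n,
      stat ((lattice n (K m))ᶜ.indicator fun z => |(E n).ν m.succ z| ^ k) (y m.succ) ∂(E n).law)
      atTop (𝓝 0) := by
  refine tendsto_integral_of_lintegral (fun n => Measurable.of_discrete.aestronglyMeasurable)
    (fun n y => stat_nonneg (fun z => Set.indicator_nonneg (fun z _ => by positivity) z) _)
    (fun n y => ?_) (hKmoment k)
  rw [outerMoment]
  exact Finset.single_le_sum (f := fun m : Fin N => ∑ j : Fin n,
    Set.indicator {z : ℤ | (z : ℝ) / n ∉ K m} (fun z => |(E n).ν m.succ z| ^ k) (y m.succ j))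
    (fun i _ => Finset.sum_nonneg fun _ _ => Set.indicator_nonneg (fun z _ => by positivity) _)
    (Finset.mem_univ m)

include hKmoment' in
lemma tail_mu (m : Fin N) (k : ℕ) :
    (∀ᶠ n in atTop, Integrable (fun y : Config N n =>
      stat ((lattice n (K m))ᶜ.indicator fun z => |μ m ((z : ℝ) / n)| ^ k) (y m.succ)) (E n).law) ∧
    Tendsto (fun n => ∫ y : Config N n,
      stat ((lattice n (K m))ᶜ.indicator fun z => |μ m ((z : ℝ) / n)| ^ k) (y m.succ) ∂(E n).law)
      atTop (𝓝 0) := by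
  refine tendsto_integral_of_lintegral (fun n => Measurable.of_discrete.aestronglyMeasurable)
    (fun n y => stat_nonneg (fun z => Set.indicator_nonneg (fun z _ => by positivity) z) _)
    (fun n y => ?_) (hKmoment' k)
  rw [linStat]
  exact Finset.single_le_sum (f := fun m : Fin N => ∑ j : Fin n,
    Set.indicator (K m)ᶜ (fun x => |μ m x| ^ k) ((y m.succ j : ℝ) / n))
    (fun i _ => Finset.sum_nonneg fun _ _ => Set.indicator_nonneg (fun z _ => by positivity) _)
    (Finset.mem_univ m)

lemma eventually_integrable_stat_comb {J : ℕ} (c : ℕ → ℝ) {h : ℕ → ℕ → ℤ → ℝ} (m : Fin N)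
    (hh : ∀ k, (∀ᶠ n in atTop, Integrable (fun y : Config N n =>
        stat ((lattice n (K m))ᶜ.indicator (h n k)) (y m.succ)) (E n).law) ∧
      Tendsto (fun n => ∫ y : Config N n,
        stat ((lattice n (K m))ᶜ.indicator (h n k)) (y m.succ) ∂(E n).law) atTop (𝓝 0)) :
    (∀ᶠ n in atTop, Integrable (fun y : Config N n =>
        stat ((lattice n (K m))ᶜ.indicator fun z => ∑ k ∈ Finset.range J, c k * h n k z) (y m.succ))
        (E n).law) ∧
      Tendsto (fun n => ∫ y : Config N n,
        stat ((lattice n (K m))ᶜ.indicator fun z => ∑ k ∈ Finset.range J, c k * h n k z) (y m.succ)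
          ∂(E n).law) atTop (𝓝 0) := by
  have e : ∀ n (x : Fin n → ℤ),
      stat ((lattice n (K m))ᶜ.indicator fun z => ∑ k ∈ Finset.range J, c k * h n k z) x
      = ∑ k ∈ Finset.range J, c k * stat ((lattice n (K m))ᶜ.indicator (h n k)) x := by
    intro n x
    simp only [stat, Finset.mul_sum]
    rw [Finset.sum_comm]
    refine Finset.sum_congr rfl fun j _ => ?_
    by_cases hj : x j ∈ (lattice n (K m))ᶜ
    · simp [Set.indicator_of_mem hj]
    · simp [Set.indicator_of_notMem hj]
  simp only [e]
  have hall : ∀ᶠ n in atTop, ∀ k ∈ Finset.range J, Integrable (fun y : Config N n =>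
      c k * stat ((lattice n (K m))ᶜ.indicator (h n k)) (y m.succ)) (E n).law := by
    rw [Filter.eventually_all_finset]
    exact fun k _ => (hh k).1.mono fun n hn => hn.const_mul _
  refine ⟨hall.mono fun n hn => integrable_finsetSum _ hn, ?_⟩
  have h1 : Tendsto (fun n => ∑ k ∈ Finset.range J, c k * ∫ y : Config N n,
      stat ((lattice n (K m))ᶜ.indicator (h n k)) (y m.succ) ∂(E n).law) atTop
      (𝓝 (∑ k ∈ Finset.range J, c k * 0)) :=
    tendsto_finsetSum _ fun k _ => (hh k).2.const_mul _
  simp only [mul_zero, Finset.sum_const_zero] at h1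
  refine h1.congr' ?_
  filter_upwards [hall] with n hn
  rw [integral_finsetSum _ hn]
  exact Finset.sum_congr rfl fun k _ => (integral_const_mul _ _).symm

lemma abs_eval_le_sum (q : Polynomial ℝ) (u : ℝ) :
    |q.eval u| ≤ ∑ k ∈ Finset.range (q.natDegree + 1), |q.coeff k| * |u| ^ k := by
  rw [Polynomial.eval_eq_sum_range]
  refine (Finset.abs_sum_le_sum_abs _ _).trans (le_of_eq ?_)
  exact Finset.sum_congr rfl fun k _ => by rw [abs_mul, abs_pow]

include hKmoment in
/-- The contribution of the points outside `K` to a polynomial statistic is negligible. -/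
lemma tail_eval (m : Fin N) (q : Polynomial ℝ) :
    (∀ᶠ n in atTop, Integrable (fun y : Config N n =>
      stat ((lattice n (K m))ᶜ.indicator fun z => |q.eval ((E n).ν m.succ z)|) (y m.succ))
        (E n).law) ∧
    Tendsto (fun n => ∫ y : Config N n,
      stat ((lattice n (K m))ᶜ.indicator fun z => |q.eval ((E n).ν m.succ z)|) (y m.succ)
        ∂(E n).law) atTop (𝓝 0) := by
  obtain ⟨h1, h2⟩ := eventually_integrable_stat_comb E K (J := q.natDegree + 1)
    (fun k => |q.coeff k|) m (h := fun n k z => |(E n).ν m.succ z| ^ k) fun k =>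
      tail_nu E K hKmoment m k
  have hle : ∀ n (y : Config N n),
      stat ((lattice n (K m))ᶜ.indicator fun z => |q.eval ((E n).ν m.succ z)|) (y m.succ)
      ≤ stat ((lattice n (K m))ᶜ.indicator fun z => ∑ k ∈ Finset.range (q.natDegree + 1),
        |q.coeff k| * |(E n).ν m.succ z| ^ k) (y m.succ) := fun n y =>
    stat_mono (fun z => Set.indicator_le_indicator (abs_eval_le_sum q _)) _
  have h0 : ∀ n (y : Config N n),
      0 ≤ stat ((lattice n (K m))ᶜ.indicator fun z => |q.eval ((E n).ν m.succ z)|) (y m.succ) :=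
    fun n y => stat_nonneg (fun z => Set.indicator_nonneg (fun z _ => abs_nonneg _) z) _
  have hint := h1.mono fun n hn => hn.mono' (Measurable.of_discrete.aestronglyMeasurable)
    (.of_forall fun y => by rw [Real.norm_of_nonneg (h0 n y)]; exact hle n y)
  refine ⟨hint, tendsto_of_tendsto_of_tendsto_of_le_of_le' tendsto_const_nhds h2
    (.of_forall fun n => integral_nonneg (h0 n)) ?_⟩
  filter_upwards [h1, hint] with n hn hn'
  exact integral_mono hn' hn (hle n)

end Tail

/-! ### The limiting interval is contained in the image of `K` -/

section Inclusion

variable {N : ℕ} (E : ∀ n : ℕ, ExtendedEnsemble N n) (a b : ℕ → Fin N → ℕ → ℝ)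
    (hab : ∀ n m, IsRecurrence ((E n).ν m.succ) ((E n).w m.succ) ((E n).p m.succ)
      (a n m) (b n m))
    (μ : Fin N → ℝ → ℝ) (K : Fin N → Set ℝ)
    (hKcompact : ∀ m, IsCompact (μ m '' K m))
    (hKmoment : ∀ k : ℕ, Tendsto (fun n : ℕ => (n : ENNReal) *
      ∫⁻ y, ENNReal.ofReal (outerMoment (E n) K k y) ∂(E n).law) atTop (𝓝 0))
    (hsup : ∀ m, Tendsto (fun n : ℕ => ⨆ y ∈ lattice n (K m),
      ENNReal.ofReal |(E n).ν m.succ y - μ m ((y : ℝ) / n)|) atTop (𝓝 0))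
    (α β τ : Fin N → ℝ) (hα : ∀ m, 0 < α m)
    (ha : ∀ m (j : ℤ), Tendsto (fun n : ℕ => a n m ((n : ℤ) + j).toNat) atTop (𝓝 (α m)))
    (hb : ∀ m (j : ℤ), Tendsto (fun n : ℕ => b n m ((n : ℤ) + j).toNat) atTop (𝓝 (β m)))
    (hc : ∀ (m : Fin N) (k l : ℤ), Tendsto (fun n : ℕ =>
      (E n).c m.succ ((n : ℤ) + k).toNat / (E n).c m.succ ((n : ℤ) + l).toNat) atTop
      (𝓝 (Real.exp (τ m * (l - k)))))

include hsup in
lemma eventually_abs_nu_sub_le (m : Fin N) {s : ℝ} (hs : 0 < s) :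
    ∀ᶠ n : ℕ in atTop, ∀ y ∈ lattice n (K m), |(E n).ν m.succ y - μ m ((y : ℝ) / n)| ≤ s := by
  filter_upwards [(hsup m).eventually_lt_const (ENNReal.ofReal_pos.2 hs)] with n hn y hy
  have h1 := (le_iSup₂ (f := fun y (_ : y ∈ lattice n (K m)) =>
    ENNReal.ofReal |(E n).ν m.succ y - μ m ((y : ℝ) / n)|) y hy).trans hn.le
  exact (ENNReal.ofReal_le_ofReal_iff hs.le).1 h1

include ha hb hc in
/-- The squared orthonormal functions `r_{n-1}²` converge to the arcsine law of the limiting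
recurrence coefficients. -/
lemma tendsto_integral_eval_rho_sq (m : Fin N) (q : Polynomial ℝ) :
    Tendsto (fun n => ent (Polynomial.aeval (jacobi (a n m) (b n m) ((E n).c m.succ)) q)
      (n - 1) (n - 1)) atTop (𝓝 (chebCoeff (α m) (β m) (fun u => q.eval u) 0)) := by
  have h := (hasSymbol_multOp E a b α β τ ha hb hc (fun _ => q) m).2 (-1) (-1)
  rw [sub_self, coeff_aeval_jacobiSymbol] at h
  simp only [Int.cast_zero, mul_zero, Real.exp_zero, one_mul] at h
  refine h.congr fun n => ?_
  rw [show ((n : ℤ) + -1).toNat = n - 1 by omega]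
  rfl

include hab hKcompact hKmoment hsup hα ha hb hc in
/-- By the recurrence, the probability measures `r_{n-1}² w` have the arcsine law on the limiting
interval as their limit in the sense of polynomial moments. That law charges every neighbourhood of
every point of the interval, whereas `r_{n-1}² w` has asymptotically no mass away from `μ(K)`. -/
theorem Icc_subset_image (m : Fin N) :
    Set.Icc (β m - 2 * α m) (β m + 2 * α m) ⊆ μ m '' K m := by
  intro u₀ hu₀
  by_contra hu
  obtain ⟨r, hr, hball⟩ := Metric.isOpen_iff.1 (hKcompact m).isClosed.isOpen_compl u₀ hu
  set δ := r / 2 with hδ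
  have hδ0 : 0 < δ := by positivity
  -- a bump around `u₀` that vanishes at distance at most `δ` from `μ(K)`
  set F : ℝ → ℝ := fun u => max 0 (δ - |u - u₀|) with hF
  have hFc : Continuous F := by fun_prop
  have hF0 : ∀ u, 0 ≤ F u := fun u => le_max_left _ _
  have hFK : ∀ u, ∀ v ∈ μ m '' K m, |u - v| ≤ δ → F u = 0 := by
    intro u v hv huv
    refine max_eq_left ?_
    have h1 : r ≤ |v - u₀| := by
      by_contra! h
      exact hball (Metric.mem_ball.2 h) hv
    have h2 : |v - u₀| ≤ |u - v| + |u - u₀| := by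
      have := abs_sub_le v u u₀
      rwa [abs_sub_comm v u] at this
    linarith
  -- the limit law charges every neighbourhood of `u₀`
  have hpos : 0 < chebCoeff (α m) (β m) F 0 := by
    have hα' := hα m
    set x := (u₀ - β m) / (2 * α m) with hx
    have hx1 : -1 ≤ x := by rw [hx, le_div_iff₀ (by positivity)]; linarith [hu₀.1]
    have hx2 : x ≤ 1 := by rw [hx, div_le_iff₀ (by positivity)]; linarith [hu₀.2]
    have hval : β m + 2 * α m * Real.cos (Real.arccos x) = u₀ := by
      rw [Real.cos_arccos hx1 hx2, hx]
      field_simp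
      ring
    rw [chebCoeff]
    have : 0 < ∫ θ in (0 : ℝ)..Real.pi,
        F (β m + 2 * α m * Real.cos θ) * Real.cos ((0 : ℤ) * θ) := by
      refine intervalIntegral.integral_pos Real.pi_pos (by fun_prop) (fun θ _ => ?_)
        ⟨Real.arccos x, ⟨Real.arccos_nonneg _, Real.arccos_le_pi _⟩, ?_⟩
      · simpa using hF0 _
      · rw [hval]
        simp [hF, hδ0]
    have hpi := Real.pi_pos
    positivity
  obtain ⟨R, hR⟩ := (hKcompact m).isBounded.exists_norm_le
  set B := max (R + δ) (|β m| + 2 * α m) with hB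
  have key : ∀ η > 0, chebCoeff (α m) (β m) F 0 ≤ 2 * η := by
    intro η hη
    obtain ⟨q, hq⟩ := exists_polynomial_near_of_continuousOn (-B) B F hFc.continuousOn η hη
    have h1 := tendsto_integral_eval_rho_sq E a b α β τ ha hb hc m q
    have h2 := tail_eval E K hKmoment m q
    have h3 : chebCoeff (α m) (β m) (fun u => q.eval u) 0 ≤ η + 0 := by
      refine le_of_tendsto_of_tendsto h1 (h2.2.const_add η) ?_
      filter_upwards [eventually_abs_nu_sub_le E μ K hsup m hδ0, eventually_ge_atTop 1,
        eventually_le_numSupp E a b hab α hα ha 0] with n hn hn1 hS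
      simp only [add_zero] at hS
      have hi : ((n - 1 : ℕ) : ℕ∞) < numSupp (E n) m.succ :=
        lt_of_lt_of_le (by exact_mod_cast Nat.sub_lt hn1 one_pos) (hS m)
      have h4 := hasSum_eval_mul_rho_sq (E n) (a n) (b n) (hab n) m q hi
      have h5 := hasSum_rho_mul_rho (E n) m.succ hi hi
      rw [if_pos rfl] at h5
      have h6 := tsum_mul_rho_sq_le (E n) (a n) (b n) (hab n) hS m q
        (g := (lattice n (K m))ᶜ.indicator fun z => |q.eval ((E n).ν m.succ z)|)
        (fun y => Set.indicator_nonneg (fun z _ => abs_nonneg _) y) (fun y => by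
          by_cases hy : y ∈ (lattice n (K m))ᶜ
          · simp [Set.indicator_of_mem hy]
          · simp [Set.indicator_of_notMem hy]) ⟨n - 1, Nat.sub_lt hn1 one_pos⟩
      refine le_trans (hasSum_le (fun y => ?_) h4 ((h5.mul_left η).add h6.1.hasSum)) ?_
      · have hsq := mul_self_nonneg (rho (E n) m.succ (n - 1) y)
        rw [← add_mul]
        refine mul_le_mul_of_nonneg_right ?_ hsq
        by_cases hy : y ∈ lattice n (K m)
        · rw [Set.indicator_of_notMem (by simpa using hy), add_zero]
          have hmem : μ m ((y : ℝ) / n) ∈ μ m '' K m := ⟨_, hy, rfl⟩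
          have h7 := hn y hy
          have h8 := hFK _ _ hmem h7
          have h9 : (E n).ν m.succ y ∈ Set.Icc (-B) B := by
            rw [Set.mem_Icc, ← abs_le]
            have := hR _ hmem
            rw [Real.norm_eq_abs] at this
            have h10 := abs_sub_abs_le_abs_sub ((E n).ν m.succ y) (μ m ((y : ℝ) / n))
            exact le_trans (by linarith) (le_max_left _ _)
          have h11 := hq _ h9
          rw [h8, sub_zero] at h11
          exact (le_abs_self _).trans h11.le
        · rw [Set.indicator_of_mem (by simpa using hy)]
          exact (le_abs_self _).trans (by linarith)
      · rw [mul_one]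
        gcongr
        exact h6.2
    have h4 : chebCoeff (α m) (β m) F 0 ≤ chebCoeff (α m) (β m) (fun u => q.eval u) 0 + η := by
      have e := chebCoeff_add (α m) (β m) q.continuous (continuous_const (y := η)) 0
      have e2 : chebCoeff (α m) (β m) (fun _ => η) 0 = η := by
        have := chebCoeff_const_mul (α m) (β m) (F := fun _ => 1) η 0
        rw [chebCoeff_one] at this
        simpa using this
      rw [e2] at e
      rw [← e, chebCoeff, chebCoeff]
      have hpi := Real.pi_pos
      refine mul_le_mul_of_nonneg_left ?_ (by positivity)
      refine intervalIntegral.integral_mono_on hpi.le (intervalIntegrable_cheb _ _ hFc _)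
        (intervalIntegrable_cheb _ _ (F := fun u => q.eval u + η) (by fun_prop) _) fun θ _ => ?_
      simp only [Int.cast_zero, zero_mul, Real.cos_zero, mul_one]
      have hmem : β m + 2 * α m * Real.cos θ ∈ Set.Icc (-B) B := by
        rw [Set.mem_Icc, ← abs_le]
        have h1 := abs_add_le (β m) (2 * α m * Real.cos θ)
        rw [abs_mul, abs_of_pos (by linarith [hα m] : 0 < 2 * α m)] at h1
        have h2 := Real.abs_cos_le_one θ
        refine le_trans ?_ (le_max_right _ _)
        nlinarith [hα m]
      have := (abs_lt.1 (hq _ hmem)).1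
      linarith
    linarith
  have := key (chebCoeff (α m) (β m) F 0 / 4) (by positivity)
  linarith

end Inclusion

/-! ### Polynomial approximation of the test function -/

lemma exists_derivative_eq (p : Polynomial ℝ) : ∃ q : Polynomial ℝ, q.derivative = p := by
  induction p using Polynomial.induction_on' with
  | add p q hp hq =>
    obtain ⟨p', rfl⟩ := hp
    obtain ⟨q', rfl⟩ := hq
    exact ⟨p' + q', by simp⟩
  | monomial k c =>
    refine ⟨Polynomial.monomial (k + 1) (c / (k + 1)), ?_⟩
    rw [Polynomial.derivative_monomial, Nat.add_sub_cancel]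
    congr 1
    push_cast
    field_simp

/-- If the displacements `v - u` and `v' - u'` of two points are at most `s`, and their difference is
at most `s |u - u'|`, then the same holds, up to a constant, for the increments of `q`. -/
lemma exists_increment_bound (q : Polynomial ℝ) {R : ℝ} (hR : 0 ≤ R) :
    ∃ C : ℝ, 0 ≤ C ∧ (∀ u, |u| ≤ R → |q.eval u| ≤ C) ∧
      (∀ u v, |u| ≤ R → |v| ≤ R → |q.eval u - q.eval v| ≤ C * |u - v|) ∧
      ∀ u v u' v' s, |u| ≤ R → |v| ≤ R → |u'| ≤ R → |v'| ≤ R → 0 ≤ s → s ≤ 1 →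
        |v - u| ≤ s → |v' - u'| ≤ s → |(v - u) - (v' - u')| ≤ s * |u - u'| →
        |(q.eval v - q.eval u) - (q.eval v' - q.eval u')| ≤ C * s * |u - u'| := by
  induction q using Polynomial.induction_on with
  | C c =>
    refine ⟨|c|, abs_nonneg c, by simp, fun u v _ _ => ?_, fun u v u' v' s _ _ _ _ hs _ _ _ _ => ?_⟩
    · simp; positivity
    · simp; positivity
  | add p q hp hq =>
    obtain ⟨C, hC, h1, h2, h3⟩ := hp
    obtain ⟨D, hD, k1, k2, k3⟩ := hq
    refine ⟨C + D, by positivity, fun u hu => ?_, fun u v hu hv => ?_,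
      fun u v u' v' s hu hv hu' hv' hs hs1 e1 e2 e3 => ?_⟩
    · rw [Polynomial.eval_add]
      exact (abs_add_le _ _).trans (add_le_add (h1 u hu) (k1 u hu))
    · simp only [Polynomial.eval_add]
      have := (abs_add_le _ _).trans (add_le_add (h2 u v hu hv) (k2 u v hu hv))
      refine le_trans (le_of_eq ?_) (this.trans (le_of_eq (by ring)))
      congr 1; ring
    · simp only [Polynomial.eval_add]
      have := (abs_add_le _ _).trans (add_le_add (h3 u v u' v' s hu hv hu' hv' hs hs1 e1 e2 e3)
        (k3 u v u' v' s hu hv hu' hv' hs hs1 e1 e2 e3))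
      refine le_trans (le_of_eq ?_) (this.trans (le_of_eq (by ring)))
      congr 1; ring
  | monomial n c ih =>
    have e : Polynomial.C c * Polynomial.X ^ (n + 1)
        = Polynomial.X * (Polynomial.C c * Polynomial.X ^ n) := by ring
    rw [e]
    generalize Polynomial.C c * Polynomial.X ^ n = p at ih
    obtain ⟨C, hC, h1, h2, h3⟩ := ih
    refine ⟨(R + 4) * C, by positivity, fun u hu => ?_, fun u v hu hv => ?_,
      fun u v u' v' s hu hv hu' hv' hs hs1 e1 e2 e3 => ?_⟩
    · rw [Polynomial.eval_mul, Polynomial.eval_X, abs_mul]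
      exact mul_le_mul (by linarith) (h1 u hu) (abs_nonneg _) (by linarith)
    · simp only [Polynomial.eval_mul, Polynomial.eval_X]
      have e : u * p.eval u - v * p.eval v = u * (p.eval u - p.eval v) + (u - v) * p.eval v := by
        ring
      rw [e]
      refine (abs_add_le _ _).trans ?_
      rw [abs_mul, abs_mul]
      have i1 : |u| * |p.eval u - p.eval v| ≤ R * (C * |u - v|) :=
        mul_le_mul hu (h2 u v hu hv) (abs_nonneg _) hR
      have i2 : |u - v| * |p.eval v| ≤ |u - v| * C :=
        mul_le_mul_of_nonneg_left (h1 v hv) (abs_nonneg _)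
      have : 0 ≤ C * |u - v| := by positivity
      nlinarith
    · simp only [Polynomial.eval_mul, Polynomial.eval_X]
      set Q := p.eval v - p.eval u with hQ
      set Q' := p.eval v' - p.eval u' with hQ'
      have e : (v * p.eval v - u * p.eval u) - (v' * p.eval v' - u' * p.eval u')
          = v * (Q - Q') + (v - v') * Q' + ((v - u) - (v' - u')) * p.eval u
            + (v' - u') * (p.eval u - p.eval u') := by
        rw [hQ, hQ']; ring
      rw [e]
      have i1 : |v * (Q - Q')| ≤ R * (C * s * |u - u'|) := by
        rw [abs_mul]
        exact mul_le_mul hv (h3 u v u' v' s hu hv hu' hv' hs hs1 e1 e2 e3) (abs_nonneg _) hR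
      have j1 : |v - v'| ≤ 2 * |u - u'| := by
        have : v - v' = (u - u') + ((v - u) - (v' - u')) := by ring
        rw [this]
        refine (abs_add_le _ _).trans ?_
        nlinarith [abs_nonneg (u - u')]
      have j2 : |Q'| ≤ C * s := (h2 v' u' hv' hu').trans (mul_le_mul_of_nonneg_left e2 hC)
      have i2 : |(v - v') * Q'| ≤ (2 * |u - u'|) * (C * s) := by
        rw [abs_mul]
        exact mul_le_mul j1 j2 (abs_nonneg _) (by positivity)
      have i3 : |((v - u) - (v' - u')) * p.eval u| ≤ (s * |u - u'|) * C := by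
        rw [abs_mul]
        exact mul_le_mul e3 (h1 u hu) (abs_nonneg _) (by positivity)
      have i4 : |(v' - u') * (p.eval u - p.eval u')| ≤ s * (C * |u - u'|) := by
        rw [abs_mul]
        exact mul_le_mul e2 (h2 u u' hu hu') (abs_nonneg _) hs
      calc _ ≤ |v * (Q - Q')| + |(v - v') * Q'| + |((v - u) - (v' - u')) * p.eval u|
            + |(v' - u') * (p.eval u - p.eval u')| :=
            (abs_add_le _ _).trans (add_le_add_left ((abs_add_le _ _).trans
              (add_le_add_left (abs_add_le _ _) _)) _)
        _ ≤ R * (C * s * |u - u'|) + (2 * |u - u'|) * (C * s) + (s * |u - u'|) * C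
            + s * (C * |u - u'|) := by gcongr
        _ = _ := by ring

lemma abs_sub_sub_le_of_deriv {F : ℝ → ℝ} (hF : ContDiff ℝ 1 F) (q : Polynomial ℝ) {R δ : ℝ}
    (h : ∀ u, |u| ≤ R → |deriv F u - q.derivative.eval u| ≤ δ) {u v : ℝ} (hu : |u| ≤ R)
    (hv : |v| ≤ R) : |(F u - q.eval u) - (F v - q.eval v)| ≤ δ * |u - v| := by
  have hd : ∀ x, HasDerivAt (fun x => F x - q.eval x) (deriv F x - q.derivative.eval x) x :=
    fun x => ((hF.differentiable one_ne_zero x).hasDerivAt).sub (q.hasDerivAt x)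
  have := (convex_Icc (-R) R).norm_image_sub_le_of_norm_hasDerivWithin_le
    (f := fun x => F x - q.eval x) (fun x _ => (hd x).hasDerivWithinAt) (C := δ) (fun x hx => h x (abs_le.2 hx))
    (abs_le.1 hv) (abs_le.1 hu)
  simpa only [Real.norm_eq_abs] using this

/-- A polynomial whose derivative approximates that of a given `C¹` function. -/
lemma exists_polynomial_deriv_near {F : ℝ → ℝ} (hF : ContDiff ℝ 1 F) (R : ℝ) {δ : ℝ}
    (hδ : 0 < δ) :
    ∃ q : Polynomial ℝ, ∀ u, |u| ≤ R → |deriv F u - q.derivative.eval u| ≤ δ := by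
  obtain ⟨p, hp⟩ := exists_polynomial_near_of_continuousOn (-R) R (deriv F)
    (hF.continuous_deriv le_rfl).continuousOn δ hδ
  obtain ⟨q, rfl⟩ := exists_derivative_eq p
  refine ⟨q, fun u hu => ?_⟩
  rw [abs_sub_comm]
  exact (hp u (abs_le.1 hu)).le

section Approximation

variable {N : ℕ} (E : ∀ n : ℕ, ExtendedEnsemble N n) (a b : ℕ → Fin N → ℕ → ℝ)
    (hab : ∀ n m, IsRecurrence ((E n).ν m.succ) ((E n).w m.succ) ((E n).p m.succ)
      (a n m) (b n m))
    (μ : Fin N → ℝ → ℝ) (K : Fin N → Set ℝ)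
    (hμinj : ∀ m, Set.InjOn (μ m) (K m))
    (hνinj : ∀ n m, 0 < n → Set.InjOn ((E n).ν m.succ) (lattice n (K m)))
    (hKmoment : ∀ k : ℕ, Tendsto (fun n : ℕ => (n : ENNReal) *
      ∫⁻ y, ENNReal.ofReal (outerMoment (E n) K k y) ∂(E n).law) atTop (𝓝 0))
    (hKmoment' : ∀ k : ℕ, Tendsto (fun n : ℕ => (n : ENNReal) *
      ∫⁻ y, ENNReal.ofReal (linStat
        (fun m => Set.indicator (K m)ᶜ fun x => |μ m x| ^ k) y) ∂(E n).law) atTop (𝓝 0))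
    (hsup : ∀ m, Tendsto (fun n : ℕ => ⨆ y ∈ lattice n (K m),
      ENNReal.ofReal |(E n).ν m.succ y - μ m ((y : ℝ) / n)|) atTop (𝓝 0))
    (hlip : ∀ m, Tendsto (fun n : ℕ => lipConst
      (fun u => compInv n (μ m) ((E n).ν m.succ) (K m) u - u)
      ((E n).ν m.succ '' lattice n (K m))) atTop (𝓝 0))
    (α : Fin N → ℝ) (hα : ∀ m, 0 < α m)
    (ha : ∀ m (j : ℤ), Tendsto (fun n : ℕ => a n m ((n : ℤ) + j).toNat) atTop (𝓝 (α m)))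

include hνinj hlip in
/-- The Lipschitz condition on `μ ∘ μ_n⁻¹ - id`, read off at lattice points. -/
lemma eventually_abs_increment_le (m : Fin N) {s : ℝ} (hs : 0 < s) :
    ∀ᶠ n : ℕ in atTop, ∀ x ∈ lattice n (K m), ∀ y ∈ lattice n (K m),
      |(μ m ((x : ℝ) / n) - (E n).ν m.succ x) - (μ m ((y : ℝ) / n) - (E n).ν m.succ y)|
        ≤ s * |(E n).ν m.succ x - (E n).ν m.succ y| := by
  filter_upwards [(hlip m).eventually_lt_const (ENNReal.ofReal_pos.2 hs), eventually_gt_atTop 0]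
    with n hn hn0 x hx y hy
  have hinj := hνinj n m hn0
  by_cases hxy : (E n).ν m.succ x = (E n).ν m.succ y
  · have := hinj hx hy hxy
    subst this
    simp
  have hcomp : ∀ x ∈ lattice n (K m), compInv n (μ m) ((E n).ν m.succ) (K m) ((E n).ν m.succ x)
      = μ m ((x : ℝ) / n) := by
    intro x hx
    rw [compInv, hinj.leftInvOn_invFunOn hx]
  have h1 : ENNReal.ofReal |((fun u => compInv n (μ m) ((E n).ν m.succ) (K m) u - u)
        ((E n).ν m.succ x) - (fun u => compInv n (μ m) ((E n).ν m.succ) (K m) u - u)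
        ((E n).ν m.succ y)) / ((E n).ν m.succ x - (E n).ν m.succ y)| ≤ ENNReal.ofReal s := by
    refine le_trans ?_ hn.le
    rw [lipConst]
    refine le_trans ?_ (le_iSup₂ ((E n).ν m.succ x) ⟨x, hx, rfl⟩)
    refine le_trans ?_ (le_iSup₂ ((E n).ν m.succ y) ⟨y, hy, rfl⟩)
    exact le_iSup_of_le hxy le_rfl
  rw [ENNReal.ofReal_le_ofReal_iff hs.le, abs_div,
    div_le_iff₀ (abs_pos.2 (sub_ne_zero.2 hxy))] at h1
  simpa only [hcomp x hx, hcomp y hy] using h1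

include hab hμinj hνinj hKmoment hKmoment' hsup hlip hα ha in
/-- A linear statistic at one time is close in `L¹`, after centring, to that of a polynomial `q`,
if `q'` is close to the derivative of `f ∘ μ⁻¹`. -/
theorem eventually_integral_abs_sub_le (m : Fin N) {f F : ℝ → ℝ} (hF : ContDiff ℝ 1 F)
    (hfF : Set.EqOn (fun u => f (Function.invFunOn (μ m) (K m) u)) F (μ m '' K m))
    {C : ℝ} {d : ℕ} (hfg : ∀ x, |f x| ≤ C * (1 + |μ m x| ^ d)) (q : Fin N → Polynomial ℝ)
    {R δ : ℝ} (hR0 : 0 ≤ R) (hR : ∀ u ∈ μ m '' K m, |u| ≤ R) (hδ : 0 < δ)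
    (hq : ∀ u, |u| ≤ R + 1 → |deriv F u - (q m).derivative.eval u| ≤ δ) :
    ∀ᶠ n : ℕ in atTop,
      Integrable (fun y : Config N n => stat (fun z => f ((z : ℝ) / n)) (y m.succ)) (E n).law ∧
      Integrable (centredVar E a b q n m) (E n).law ∧
      ∫ y : Config N n, |(stat (fun z => f ((z : ℝ) / n)) (y m.succ)
        - ∫ y : Config N n, stat (fun z => f ((z : ℝ) / n)) (y m.succ) ∂(E n).law)
        - centredVar E a b q n m y| ∂(E n).law ≤ δ * (3 * α m + 4) := by
  have hα' := hα m
  obtain ⟨Cq, hCq, hq1, -, hq3⟩ := exists_increment_bound (q m) (show 0 ≤ R + 1 by linarith)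
  obtain ⟨M₀, hM₀⟩ := (isCompact_Icc (a := -R) (b := R)).exists_bound_of_continuousOn
    hF.continuous.continuousOn
  set M := |M₀| + Cq with hM
  have hM0 : 0 ≤ M := by positivity
  -- `s` bounds the distance of `μ_n` to `μ`, and the Lipschitz constant of `μ ∘ μ_n⁻¹ - id`
  set s := min 1 (δ / (Cq + 1)) with hs
  have hs0 : 0 < s := by positivity
  have hs1 : s ≤ 1 := min_le_left _ _
  have hsC : Cq * s ≤ δ := by
    calc Cq * s ≤ (Cq + 1) * (δ / (Cq + 1)) := by
          gcongr
          · linarith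
          · exact min_le_right _ _
      _ = δ := by field_simp
  -- the tail of `f`
  have htf := eventually_integrable_stat_comb E K (J := d + 1)
    (fun k => (if k = 0 then C else 0) + (if k = d then C else 0)) m
    (h := fun n k z => |μ m ((z : ℝ) / n)| ^ k) fun k => tail_mu E μ K hKmoment' m k
  have hcomb : ∀ t : ℝ, ∑ k ∈ Finset.range (d + 1),
      ((if k = 0 then C else 0) + (if k = d then C else 0)) * t ^ k = C * (1 + t ^ d) := by
    intro t
    simp only [add_mul, Finset.sum_add_distrib, ite_mul, zero_mul, Finset.sum_ite_eq',
      Finset.mem_range]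
    rw [if_pos (by omega), if_pos (by omega)]
    ring
  simp only [hcomb] at htf
  have htq := tail_eval E K hKmoment m (q m)
  have ht0 := tail_nu E K hKmoment m 0
  simp only [pow_zero] at ht0
  have ha' : Tendsto (fun n => a n m (n - 1)) atTop (𝓝 (α m)) :=
    (ha m (-1)).congr fun n => by rw [show ((n : ℤ) + -1).toNat = n - 1 by omega]
  filter_upwards [htf.1, htf.2.eventually_lt_const (show (0 : ℝ) < δ / 2 by positivity), htq.1,
    htq.2.eventually_lt_const (show (0 : ℝ) < δ / 2 by positivity),
    ht0.2.eventually_lt_const (show (0 : ℝ) < δ ^ 2 / (M ^ 2 + 1) by positivity),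
    ha'.eventually_lt_const (show α m < α m + 1 / 3 by linarith),
    ha'.eventually_const_lt hα',
    eventually_abs_nu_sub_le E μ K hsup m hs0,
    eventually_abs_increment_le E μ K hνinj hlip m hs0,
    eventually_le_numSupp E a b hab α hα ha 1, eventually_gt_atTop 0]
    with n hf1 hf2 hq1' hq2' h0 ha1 ha2 hclose hinc hS1 hn
  have hS : ∀ m : Fin N, (n : ℕ∞) ≤ numSupp (E n) m.succ := fun m =>
    le_trans (by exact_mod_cast Nat.le_succ n) (hS1 m)
  have hSm : (n : ℕ∞) < numSupp (E n) m.succ :=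
    lt_of_lt_of_le (by exact_mod_cast Nat.lt_succ_self n) (hS1 m)
  set L := lattice n (K m) with hL
  set ν := (E n).ν m.succ with hν
  -- the part inside `K`
  set D : ℤ → ℝ := L.indicator fun z => F (μ m ((z : ℝ) / n)) - (q m).eval (ν z) with hD
  have hmem : ∀ z ∈ L, μ m ((z : ℝ) / n) ∈ μ m '' K m := fun z hz => ⟨_, hz, rfl⟩
  have hμR : ∀ z ∈ L, |μ m ((z : ℝ) / n)| ≤ R := fun z hz => hR _ (hmem z hz)
  have hνR : ∀ z ∈ L, |ν z| ≤ R + 1 := by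
    intro z hz
    have h1 := abs_sub_abs_le_abs_sub (ν z) (μ m ((z : ℝ) / n))
    have h2 := hclose z hz
    have h3 := hμR z hz
    linarith
  have hDM : ∀ z, |D z| ≤ M := by
    intro z
    by_cases hz : z ∈ L
    · rw [hD, Set.indicator_of_mem hz]
      refine (abs_sub _ _).trans ?_
      have h1 := hM₀ _ (abs_le.1 (hμR z hz))
      rw [Real.norm_eq_abs] at h1
      exact add_le_add (h1.trans (le_abs_self _)) (hq1 _ (hνR z hz))
    · rw [hD, Set.indicator_of_notMem hz, abs_zero]
      exact hM0
  have hD0 : ∀ z, z ∉ L → D z = 0 := fun z hz => Set.indicator_of_notMem hz _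
  have hDL : ∀ x ∈ L, ∀ y ∈ L, |D x - D y| ≤ 3 * δ * |ν x - ν y| := by
    intro x hx y hy
    simp only [hD, Set.indicator_of_mem hx, Set.indicator_of_mem hy]
    set u := μ m ((x : ℝ) / n) with hu
    set v := μ m ((y : ℝ) / n) with hv
    have hincxy := hinc x hx y hy
    have huv : |u - v| ≤ 2 * |ν x - ν y| := by
      have e : u - v = (ν x - ν y) + ((u - ν x) - (v - ν y)) := by ring
      rw [e]
      refine (abs_add_le _ _).trans ?_
      nlinarith [abs_nonneg (ν x - ν y)]
    have h1 := abs_sub_sub_le_of_deriv hF (q m) hq (u := u) (v := v)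
      (by linarith [hμR x hx]) (by linarith [hμR y hy])
    have h2 := hq3 (ν x) u (ν y) v s (hνR x hx) (by linarith [hμR x hx]) (hνR y hy)
      (by linarith [hμR y hy]) hs0.le hs1 (by rw [abs_sub_comm]; exact hclose x hx)
      (by rw [abs_sub_comm]; exact hclose y hy) hincxy
    have e : (F u - (q m).eval (ν x)) - (F v - (q m).eval (ν y))
        = ((F u - (q m).eval u) - (F v - (q m).eval v))
          + (((q m).eval u - (q m).eval (ν x)) - ((q m).eval v - (q m).eval (ν y))) := by ring
    rw [e]
    refine (abs_add_le _ _).trans ((add_le_add h1 h2).trans ?_)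
    have h3 : δ * |u - v| ≤ δ * (2 * |ν x - ν y|) := by gcongr
    have h4 : Cq * s * |ν x - ν y| ≤ δ * |ν x - ν y| := by gcongr
    linarith
  have hsumm : ∀ {g : ℤ → ℝ} {B : ℝ}, (∀ z, |g z| ≤ B) → ∀ i : Fin n,
      Summable fun y => (g y * rho (E n) m.succ i y) ^ 2 := fun hg i =>
    summable_sq_of_le_eval (E n) (a n) (b n) (hab n) m (Polynomial.C _)
      (lt_numSupp_of_fin (E n) hS m i) fun y => by
        rw [Polynomial.eval_C]
        exact (hg y).trans (le_abs_self _)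
  obtain ⟨hDmem, hDmean, hDvar⟩ :=
    integral_stat (E n) (a n) (b n) (hab n) hS m D (hsumm hDM)
  have h1mean := (integral_stat (E n) (a n) (b n) (hab n) hS m (Lᶜ.indicator fun _ => 1)
    (hsumm (B := 1) fun z => by
      by_cases hz : z ∈ Lᶜ
      · simp [Set.indicator_of_mem hz]
      · simp [Set.indicator_of_notMem hz])).2.1
  have hvar := projVar_le (orthonormal_rho (E n) m.succ (hS m)) ν
    (hasSum_increments_nu (E n) (a n) (b n) (hab n) m hn.ne' hSm) L hDM hD0 hDL
  rw [← h1mean, ← hDvar] at hvar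
  -- `3 δ` is the Lipschitz constant of `D` with respect to `ν`, whose variance is `a_{n-1}²`;
  -- the points outside `K` contribute at most `δ²`
  set c := δ * (3 * α m + 2) with hc
  have hc0 : 0 < c := by positivity
  have hvarc : ∫ y : Config N n, (stat D (y m.succ)
      - ∑ k, gMat (fun k : Fin n => rho (E n) m.succ k) D k k) ^ 2 ∂(E n).law ≤ c ^ 2 := by
    refine hvar.trans ?_
    have h1 : M ^ 2 * ∫ y : Config N n, stat (Lᶜ.indicator fun _ => 1) (y m.succ) ∂(E n).law
        ≤ δ ^ 2 := by
      calc _ ≤ (M ^ 2 + 1) * (δ ^ 2 / (M ^ 2 + 1)) := by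
            refine mul_le_mul (by linarith) h0.le ?_ (by positivity)
            exact integral_nonneg fun y =>
              stat_nonneg (fun z => Set.indicator_nonneg (fun _ _ => zero_le_one) z) _
        _ = _ := by field_simp
    have h2 : a n m (n - 1) ^ 2 ≤ (α m + 1 / 3) ^ 2 := by gcongr
    have h3 : (3 * δ) ^ 2 * a n m (n - 1) ^ 2 ≤ (3 * δ) ^ 2 * (α m + 1 / 3) ^ 2 := by gcongr
    rw [hc]
    have : 0 < δ ^ 2 := by positivity
    nlinarith
  rw [← hDmean] at hvarc
  -- the part outside `K`
  set T : ℤ → ℝ := Lᶜ.indicator fun z => f ((z : ℝ) / n) - (q m).eval (ν z) with hT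
  set U : Config N n → ℝ := fun y =>
    stat (Lᶜ.indicator fun z => C * (1 + |μ m ((z : ℝ) / n)| ^ d)) (y m.succ)
    + stat (Lᶜ.indicator fun z => |(q m).eval (ν z)|) (y m.succ) with hU
  have hUint : Integrable U (E n).law := hf1.add hq1'
  have hTU : ∀ y : Config N n, |stat T (y m.succ)| ≤ U y := by
    intro y
    refine (Finset.abs_sum_le_sum_abs _ _).trans ?_
    simp only [hU, stat, ← Finset.sum_add_distrib]
    refine Finset.sum_le_sum fun j _ => ?_
    by_cases hz : y m.succ j ∈ Lᶜ
    · simp only [hT, Set.indicator_of_mem hz]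
      exact (abs_sub _ _).trans (add_le_add (hfg _) le_rfl)
    · simp [hT, Set.indicator_of_notMem hz]
  have hTint : Integrable (fun y : Config N n => stat T (y m.succ)) (E n).law :=
    hUint.mono' Measurable.of_discrete.aestronglyMeasurable (.of_forall hTU)
  have hUle : ∫ y, U y ∂(E n).law ≤ δ := by
    rw [hU, integral_add hf1 hq1']
    linarith
  have hTle : ∫ y : Config N n, |stat T (y m.succ)| ∂(E n).law ≤ δ :=
    (integral_mono hTint.abs hUint hTU).trans hUle
  -- the decomposition
  obtain ⟨hQmem, hQmean⟩ := integral_stat_eval (E n) (a n) (b n) (hab n) hS m (q m)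
  have hDint := hDmem.integrable one_le_two
  have hQint := hQmem.integrable one_le_two
  have hdec : ∀ y : Config N n, stat (fun z => f ((z : ℝ) / n)) (y m.succ)
      = stat D (y m.succ) + stat T (y m.succ) + stat (fun z => (q m).eval (ν z)) (y m.succ) := by
    intro y
    simp only [stat, ← Finset.sum_add_distrib]
    refine Finset.sum_congr rfl fun j _ => ?_
    by_cases hz : y m.succ j ∈ L
    · have h1 : f ((y m.succ j : ℝ) / n) = F (μ m ((y m.succ j : ℝ) / n)) := by
        rw [← hfF (hmem _ hz)]
        simp only
        rw [(hμinj m).leftInvOn_invFunOn hz]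
      rw [hD, hT, Set.indicator_of_mem hz, Set.indicator_of_notMem (by simpa using hz), h1]
      ring
    · rw [hD, hT, Set.indicator_of_notMem hz, Set.indicator_of_mem (by simpa using hz)]
      ring
  have hXint : Integrable (fun y : Config N n => stat (fun z => f ((z : ℝ) / n)) (y m.succ))
      (E n).law :=
    ((hDint.add hTint).add hQint).congr (.of_forall fun y => (hdec y).symm)
  refine ⟨hXint, hQint.sub (integrable_const _), ?_⟩
  have hmean : ∫ y : Config N n, stat (fun z => f ((z : ℝ) / n)) (y m.succ) ∂(E n).law
      = (∫ y : Config N n, stat D (y m.succ) ∂(E n).law)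
        + (∫ y : Config N n, stat T (y m.succ) ∂(E n).law)
        + ptr n (multOp E a b q m n) := by
    have hDT : Integrable (fun y : Config N n => stat D (y m.succ) + stat T (y m.succ)) (E n).law :=
      hDint.add hTint
    simp only [hdec]
    rw [integral_add hDT hQint, integral_add hDint hTint, hQmean]
    rfl
  set eD := ∫ y : Config N n, stat D (y m.succ) ∂(E n).law with heD
  set eT := ∫ y : Config N n, stat T (y m.succ) ∂(E n).law with heT
  have heTle : |eT| ≤ δ := (abs_integral_le_integral_abs).trans hTle
  have hDsq : Integrable (fun y : Config N n => (stat D (y m.succ) - eD) ^ 2) (E n).law :=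
    (hDmem.sub (memLp_const eD)).integrable_sq
  have hpt : ∀ y : Config N n, |(stat (fun z => f ((z : ℝ) / n)) (y m.succ)
      - ∫ y : Config N n, stat (fun z => f ((z : ℝ) / n)) (y m.succ) ∂(E n).law)
      - centredVar E a b q n m y|
      ≤ (c / 2 + (stat D (y m.succ) - eD) ^ 2 / (2 * c)) + |stat T (y m.succ)| + δ := by
    intro y
    rw [hmean, hdec y, centredVar, centredStat]
    have e : (stat D (y m.succ) + stat T (y m.succ) + stat (fun z => (q m).eval (ν z)) (y m.succ)
        - (eD + eT + ptr n (multOp E a b q m n)))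
        - (stat (fun z => (q m).eval ((E n).ν m.succ z)) (y m.succ) - ptr n (multOp E a b q m n))
        = (stat D (y m.succ) - eD) + stat T (y m.succ) - eT := by
      rw [← hν]; ring
    rw [e]
    -- the inequality `2 c t ≤ c² + t²` passes from the second moment to the first
    have h1 : |stat D (y m.succ) - eD| ≤ c / 2 + (stat D (y m.succ) - eD) ^ 2 / (2 * c) := by
      rw [← sq_abs (stat D (y m.succ) - eD)]
      set t := |stat D (y m.succ) - eD|
      have : c / 2 + t ^ 2 / (2 * c) - t = (c - t) ^ 2 / (2 * c) := by field_simp; ring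
      have h2 : 0 ≤ (c - t) ^ 2 / (2 * c) := by positivity
      linarith
    refine (abs_sub _ _).trans (add_le_add ((abs_add_le _ _).trans ?_) heTle)
    exact add_le_add h1 le_rfl
  have hb1 : Integrable (fun y : Config N n =>
      c / 2 + (stat D (y m.succ) - eD) ^ 2 / (2 * c)) (E n).law :=
    (integrable_const _).add (hDsq.div_const _)
  have hb2 : Integrable (fun y : Config N n =>
      (c / 2 + (stat D (y m.succ) - eD) ^ 2 / (2 * c)) + |stat T (y m.succ)|) (E n).law :=
    hb1.add hTint.abs
  have hbint : Integrable (fun y : Config N n =>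
      (c / 2 + (stat D (y m.succ) - eD) ^ 2 / (2 * c)) + |stat T (y m.succ)| + δ) (E n).law :=
    hb2.add (integrable_const _)
  refine (integral_mono_of_nonneg (.of_forall fun y => abs_nonneg _) hbint
    (.of_forall hpt)).trans ?_
  rw [integral_add hb2 (integrable_const _), integral_add hb1 hTint.abs,
    integral_add (integrable_const _) (hDsq.div_const _), integral_div (2 * c)]
  simp only [integral_const, probReal_univ, smul_eq_mul, one_mul]
  have h5 : (∫ y : Config N n, (stat D (y m.succ) - eD) ^ 2 ∂(E n).law) / (2 * c) ≤ c / 2 := by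
    rw [div_le_iff₀ (by positivity)]
    linarith [show c / 2 * (2 * c) = c ^ 2 by ring]
  have h6 : c = δ * (3 * α m + 2) := hc
  linarith

end Approximation

/-! ### Continuity of the limiting variance -/

/-- On the limiting interval, which lies in `μ(K)`, the function `f ∘ μ⁻¹` may be replaced by its
`C¹` extension `F`. -/
lemma fourierCos_eq_chebCoeff {f μ F : ℝ → ℝ} {K : Set ℝ} {α β : ℝ} (hα : 0 ≤ α)
    (hI : Set.Icc (β - 2 * α) (β + 2 * α) ⊆ μ '' K)
    (hfF : Set.EqOn (fun u => f (Function.invFunOn μ K u)) F (μ '' K)) (k : ℕ) :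
    fourierCos f μ K α β k = chebCoeff α β F k := by
  rw [fourierCos, chebCoeff]
  congr 1
  refine intervalIntegral.integral_congr fun θ _ => ?_
  have hc := abs_le.1 (Real.abs_cos_le_one θ)
  have := hfF (hI ⟨by nlinarith [hc.1], by nlinarith [hc.2]⟩ : β + 2 * α * Real.cos θ ∈ μ '' K)
  simp only at this
  simp only [this, Int.cast_natCast]

/-- The limiting covariance depends continuously on the derivatives of the test functions. -/
lemma abs_tsum_covTerm_sub_le {α β α' β' l : ℝ} {F G P Q : ℝ → ℝ} (hα : 0 ≤ α) (hα' : 0 ≤ α')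
    (hl : 0 ≤ l) (hF : ContDiff ℝ 1 F) (hG : ContDiff ℝ 1 G) (hP : ContDiff ℝ 1 P)
    (hQ : ContDiff ℝ 1 Q) {M M' δ : ℝ} (hM0 : 0 ≤ M) (hM0' : 0 ≤ M') (hδ : 0 ≤ δ) (hδ1 : δ ≤ 1)
    (hM : ∀ u ∈ Set.Icc (β - 2 * α) (β + 2 * α), |deriv F u| ≤ M)
    (hM' : ∀ u ∈ Set.Icc (β' - 2 * α') (β' + 2 * α'), |deriv G u| ≤ M')
    (hP' : ∀ u ∈ Set.Icc (β - 2 * α) (β + 2 * α), |deriv F u - deriv P u| ≤ δ)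
    (hQ' : ∀ u ∈ Set.Icc (β' - 2 * α') (β' + 2 * α'), |deriv G u - deriv Q u| ≤ δ) :
    |(∑' k, covTerm α β α' β' l F G k) - ∑' k, covTerm α β α' β' l P Q k|
      ≤ δ * (2 * α * α' * (M + M' + 1)) := by
  have hdsub : ∀ {A B : ℝ → ℝ}, ContDiff ℝ 1 A → ContDiff ℝ 1 B → ∀ u,
      deriv (fun u => A u - B u) u = deriv A u - deriv B u := fun hA hB u =>
    deriv_fun_sub (hA.differentiable one_ne_zero u) (hB.differentiable one_ne_zero u)
  have hPM : ∀ u ∈ Set.Icc (β - 2 * α) (β + 2 * α), |deriv P u| ≤ M + 1 := by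
    intro u hu
    have h1 := hM u hu
    have h2 := hP' u hu
    rw [abs_sub_comm] at h2
    have h3 := abs_sub_abs_le_abs_sub (deriv P u) (deriv F u)
    linarith
  have hQM : ∀ u ∈ Set.Icc (β' - 2 * α') (β' + 2 * α'), |deriv Q u| ≤ M' + 1 := by
    intro u hu
    have h1 := hM' u hu
    have h2 := hQ' u hu
    rw [abs_sub_comm] at h2
    have h3 := abs_sub_abs_le_abs_sub (deriv Q u) (deriv G u)
    linarith
  have s1 := covTerm_bound (l := l) hα hα' hl hF hG hM0 hM0' hM hM'
  have s2 := covTerm_bound (l := l) hα hα' hl hP hQ (by positivity) (by positivity) hPM hQM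
  have s3 := covTerm_bound (l := l) hα hα' hl (hF.sub hP) hG hδ hM0'
    (fun u hu => by rw [hdsub hF hP]; exact hP' u hu) hM'
  have s4 := covTerm_bound (l := l) hα hα' hl hP (hG.sub hQ) (by positivity) hδ hPM
    (fun u hu => by rw [hdsub hG hQ]; exact hQ' u hu)
  have e : (∑' k, covTerm α β α' β' l F G k) - ∑' k, covTerm α β α' β' l P Q k
      = (∑' k, covTerm α β α' β' l (fun u => F u - P u) G k)
        + ∑' k, covTerm α β α' β' l P (fun u => G u - Q u) k := by
    rw [← s1.1.tsum_sub s2.1, ← s3.1.tsum_add s4.1]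
    exact tsum_congr fun k =>
      covTerm_sub hF.continuous hG.continuous hP.continuous hQ.continuous k
  rw [e]
  refine (abs_add_le _ _).trans ((add_le_add s3.2 s4.2).trans (le_of_eq ?_))
  ring

lemma linStat_eq_sum_stat {N n : ℕ} (f : Fin N → ℝ → ℝ) (y : Config N n) :
    linStat f y = ∑ m : Fin N, stat (fun z => f m ((z : ℝ) / n)) (y m.succ) := rfl

end QOPE

open QOPE

theorem theorem2p5 (N : ℕ)
    -- for every `n`, an extended ensemble of `n` points; `m : Fin N` stands for the time `t_{m+1}`
    (E : ∀ n : ℕ, QOPE.ExtendedEnsemble N n)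
    -- the recurrence coefficients at the times `t_1, …, t_N`
    (a b : ℕ → Fin N → ℕ → ℝ)
    (hab : ∀ n m, QOPE.IsRecurrence ((E n).ν m.succ) ((E n).w m.succ) ((E n).p m.succ)
      (a n m) (b n m))
    -- the limit `μ` and the sets `K`
    (μ : Fin N → ℝ → ℝ) (K : Fin N → Set ℝ)
    (hμinj : ∀ m, Set.InjOn (μ m) (K m))
    (hνinj : ∀ n m, 0 < n → Set.InjOn ((E n).ν m.succ) (QOPE.lattice n (K m)))
    (hKcompact : ∀ m, IsCompact (μ m '' K m))
    (hKmoment : ∀ k : ℕ, Tendsto (fun n : ℕ => (n : ENNReal) *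
      ∫⁻ y, ENNReal.ofReal (QOPE.outerMoment (E n) K k y) ∂(E n).law) atTop (𝓝 0))
    (hKmoment' : ∀ k : ℕ, Tendsto (fun n : ℕ => (n : ENNReal) *
      ∫⁻ y, ENNReal.ofReal (QOPE.linStat
        (fun m => Set.indicator (K m)ᶜ fun x => |μ m x| ^ k) y) ∂(E n).law) atTop (𝓝 0))
    (hsup : ∀ m, Tendsto (fun n : ℕ => ⨆ y ∈ QOPE.lattice n (K m),
      ENNReal.ofReal |(E n).ν m.succ y - μ m ((y : ℝ) / n)|) atTop (𝓝 0))
    (hlip : ∀ m, Tendsto (fun n : ℕ => QOPE.lipConst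
      (fun u => QOPE.compInv n (μ m) ((E n).ν m.succ) (K m) u - u)
      ((E n).ν m.succ '' QOPE.lattice n (K m))) atTop (𝓝 0))
    (hμlip : ∀ m, QOPE.lipConst (μ m) (K m) < ⊤)
    -- limits of the coefficients
    (α β τ : Fin N → ℝ) (hα : ∀ m, 0 < α m) (hτ : StrictMono τ)
    (ha : ∀ m (j : ℤ), Tendsto (fun n : ℕ => a n m ((n : ℤ) + j).toNat) atTop (𝓝 (α m)))
    (hb : ∀ m (j : ℤ), Tendsto (fun n : ℕ => b n m ((n : ℤ) + j).toNat) atTop (𝓝 (β m)))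
    (hc : ∀ (m : Fin N) (k l : ℤ), Tendsto (fun n : ℕ =>
      (E n).c m.succ ((n : ℤ) + k).toNat / (E n).c m.succ ((n : ℤ) + l).toNat) atTop
      (𝓝 (Real.exp (τ m * (l - k)))))
    -- the test function: `f(t_m, μ⁻¹(·))` is `C¹` on `μ(t_m, K)` and of polynomial growth
    (f : Fin N → ℝ → ℝ)
    (hfC1 : ∀ m, ∃ g : ℝ → ℝ, ContDiff ℝ 1 g ∧
      Set.EqOn (fun u => f m (Function.invFunOn (μ m) (K m) u)) g (μ m '' K m))
    (hfgrowth : ∃ (C : ℝ) (d : ℕ), ∀ m x, |f m x| ≤ C * (1 + |μ m x| ^ d)) :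
    (∀ m, Set.Icc (β m - 2 * α m) (β m + 2 * α m) ⊆ μ m '' K m) ∧
    (∀ᶠ n : ℕ in atTop, Integrable (QOPE.linStat f : QOPE.Config N n → ℝ) (E n).law) ∧
    (∀ r s, Summable (QOPE.varTerm f μ K α β τ r s)) ∧
    0 ≤ QOPE.limVar f μ K α β τ ∧
    TendstoInDistribution
      (fun (n : ℕ) (y : QOPE.Config N n) => QOPE.linStat f y - ∫ z, QOPE.linStat f z ∂(E n).law)
      atTop (id : ℝ → ℝ) (fun n => (E n).law)
      (gaussianReal 0 (QOPE.limVar f μ K α β τ).toNNReal) := by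
  have hI : ∀ m, Set.Icc (β m - 2 * α m) (β m + 2 * α m) ⊆ μ m '' K m :=
    Icc_subset_image E a b hab μ K hKcompact hKmoment hsup α β τ hα ha hb hc
  choose F hF hfF using hfC1
  obtain ⟨C, d, hgrowth⟩ := hfgrowth
  have hterm : ∀ r s, varTerm f μ K α β τ r s
      = covTerm (α r) (β r) (α s) (β s) |τ r - τ s| (F r) (F s) := by
    intro r s
    funext k
    rw [varTerm, covTerm, fourierCos_eq_chebCoeff (hα r).le (hI r) (hfF r),
      fourierCos_eq_chebCoeff (hα s).le (hI s) (hfF s)]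
  have hM : ∀ m, ∃ M : ℝ, 0 ≤ M ∧
      ∀ u ∈ Set.Icc (β m - 2 * α m) (β m + 2 * α m), |deriv (F m) u| ≤ M := by
    intro m
    obtain ⟨M, hM⟩ := (isCompact_Icc (a := β m - 2 * α m)
      (b := β m + 2 * α m)).exists_bound_of_continuousOn
      ((hF m).continuous_deriv le_rfl).continuousOn
    exact ⟨|M|, abs_nonneg M, fun u hu => (hM u hu).trans (le_abs_self M)⟩
  choose M hM0 hM using hM
  have hR : ∃ R : ℝ, 0 ≤ R ∧ ∀ m, ∀ u ∈ μ m '' K m, |u| ≤ R := by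
    have h1 : ∀ m, ∃ R : ℝ, 0 ≤ R ∧ ∀ u ∈ μ m '' K m, |u| ≤ R := by
      intro m
      obtain ⟨R, hR⟩ := (hKcompact m).isBounded.exists_norm_le
      exact ⟨|R|, abs_nonneg R, fun u hu => (hR u hu).trans (le_abs_self R)⟩
    choose R hR0 hR using h1
    exact ⟨∑ m, R m, Finset.sum_nonneg fun m _ => hR0 m, fun m u hu => (hR m u hu).trans
      (Finset.single_le_sum (fun m _ => hR0 m) (Finset.mem_univ m))⟩
  obtain ⟨R, hR0, hR⟩ := hR
  have hsummable : ∀ r s, Summable (varTerm f μ K α β τ r s) := by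
    intro r s
    rw [hterm]
    exact (covTerm_bound (hα r).le (hα s).le (abs_nonneg _) (hF r) (hF s) (hM0 r) (hM0 s)
      (hM r) (hM s)).1
  set V := limVar f μ K α β τ with hV
  set c₁ := ∑ r, ∑ s, 2 * α r * α s * (M r + M s + 1) with hc₁
  set c₂ := ∑ m, (3 * α m + 4) with hc₂
  have hc₁0 : 0 ≤ c₁ := Finset.sum_nonneg fun r _ => Finset.sum_nonneg fun s _ => by
    have := hα r; have := hα s; have := hM0 r; have := hM0 s
    positivity
  have hc₂0 : 0 ≤ c₂ := Finset.sum_nonneg fun m _ => by have := hα m; positivity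
  -- approximation by statistics of polynomials, whose limiting variance `v` is close to `V`
  have happ : ∀ δ : ℝ, 0 < δ → δ ≤ 1 → ∃ (q : Fin N → Polynomial ℝ) (v : ℝ),
      |v - V| ≤ δ * c₁ ∧
      (∀ k : ℕ, Tendsto (fun n => ∫ y, (∑ m, centredVar E a b q n m y) ^ (k + 1) ∂(E n).law
        - k * v * ∫ y, (∑ m, centredVar E a b q n m y) ^ (k - 1) ∂(E n).law) atTop (𝓝 0)) ∧
      ∀ᶠ n : ℕ in atTop, Integrable (linStat f : Config N n → ℝ) (E n).law ∧
        Integrable (fun y : Config N n => (linStat f y - ∫ z, linStat f z ∂(E n).law)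
          - ∑ m, centredVar E a b q n m y) (E n).law ∧
        ∫ y : Config N n, |(linStat f y - ∫ z, linStat f z ∂(E n).law)
          - ∑ m, centredVar E a b q n m y| ∂(E n).law ≤ δ * c₂ := by
    intro δ hδ hδ1
    choose q hq using fun m => exists_polynomial_deriv_near (hF m) (R + 1) hδ
    refine ⟨q, _, ?_, tendsto_integral_pow_recursion E a b hab α β τ hα ha hb hc q, ?_⟩
    · have hqI : ∀ m, ∀ u ∈ Set.Icc (β m - 2 * α m) (β m + 2 * α m),
          |deriv (F m) u - deriv (fun u => (q m).eval u) u| ≤ δ := by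
        intro m u hu
        rw [Polynomial.deriv]
        exact hq m u ((hR m u (hI m hu)).trans (by linarith))
      have hqC : ∀ m, ContDiff ℝ 1 fun u => (q m).eval u := fun m => by
        have h := (q m).contDiff_aeval (𝕜 := ℝ) 1
        simp only [Polynomial.coe_aeval_eq_eval] at h
        exact h
      rw [hV, limVar, hc₁, Finset.mul_sum, ← Finset.sum_sub_distrib]
      refine (Finset.abs_sum_le_sum_abs _ _).trans (Finset.sum_le_sum fun r _ => ?_)
      rw [Finset.mul_sum, ← Finset.sum_sub_distrib]
      refine (Finset.abs_sum_le_sum_abs _ _).trans (Finset.sum_le_sum fun s _ => ?_)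
      rw [symCov_eq_tsum α β τ hτ q r s, hterm, abs_sub_comm]
      exact abs_tsum_covTerm_sub_le (hα r).le (hα s).le (abs_nonneg _) (hF r) (hF s)
        (hqC r) (hqC s) (hM0 r) (hM0 s) hδ.le hδ1 (hM r) (hM s) (hqI r) (hqI s)
    · have hone := fun m => eventually_integral_abs_sub_le E a b hab μ K hμinj hνinj hKmoment
        hKmoment' hsup hlip α hα ha m (hF m) (hfF m) (hgrowth m) q hR0 (hR m) hδ (hq m)
      filter_upwards [eventually_all.2 hone] with n hn
      have hYint : Integrable (fun y => ∑ m, centredVar E a b q n m y) (E n).law :=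
        integrable_finsetSum _ fun m _ => (hn m).2.1
      have hXint : Integrable (linStat f : Config N n → ℝ) (E n).law :=
        integrable_finsetSum _ fun m _ => (hn m).1
      refine ⟨hXint, (hXint.sub (integrable_const _)).sub hYint, ?_⟩
      set D : Fin N → Config N n → ℝ := fun m y => (stat (fun z => f m ((z : ℝ) / n)) (y m.succ)
        - ∫ y : Config N n, stat (fun z => f m ((z : ℝ) / n)) (y m.succ) ∂(E n).law)
        - centredVar E a b q n m y with hD
      have hDint : ∀ m, Integrable (D m) (E n).law := fun m =>
        ((hn m).1.sub (integrable_const _)).sub (hn m).2.1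
      have hmean : ∫ z : Config N n, linStat f z ∂(E n).law
          = ∑ m, ∫ y : Config N n, stat (fun z => f m ((z : ℝ) / n)) (y m.succ) ∂(E n).law := by
        simp only [linStat_eq_sum_stat]
        exact integral_finsetSum _ fun m _ => (hn m).1
      have hsum : ∀ y : Config N n, (linStat f y - ∫ z, linStat f z ∂(E n).law)
          - ∑ m, centredVar E a b q n m y = ∑ m, D m y := by
        intro y
        rw [hmean, linStat_eq_sum_stat, ← Finset.sum_sub_distrib, ← Finset.sum_sub_distrib]
      simp only [hsum]
      calc ∫ y, |∑ m, D m y| ∂(E n).law ≤ ∫ y, ∑ m, |D m y| ∂(E n).law :=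
            integral_mono (integrable_finsetSum _ fun m _ => hDint m).abs
              (integrable_finsetSum _ fun m _ => (hDint m).abs)
              fun y => Finset.abs_sum_le_sum_abs _ _
        _ = ∑ m, ∫ y, |D m y| ∂(E n).law := integral_finsetSum _ fun m _ => (hDint m).abs
        _ ≤ ∑ m, δ * (3 * α m + 4) := Finset.sum_le_sum fun m _ => (hn m).2.2
        _ = δ * c₂ := (Finset.mul_sum _ _ _).symm
  have hintY : ∀ (q : Fin N → Polynomial ℝ) (k : ℕ), ∀ᶠ n : ℕ in atTop,
      Integrable (fun y => (∑ m, centredVar E a b q n m y) ^ k) (E n).law := fun q k =>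
    (eventually_integrable_pow E a b hab α β τ hα ha hb hc q k).mono fun n hn => hn.1
  -- `v` is a limit of second moments
  have hV0 : 0 ≤ V := by
    refine le_of_forall_pos_le_add fun ε hε => ?_
    obtain ⟨q, v, hv, hrec, -⟩ := happ (min 1 (ε / (c₁ + 1))) (by positivity) (min_le_left _ _)
    have hv0 : 0 ≤ v := by
      have h := tendsto_gaussMoment hrec 2
      have e : gaussMoment v 2 = v := by simp [gaussMoment]
      rw [e] at h
      exact ge_of_tendsto' h fun n => integral_nonneg fun y => sq_nonneg _
    have h1 : min 1 (ε / (c₁ + 1)) * c₁ ≤ ε := by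
      calc _ ≤ ε / (c₁ + 1) * (c₁ + 1) := by
            gcongr
            · exact min_le_right _ _
            · linarith
        _ = ε := by field_simp
    have h2 := (abs_le.1 hv).2
    linarith
  refine ⟨hI, ?_, hsummable, hV0, ?_⟩
  · obtain ⟨q, v, -, -, h⟩ := happ 1 one_pos le_rfl
    exact h.mono fun n hn => hn.1
  · refine tendstoInDistribution_gaussian hV0 (fun n => Measurable.of_discrete.aemeasurable) ?_
    refine tendsto_charFun_of_approx
      (fun n => Measurable.of_discrete.aestronglyMeasurable) fun ε hε => ?_
    set δ := min 1 (ε / (c₁ + c₂ + 1)) with hδ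
    have hδ0 : 0 < δ := by positivity
    have h1 : ∀ c, 0 ≤ c → c ≤ c₁ + c₂ + 1 → δ * c ≤ ε := fun c hc0 hc => by
      calc _ ≤ ε / (c₁ + c₂ + 1) * (c₁ + c₂ + 1) := by
            gcongr
            exact min_le_right _ _
        _ = ε := by field_simp
    obtain ⟨q, v, hv, hrec, hX⟩ := happ δ hδ0 (min_le_left _ _)
    refine ⟨fun n y => ∑ m, centredVar E a b q n m y, v, hv.trans (h1 c₁ hc₁0 (by linarith)),
      fun n => Measurable.of_discrete.aestronglyMeasurable, ?_,
      tendsto_charFun_of_moments (hintY q) hrec⟩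
    exact hX.mono fun n hn => ⟨hn.2.1, hn.2.2.trans (h1 c₂ hc₂0 (by linarith))⟩
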